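/- Let $V\in C^1([0,1])$ with $V>0$ on $[0,1]$. Let $\mu_0<\mu_1<\mu_2<\cdots$ be the (simple) eigenvalues of $A=-\partial_{xx}^2+V$ on $[0,1]$ with Neumann boundary conditions, and let $e_n$ be the corresponding eigenfunctions, normalised by $\|e_n\|_{L^2}=1$ and $e_n(0)>0$ (so $e_0>0$ on $[0,1]$). Put $c_n(v)=\int_0^1 e_n v\,dx$, $m_0=\inf_{[0,1]}e_0$, and $$H(u)(x)=\frac{e^{-\frac12\int_0^x u}}{\int_0^1 e^{-\frac12\int_0^y u}\,dy}\quad(u\in L^2([0,1])),\qquad \tilde f_0=\frac{e_0}{\int_0^1 e_0},\qquad s_0=-2\frac{\partial_x e_0}{e_0},$$ $$h_5(t)=\Big(\sum_{q=1}^\infty e^{-2(\mu_q-\mu_0)t}(1+\sqrt{\mu_q})^2\Big)^{1/2}\in[0,\infty].$$ For $\nu=(q_0,q_1,\dots,q_m)\in\mathcal B=\bigcup_{m\ge 0}\mathbb N\times(\mathbb N\setminus\{0\})^m$ let $$\lambda_\nu=\sum_{i=0}^m(\mu_{q_i}-\mu_0),\qquad \varphi_\nu(u_0)=\prod_{i=0}^m\frac{c_{q_i}(H(u_0))}{c_0(H(u_0))},\qquad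 a_\nu(x)=2(-1)^{m+1}\frac{\partial_xe_{q_0}(x)}{e_0(x)}\prod_{i=1}^m\frac{e_{q_i}(x)}{e_0(x)}.$$ Given $u_0\in L^2([0,1])$, a solution of the Burgers equation with data $u_0$ means a function $u$ on $(0,\infty)\times[0,1]$ such that $u,\partial_tu,\partial_xu,\partial^2_{xx}u$ exist and are continuous there, $\partial_tu+u\partial_xu=\partial^2_{xx}u+2\partial_xV$, $u(t,0)=u(t,1)=0$ for $t>0$, and $u(t,\cdot)\to u_0$ in $L^2([0,1])$ as $t\to0^+$. We say that the Koopman decomposition of the orbit of $u_0$ converges absolutely at time $t$ if $$\sum_{\nu\in\mathcal B}e^{-\lambda_\nu t}\,|\varphi_\nu(u_0)|\,\sup_{x\in[0,1]}|a_\nu(x)|<\infty$$ and, for every solution $u$ of the Burgers equation with data $u_0$, $$u(t,x)=\sum_{\nu\in\mathcal B}e^{-\lambda_\nu t}\varphi_\nu(u_0)\,a_\nu(x),$$ the series converging unconditionally (so that it can be summed in any order), uniformly in $x\in[0,1]$. Then: 1. For every $u_0\in L^2([0,1])$ there is exactly one $\tilde\tau_{\mathcal B}(u_0)\in[0,\infty)$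 with $$h_5(\tilde\tau_{\mathcal B}(u_0))=\frac{m_0^2}{\|H(u_0)-c_0(H(u_0))e_0\|_{L^2}}$$ (an equation in $[0,\infty]$, where the right side is $\infty$ if the denominator vanishes), and for every $t>\tilde\tau_{\mathcal B}(u_0)$ the Koopman decomposition of the orbit of $u_0$ converges absolutely at time $t$. 2. For every $\theta_0>0$ the set $\tilde\Omega_{\mathcal B}(\theta_0)=\{u_0\in L^2([0,1]):\ \|H(u_0)-\tilde f_0\|_{L^2}<m_0^2/h_5(\theta_0)\}$ is a neighbourhood of $s_0$ in $L^2([0,1])$, and for every $u_0\in\tilde\Omega_{\mathcal B}(\theta_0)$ and every $t>\theta_0$ the Koopman decomposition of the orbit of $u_0$ converges absolutely at time $t$. -/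

import Mathlib

open MeasureTheory Set Filter Topology
open scoped ENNReal

namespace BurgersKoopman

/-- The unit interval `[0,1]` as a subset of `ℝ`. -/
abbrev I : Set ℝ := Icc 0 1

/-- The Lebesgue measure on `[0,1]`. -/
noncomputable abbrev vol : Measure ℝ := volume.restrict I

/-- The real Hilbert space `L²([0,1])`. -/
abbrev L2 : Type := Lp ℝ 2 vol

/-! ### Spectral elements of `A = -∂ₓₓ + V` with Neumann boundary conditions -/

/-- `f` is a nonzero function on `[0,1]`, twice differentiable (one-sidedly at the end points), with
`f'' - V f = -μ f` on `[0,1]` and `f'(0) = f'(1) = 0`. -/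
def IsNeumannEigenfunction (V : ℝ → ℝ) (μ : ℝ) (f : ℝ → ℝ) : Prop :=
  (∃ x ∈ I, f x ≠ 0) ∧
  ∃ f' f'' : ℝ → ℝ,
    (∀ x ∈ I, HasDerivWithinAt f (f' x) I x) ∧
    (∀ x ∈ I, HasDerivWithinAt f' (f'' x) I x) ∧
    f' 0 = 0 ∧ f' 1 = 0 ∧
    ∀ x ∈ I, f'' x - V x * f x = -μ * f x

/-- The set of eigenvalues of `A`. -/
def neumannSpectrum (V : ℝ → ℝ) : Set ℝ :=
  {μ | ∃ f, IsNeumannEigenfunction V μ f}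

/-- The eigenvalues `μ₀ < μ₁ < ⋯` of `A` in increasing order: `μ₀` is the smallest one and `μₙ₊₁` is
the smallest one above `μₙ`. (All of them are simple, so this is also the enumeration with
multiplicities.) -/
noncomputable def eigval (V : ℝ → ℝ) : ℕ → ℝ
  | 0 => sInf (neumannSpectrum V)
  | n + 1 => sInf (neumannSpectrum V ∩ Ioi (eigval V n))

open Classical in
/-- The eigenfunction `eₙ` for `μₙ`, normalised by `‖eₙ‖_{L²} = 1` and `eₙ(0) > 0`; on `[0,1]` this
determines it, and `e₀` is the positive one. (The sign of `eₙ` for `n ≥ 1` does not matter in the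
Koopman decomposition, which involves `eₙ` only through `cₙ eₙ` and `cₙ ∂ₓeₙ`.) -/
noncomputable def eigfun (V : ℝ → ℝ) (n : ℕ) : ℝ → ℝ :=
  if h : ∃ f, IsNeumannEigenfunction V (eigval V n) f ∧ ∫ x in (0 : ℝ)..1, f x ^ 2 = 1 ∧ 0 < f 0
  then h.choose else 0

/-- The coefficient functional `cₙ(v) = ∫₀¹ eₙ v`. -/
noncomputable def coeff (V : ℝ → ℝ) (n : ℕ) (v : ℝ → ℝ) : ℝ :=
  ∫ x in (0 : ℝ)..1, eigfun V n x * v x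

/-- `m₀ = inf_{[0,1]} e₀`. -/
noncomputable def m0 (V : ℝ → ℝ) : ℝ := sInf (eigfun V 0 '' I)

/-- `h₅(t) = (∑_{q ≥ 1} e^{-2(μ_q-μ₀)t} (1+√μ_q)²)^{1/2}`, with values in `[0,∞]`. -/
noncomputable def h5 (V : ℝ → ℝ) (t : ℝ) : ℝ≥0∞ :=
  (∑' q : ℕ, ENNReal.ofReal
    (Real.exp (-2 * (eigval V (q + 1) - eigval V 0) * t) *
      (1 + Real.sqrt (eigval V (q + 1))) ^ 2)) ^ (1 / 2 : ℝ)

/-! ### The Cole-Hopf transform and the Burgers equation -/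

/-- The Cole-Hopf transform
`H(u)(x) = exp(-½∫₀ˣ u) / ∫₀¹ exp(-½∫₀ʸ u) dy`. -/
noncomputable def coleHopf (u : ℝ → ℝ) (x : ℝ) : ℝ :=
  Real.exp (-(1 / 2) * ∫ s in (0 : ℝ)..x, u s) /
    ∫ y in (0 : ℝ)..1, Real.exp (-(1 / 2) * ∫ s in (0 : ℝ)..y, u s)

/-- `u` is the (global) solution of the Burgers equation with forcing `2 ∂ₓV`,
`∂ₜu + u ∂ₓu = ∂ₓₓu + 2 ∂ₓV`, `u(t,0) = u(t,1) = 0`, with Cauchy data `u₀ ∈ L²([0,1])`: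
a classical solution on `(0,∞) × [0,1]` with `u(t,·) → u₀` in `L²([0,1])` as `t → 0⁺`. -/
structure IsBurgersSolution (V : ℝ → ℝ) (u₀ : L2) (u : ℝ → ℝ → ℝ) : Prop where
  equation : ∃ ut ux uxx : ℝ → ℝ → ℝ,
    ContinuousOn (Function.uncurry u) (Ioi 0 ×ˢ I) ∧
    ContinuousOn (Function.uncurry ut) (Ioi 0 ×ˢ I) ∧
    ContinuousOn (Function.uncurry ux) (Ioi 0 ×ˢ I) ∧
    ContinuousOn (Function.uncurry uxx) (Ioi 0 ×ˢ I) ∧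
    ∀ t > 0, ∀ x ∈ I,
      HasDerivAt (fun s => u s x) (ut t x) t ∧
      HasDerivWithinAt (u t) (ux t x) I x ∧
      HasDerivWithinAt (ux t) (uxx t x) I x ∧
      ut t x + u t x * ux t x = uxx t x + 2 * derivWithin V I x
  boundary : ∀ t > 0, u t 0 = 0 ∧ u t 1 = 0
  initial : Tendsto (fun t => eLpNorm (fun x => u t x - u₀ x) 2 vol) (𝓝[>] 0) (𝓝 0)

/-! ### The Koopman decomposition -/

/-- The indices `ν = (q₀, q₁, …, q_m)` with `m ∈ ℕ`, `q₀ ∈ ℕ` and `q₁, …, q_m ∈ ℕ ∖ {0}`. -/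
abbrev Index : Type := Σ m : ℕ, ℕ × (Fin m → ℕ+)

/-- `λ_ν = ∑_{i=0}^m (μ_{q_i} - μ₀)`. -/
noncomputable def lam (V : ℝ → ℝ) (ν : Index) : ℝ :=
  (eigval V ν.2.1 - eigval V 0) + ∑ i, (eigval V (ν.2.2 i) - eigval V 0)

/-- `φ_ν(u₀) = ∏_{i=0}^m c_{q_i}(H(u₀)) / c₀(H(u₀))`. -/
noncomputable def phi (V : ℝ → ℝ) (ν : Index) (u₀ : L2) : ℝ :=
  (coeff V ν.2.1 (coleHopf u₀) / coeff V 0 (coleHopf u₀)) *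
    ∏ i, (coeff V (ν.2.2 i) (coleHopf u₀) / coeff V 0 (coleHopf u₀))

/-- The Koopman mode `a_ν(x) = 2 (-1)^{m+1} (∂ₓe_{q₀}(x) / e₀(x)) ∏_{i=1}^m e_{q_i}(x) / e₀(x)`. -/
noncomputable def mode (V : ℝ → ℝ) (ν : Index) (x : ℝ) : ℝ :=
  2 * (-1) ^ (ν.1 + 1) * (derivWithin (eigfun V ν.2.1) I x / eigfun V 0 x) *
    ∏ i, (eigfun V (ν.2.2 i) x / eigfun V 0 x)

/-- At time `t`, the Koopman decomposition `u(t,x) = ∑_ν e^{-λ_ν t} φ_ν(u₀) a_ν(x)` of the Burgers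
orbit of `u₀` converges absolutely in the norm `sup_{x ∈ [0,1]}`: the sum of the sup norms of its
terms is finite, and the series converges to the orbit unconditionally (hence in any order),
uniformly on `[0,1]`. -/
def KoopmanConvergesAbsolutely (V : ℝ → ℝ) (u₀ : L2) (t : ℝ) : Prop :=
  (∑' ν : Index, ENNReal.ofReal (Real.exp (-lam V ν * t) * |phi V ν u₀|) *
      ⨆ x ∈ I, ENNReal.ofReal |mode V ν x|) < ∞ ∧
  ∀ u : ℝ → ℝ → ℝ, IsBurgersSolution V u₀ u →
    HasSumUniformlyOn (fun ν x => Real.exp (-lam V ν * t) * phi V ν u₀ * mode V ν x) (u t) I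

/-! ### The threshold time and the neighbourhoods of the sink -/

/-- `‖H(u₀) - c₀(H(u₀)) e₀‖_{L²}`. -/
noncomputable def dist0 (V : ℝ → ℝ) (u₀ : L2) : ℝ≥0∞ :=
  eLpNorm (fun x => coleHopf u₀ x - coeff V 0 (coleHopf u₀) * eigfun V 0 x) 2 vol

/-- The defining property of the threshold time:
`τ ∈ [0,∞)` and `h₅(τ) = m₀² / ‖H(u₀) - c₀(H(u₀)) e₀‖_{L²}`. The equation is read in `[0,∞]`, where
`m₀² / 0 = ∞` because `m₀ > 0`, and `h₅(0) = ∞`. -/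
def IsThresholdTime (V : ℝ → ℝ) (u₀ : L2) (τ : ℝ) : Prop :=
  0 ≤ τ ∧ h5 V τ = ENNReal.ofReal (m0 V ^ 2) / dist0 V u₀

/-- The steady state `f̃₀ = e₀ / ∫₀¹ e₀` of the nonlinear heat flow. -/
noncomputable def heatSink (V : ℝ → ℝ) (x : ℝ) : ℝ :=
  eigfun V 0 x / ∫ y in (0 : ℝ)..1, eigfun V 0 y

/-- The steady state `s₀ = -2 ∂ₓe₀ / e₀` of the Burgers flow. -/
noncomputable def burgersSink (V : ℝ → ℝ) (x : ℝ) : ℝ :=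
  -2 * (derivWithin (eigfun V 0) I x / eigfun V 0 x)

/-- `Ω̃(θ₀) = {u₀ ∈ L²([0,1]) ; ‖H(u₀) - f̃₀‖_{L²} < m₀² / h₅(θ₀)}`. -/
def Omega (V : ℝ → ℝ) (θ₀ : ℝ) : Set L2 :=
  {u₀ | eLpNorm (fun x => coleHopf u₀ x - heatSink V x) 2 vol <
    ENNReal.ofReal (m0 V ^ 2) / h5 V θ₀}

end BurgersKoopman

namespace BurgersKoopman

/-! ### Calculus on the unit interval -/

/-! The Cole-Hopf substitution w = exp(-½∫₀ˣ u) linearises the equation: along an orbit, w_t = w_xx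
- V w + g w with a scalar g depending on time only, and w satisfies Neumann conditions because u
vanishes at 0 and 1. Hence every coefficient c_n(w) solves a scalar linear ODE with rate g - μ_n.
The ratio c_n/c_0 sees neither g nor the normalisation of H: it equals e^{-(μ_n-μ_0)t} times its
value at H(u₀) (`IsBurgersSolution.coeff_div`).

Since u = -2 w_x/w, dividing the expansions of w_x and w by c_0 e_0 gives u = -2 (∑_q A_q) / (1 +
∑_{q≥1} z_q), with A_q = (c_q/c_0)(∂ₓe_q/e_0) and z_q = (c_q/c_0)(e_q/e_0). Expanding the quotient
as a geometric series and multiplying out yields the Koopman sum: q_0 records the numerator term,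
and q_1, …, q_m the factors of the m-th power of the denominator's tail.

This is legitimate, uniformly in x, as soon as the sup norms of the z_q have sum below 1. The
one-dimensional Sobolev inequality gives |e_q| ≤ 1+√μ_q. Moreover e_0 ≥ m_0, and c_0(H) ≥ m_0
because H has integral 1. Cauchy-Schwarz and Parseval then bound the sum by h₅(t)‖H -
c_0(H)e_0‖/m_0² (`tsum_normCoeff_lt`). As h₅ decreases strictly from ∞ to 0 on [0,∞), this is below
1 exactly after the threshold time. For the neighbourhoods, c_0(H)e_0 is the orthogonal projection
of H on the line of e_0, so it is at least as close to H as f̃₀ is; and H is continuous and sends s₀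
to f̃₀.

The spectral theory rests on three points: completeness, from a coercive form with compactly
embedded domain (`eq_zero_of_orthogonal_of_compact`); convergence of ∑ 1/μ_n, which stands in for
eigenvalue asymptotics (`exists_sum_inv_le`); and positivity of e_0, because |e_0| also minimises
the energy (`coeff_abs_eigfun_zero`). -/

lemma zero_mem_I : (0 : ℝ) ∈ I := ⟨le_rfl, zero_le_one⟩

lemma one_mem_I : (1 : ℝ) ∈ I := ⟨zero_le_one, le_rfl⟩

lemma uIcc_subset_I {a b : ℝ} (ha : a ∈ I) (hb : b ∈ I) : uIcc a b ⊆ I :=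
  (convex_Icc (0 : ℝ) 1).ordConnected.uIcc_subset ha hb

lemma intervalIntegrable_of_mem {f : ℝ → ℝ} (hf : ContinuousOn f I) {a b : ℝ}
    (ha : a ∈ I) (hb : b ∈ I) : IntervalIntegrable f volume a b :=
  (hf.mono (uIcc_subset_I ha hb)).intervalIntegrable

lemma intervalIntegrable_unit {f : ℝ → ℝ} (hf : ContinuousOn f I) :
    IntervalIntegrable f volume 0 1 :=
  intervalIntegrable_of_mem hf zero_mem_I one_mem_I

lemma integral_unit_add {f g : ℝ → ℝ} (hf : ContinuousOn f I) (hg : ContinuousOn g I) :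
    ∫ x in (0 : ℝ)..1, (f x + g x) = (∫ x in (0 : ℝ)..1, f x) + ∫ x in (0 : ℝ)..1, g x :=
  intervalIntegral.integral_add (intervalIntegrable_unit hf) (intervalIntegrable_unit hg)

lemma integral_unit_sub {f g : ℝ → ℝ} (hf : ContinuousOn f I) (hg : ContinuousOn g I) :
    ∫ x in (0 : ℝ)..1, (f x - g x) = (∫ x in (0 : ℝ)..1, f x) - ∫ x in (0 : ℝ)..1, g x :=
  intervalIntegral.integral_sub (intervalIntegrable_unit hf) (intervalIntegrable_unit hg)

/-- `f'` is the (one-sided at the end points) derivative of `f` on `[0,1]`. -/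
def HasDerivOnI (f f' : ℝ → ℝ) : Prop := ∀ x ∈ I, HasDerivWithinAt f (f' x) I x

lemma HasDerivOnI.continuousOn {f f' : ℝ → ℝ} (h : HasDerivOnI f f') : ContinuousOn f I :=
  fun x hx => (h x hx).continuousWithinAt

lemma HasDerivOnI.hasDerivAt {f f' : ℝ → ℝ} (h : HasDerivOnI f f') {x : ℝ}
    (hx : x ∈ Ioo (0 : ℝ) 1) : HasDerivAt f (f' x) x :=
  (h x (Ioo_subset_Icc_self hx)).hasDerivAt (Icc_mem_nhds hx.1 hx.2)

lemma HasDerivOnI.mul {f f' g g' : ℝ → ℝ} (hf : HasDerivOnI f f') (hg : HasDerivOnI g g') :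
    HasDerivOnI (fun x => f x * g x) (fun x => f' x * g x + f x * g' x) :=
  fun x hx => (hf x hx).mul (hg x hx)

lemma HasDerivOnI.integral_eq {f f' : ℝ → ℝ} (h : HasDerivOnI f f') (hf' : ContinuousOn f' I)
    {a b : ℝ} (ha : a ∈ I) (hb : b ∈ I) : ∫ x in a..b, f' x = f b - f a := by
  have hs := uIcc_subset_I ha hb
  refine intervalIntegral.integral_eq_sub_of_hasDeriv_right (h.continuousOn.mono hs)
    (fun x hx => ?_) (intervalIntegrable_of_mem hf' ha hb)
  have hx' : x ∈ Ioo (0 : ℝ) 1 :=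
    ⟨(le_min ha.1 hb.1).trans_lt hx.1, hx.2.trans_le (max_le ha.2 hb.2)⟩
  exact (h.hasDerivAt hx').hasDerivWithinAt

lemma HasDerivOnI.integral_mul {f f' g g' : ℝ → ℝ} (hf : HasDerivOnI f f')
    (hg : HasDerivOnI g g') (hf' : ContinuousOn f' I) (hg' : ContinuousOn g' I) :
    ∫ x in (0 : ℝ)..1, f' x * g x = f 1 * g 1 - f 0 * g 0 - ∫ x in (0 : ℝ)..1, f x * g' x := by
  have h := (hf.mul hg).integral_eq ((hf'.mul hg.continuousOn).add (hf.continuousOn.mul hg'))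
    zero_mem_I one_mem_I
  have h2 := integral_unit_add (f := fun x => f' x * g x) (g := fun x => f x * g' x)
    (hf'.mul hg.continuousOn) (hf.continuousOn.mul hg')
  linarith

lemma HasDerivOnI.continuousOn_congr {f f' : ℝ → ℝ} (h : HasDerivOnI f f') :
    EqOn (derivWithin f I) f' I :=
  fun x hx => (h x hx).derivWithin (uniqueDiffOn_Icc zero_lt_one x hx)

lemma integral_unit_mono {f g : ℝ → ℝ} (hf : ContinuousOn f I) (hg : ContinuousOn g I)
    (h : ∀ x ∈ I, f x ≤ g x) : ∫ x in (0 : ℝ)..1, f x ≤ ∫ x in (0 : ℝ)..1, g x :=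
  intervalIntegral.integral_mono_on zero_le_one (intervalIntegrable_unit hf)
    (intervalIntegrable_unit hg) h

lemma integral_unit_nonneg {f : ℝ → ℝ} (h : ∀ x ∈ I, 0 ≤ f x) : 0 ≤ ∫ x in (0 : ℝ)..1, f x :=
  intervalIntegral.integral_nonneg zero_le_one h

lemma integral_unit_congr {f g : ℝ → ℝ} (h : EqOn f g I) :
    ∫ x in (0 : ℝ)..1, f x = ∫ x in (0 : ℝ)..1, g x :=
  intervalIntegral.integral_congr (by rwa [uIcc_of_le zero_le_one])

lemma eqOn_zero_of_integral_sq_eq_zero {f : ℝ → ℝ} (hf : ContinuousOn f I)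
    (h : ∫ x in (0 : ℝ)..1, f x ^ 2 = 0) : ∀ x ∈ I, f x = 0 := by
  by_contra! hne
  obtain ⟨x, hx, hfx⟩ := hne
  have : 0 < ∫ x in (0 : ℝ)..1, f x ^ 2 :=
    intervalIntegral.integral_pos zero_lt_one (hf.pow 2) (fun y _ => sq_nonneg _)
      ⟨x, hx, by positivity⟩
  linarith

/-- Integrate (|f| - m)² ≥ 0, where m is the mean of |f|. -/
lemma sq_integral_abs_le {f : ℝ → ℝ} (hf : ContinuousOn f I) :
    (∫ x in (0 : ℝ)..1, |f x|) ^ 2 ≤ ∫ x in (0 : ℝ)..1, f x ^ 2 := by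
  set m := ∫ x in (0 : ℝ)..1, |f x| with hm
  have h1 : 0 ≤ ∫ x in (0 : ℝ)..1, (f x ^ 2 - 2 * m * |f x| + m ^ 2) :=
    integral_unit_nonneg fun x _ => by nlinarith [sq_nonneg (|f x| - m), sq_abs (f x)]
  rw [intervalIntegral.integral_add, intervalIntegral.integral_sub,
    intervalIntegral.integral_const_mul, intervalIntegral.integral_const] at h1
  · simp only [sub_zero, smul_eq_mul, one_mul, ← hm] at h1
    nlinarith
  · exact intervalIntegrable_unit (hf.pow 2)
  · exact intervalIntegrable_unit (continuousOn_const.mul hf.abs)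
  · exact intervalIntegrable_unit ((hf.pow 2).sub (continuousOn_const.mul hf.abs))
  · exact intervalIntegrable_unit continuousOn_const

lemma abs_sub_le_integral_abs {f f' : ℝ → ℝ} (h : HasDerivOnI f f') (hf' : ContinuousOn f' I)
    {x y : ℝ} (hx : x ∈ I) (hy : y ∈ I) : |f x - f y| ≤ ∫ s in (0 : ℝ)..1, |f' s| := by
  rw [← h.integral_eq hf' hy hx]
  have h1 := intervalIntegral.norm_integral_le_integral_norm_uIoc (f := f') (μ := volume)
    (a := y) (b := x)
  simp only [Real.norm_eq_abs] at h1
  refine h1.trans ?_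
  rw [intervalIntegral.integral_of_le zero_le_one, ← integral_Icc_eq_integral_Ioc]
  refine setIntegral_mono_set ?_ (Eventually.of_forall fun _ => abs_nonneg _)
    (LE.le.eventuallyLE (uIoc_subset_uIcc.trans (uIcc_subset_I hy hx)))
  exact hf'.abs.integrableOn_Icc

/-- One-dimensional Sobolev inequality: the minimum of |f| is at most its L² norm, and the
oscillation is at most the L¹ norm of f', hence its L² norm. This is the origin of the weight 1+√μ_q
in h₅. -/
lemma abs_le_sqrt_add_sqrt {f f' : ℝ → ℝ} (h : HasDerivOnI f f') (hf' : ContinuousOn f' I)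
    {x : ℝ} (hx : x ∈ I) :
    |f x| ≤ √(∫ s in (0 : ℝ)..1, f s ^ 2) + √(∫ s in (0 : ℝ)..1, f' s ^ 2) := by
  obtain ⟨y, hy, hmin⟩ := isCompact_Icc.exists_isMinOn ⟨0, zero_mem_I⟩ h.continuousOn.abs
  have h1 : |f y| ≤ √(∫ s in (0 : ℝ)..1, f s ^ 2) := by
    apply Real.le_sqrt_of_sq_le
    have := integral_unit_mono (continuousOn_const (c := |f y| ^ 2)) (h.continuousOn.pow 2)
      (fun s hs => by
        rw [Pi.pow_apply]
        rw [← sq_abs (f s)]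
        exact pow_le_pow_left₀ (abs_nonneg _) (hmin hs) 2)
    simpa using this
  have h2 : |f x - f y| ≤ √(∫ s in (0 : ℝ)..1, f' s ^ 2) :=
    (abs_sub_le_integral_abs h hf' hx hy).trans (Real.le_sqrt_of_sq_le (sq_integral_abs_le hf'))
  have := abs_sub_abs_le_abs_sub (f x) (f y)
  linarith

/-! ### Neumann eigenfunctions -/

/-- `f` is a solution of `f'' = (V - μ) f` on `[0,1]` with derivative `f'` and Neumann boundary
conditions. -/
structure IsEigenpair (V : ℝ → ℝ) (μ : ℝ) (f f' : ℝ → ℝ) : Prop where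
  deriv : HasDerivOnI f f'
  deriv_two : HasDerivOnI f' (fun x => (V x - μ) * f x)
  left : f' 0 = 0
  right : f' 1 = 0

lemma isNeumannEigenfunction_iff {V : ℝ → ℝ} {μ : ℝ} {f : ℝ → ℝ} :
    IsNeumannEigenfunction V μ f ↔ (∃ x ∈ I, f x ≠ 0) ∧ ∃ f', IsEigenpair V μ f f' := by
  refine and_congr_right fun _ => exists_congr fun f' => ⟨?_, ?_⟩
  · rintro ⟨f'', h1, h2, h3, h4, h5⟩
    refine ⟨h1, fun x hx => ?_, h3, h4⟩
    convert h2 x hx using 1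
    linarith [h5 x hx]
  · intro h
    exact ⟨_, h.deriv, h.deriv_two, h.left, h.right, fun x _ => by ring⟩

namespace IsEigenpair

variable {V : ℝ → ℝ} {μ ν : ℝ} {f f' g g' : ℝ → ℝ}

lemma continuousOn (h : IsEigenpair V μ f f') : ContinuousOn f I := h.deriv.continuousOn

lemma continuousOn_deriv (h : IsEigenpair V μ f f') : ContinuousOn f' I :=
  h.deriv_two.continuousOn

lemma smul (h : IsEigenpair V μ f f') (c : ℝ) :
    IsEigenpair V μ (fun x => c * f x) (fun x => c * f' x) where
  deriv x hx := (h.deriv x hx).const_mul c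
  deriv_two x hx := by
    refine ((h.deriv_two x hx).const_mul c).congr_deriv ?_
    ring
  left := by simp [h.left]
  right := by simp [h.right]

lemma sub (h : IsEigenpair V μ f f') (hg : IsEigenpair V μ g g') :
    IsEigenpair V μ (fun x => f x - g x) (fun x => f' x - g' x) where
  deriv x hx := (h.deriv x hx).sub (hg.deriv x hx)
  deriv_two x hx := by
    refine ((h.deriv_two x hx).fun_sub (hg.deriv_two x hx)).congr_deriv ?_
    ring
  left := by simp [h.left, hg.left]
  right := by simp [h.right, hg.right]

/-- The weak form of the eigenvalue equation. -/
lemma weak (hV : ContinuousOn V I) (h : IsEigenpair V μ f f') (hg : HasDerivOnI g g')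
    (hg' : ContinuousOn g' I) :
    ∫ x in (0 : ℝ)..1, (f' x * g' x + V x * f x * g x) = μ * ∫ x in (0 : ℝ)..1, f x * g x := by
  have hf := h.continuousOn
  have hgc := hg.continuousOn
  have h1 := h.deriv_two.integral_mul hg ((hV.sub continuousOn_const).mul hf) hg'
  rw [h.left, h.right] at h1
  have h2 : ∫ x in (0 : ℝ)..1, (V x - μ) * f x * g x =
      (∫ x in (0 : ℝ)..1, V x * f x * g x) - μ * ∫ x in (0 : ℝ)..1, f x * g x := by
    rw [← intervalIntegral.integral_const_mul, ← intervalIntegral.integral_sub]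
    · exact integral_unit_congr fun x _ => by ring
    · exact intervalIntegrable_unit ((hV.mul hf).mul hgc)
    · exact intervalIntegrable_unit (continuousOn_const.mul (hf.mul hgc))
  have h3 := integral_unit_add (f := fun x => f' x * g' x) (g := fun x => V x * f x * g x)
    (h.continuousOn_deriv.mul hg') ((hV.mul hf).mul hgc)
  linarith

lemma orthogonal (hV : ContinuousOn V I) (h : IsEigenpair V μ f f') (hg : IsEigenpair V ν g g')
    (hne : μ ≠ ν) : ∫ x in (0 : ℝ)..1, f x * g x = 0 := by
  have h1 := h.weak hV hg.deriv hg.continuousOn_deriv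
  have h2 := hg.weak hV h.deriv h.continuousOn_deriv
  have h3 : ∫ x in (0 : ℝ)..1, (f' x * g' x + V x * f x * g x) =
      ∫ x in (0 : ℝ)..1, (g' x * f' x + V x * g x * f x) := by
    congr 1; ext x; ring
  have h4 : ∫ x in (0 : ℝ)..1, g x * f x = ∫ x in (0 : ℝ)..1, f x * g x := by
    congr 1; ext x; ring
  rw [h3, h2, h4] at h1
  have : (ν - μ) * ∫ x in (0 : ℝ)..1, f x * g x = 0 := by linarith
  exact (mul_eq_zero.1 this).resolve_left (sub_ne_zero.2 hne.symm)

/-- Uniqueness for the Cauchy problem. -/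
lemma eqOn_zero (hV : ContinuousOn V I) (h : IsEigenpair V μ f f') {y : ℝ} (hy : y ∈ I)
    (h0 : f y = 0) (h1 : f' y = 0) : ∀ x ∈ I, f x = 0 := by
  obtain ⟨C, hC⟩ := isCompact_Icc.exists_bound_of_continuousOn
    ((hV.sub (continuousOn_const (c := μ))).add (continuousOn_const (c := 1)))
  -- Grönwall for f² + f'²: its derivative is at most C times itself in absolute value, so the
  -- product with e^{Cx} increases and the product with e^{-Cx} decreases.
  have hE : ∀ x ∈ Ioo (0 : ℝ) 1, HasDerivAt (fun x => f x ^ 2 + f' x ^ 2)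
      (2 * (V x - μ + 1) * (f x * f' x)) x := fun x hx => by
    refine (((h.deriv.hasDerivAt hx).fun_pow 2).fun_add
      ((h.deriv_two.hasDerivAt hx).fun_pow 2)).congr_deriv ?_
    ring
  have hb : ∀ x ∈ I, |2 * (V x - μ + 1) * (f x * f' x)| ≤ C * (f x ^ 2 + f' x ^ 2) := by
    intro x hx
    have h1 : |V x - μ + 1| ≤ C := hC x hx
    have h2 : |2 * (f x * f' x)| ≤ f x ^ 2 + f' x ^ 2 := by
      rw [abs_le]; constructor <;> nlinarith [sq_nonneg (f x + f' x), sq_nonneg (f x - f' x)]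
    calc _ = |V x - μ + 1| * |2 * (f x * f' x)| := by rw [← abs_mul]; ring_nf
      _ ≤ _ := mul_le_mul h1 h2 (abs_nonneg _) ((abs_nonneg _).trans h1)
  have hc : ContinuousOn (fun x => f x ^ 2 + f' x ^ 2) I :=
    (h.continuousOn.pow 2).add (h.continuousOn_deriv.pow 2)
  have hexp : ∀ k x : ℝ, HasDerivAt (fun x => Real.exp (k * x)) (k * Real.exp (k * x)) x :=
    fun k x => by simpa [mul_comm] using ((hasDerivAt_id x).const_mul k).exp
  have hmono : MonotoneOn (fun x => (f x ^ 2 + f' x ^ 2) * Real.exp (C * x)) I := by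
    refine monotoneOn_of_deriv_nonneg (convex_Icc _ _) (by fun_prop) ?_ ?_ <;>
      rw [interior_Icc] <;> intro x hx
    · exact ((hE x hx).fun_mul (hexp C x)).differentiableAt.differentiableWithinAt
    · rw [((hE x hx).fun_mul (hexp C x)).deriv]
      have := (abs_le.1 (hb x (Ioo_subset_Icc_self hx))).1
      nlinarith [Real.exp_pos (C * x)]
  have hanti : AntitoneOn (fun x => (f x ^ 2 + f' x ^ 2) * Real.exp (-C * x)) I := by
    refine antitoneOn_of_deriv_nonpos (convex_Icc _ _) (by fun_prop) ?_ ?_ <;>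
      rw [interior_Icc] <;> intro x hx
    · exact ((hE x hx).fun_mul (hexp (-C) x)).differentiableAt.differentiableWithinAt
    · rw [((hE x hx).fun_mul (hexp (-C) x)).deriv]
      have := (abs_le.1 (hb x (Ioo_subset_Icc_self hx))).2
      nlinarith [Real.exp_pos (-C * x)]
  intro x hx
  -- k = C carries the vanishing at y to the points on its left, k = -C to those on its right.
  have key : ∀ k : ℝ, (f x ^ 2 + f' x ^ 2) * Real.exp (k * x) ≤
      (f y ^ 2 + f' y ^ 2) * Real.exp (k * y) → f x = 0 := by
    intro k hk
    rw [h0, h1] at hk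
    have : f x ^ 2 + f' x ^ 2 ≤ 0 := by
      by_contra! hpos
      have := mul_pos hpos (Real.exp_pos (k * x))
      simp at hk; linarith
    nlinarith [sq_nonneg (f x), sq_nonneg (f' x)]
  rcases le_total x y with hxy | hxy
  · exact key C (hmono hx hy hxy)
  · exact key (-C) (hanti hy hx hxy)

/-- With f'(0) = 0, a zero at 0 would mean zero Cauchy data. This makes the normalisation e_n(0) > 0
possible. -/
lemma apply_zero_ne (hV : ContinuousOn V I) (h : IsEigenpair V μ f f')
    (hne : ∃ x ∈ I, f x ≠ 0) : f 0 ≠ 0 := by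
  intro h0
  obtain ⟨x, hx, hfx⟩ := hne
  exact hfx (h.eqOn_zero hV zero_mem_I h0 h.left x hx)

/-- The eigenvalues are simple. -/
lemma eqOn_smul (hV : ContinuousOn V I) (h : IsEigenpair V μ f f') (hg : IsEigenpair V μ g g')
    (hg0 : g 0 ≠ 0) : ∀ x ∈ I, f x = f 0 / g 0 * g x := by
  intro x hx
  have := (h.sub (hg.smul (f 0 / g 0))).eqOn_zero hV zero_mem_I (by field_simp; ring)
    (by simp [h.left, hg.left]) x hx
  linarith

lemma energy_le (hV : ContinuousOn V I) (hVpos : ∀ x ∈ I, 0 < V x) (h : IsEigenpair V μ f f') :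
    ∫ x in (0 : ℝ)..1, f' x ^ 2 ≤ μ * ∫ x in (0 : ℝ)..1, f x ^ 2 := by
  have h1 := h.weak hV h.deriv h.continuousOn_deriv
  have hf := h.continuousOn
  have hf' := h.continuousOn_deriv
  have h2 : ∫ x in (0 : ℝ)..1, f' x ^ 2 ≤ ∫ x in (0 : ℝ)..1, (f' x * f' x + V x * f x * f x) :=
    integral_unit_mono (hf'.pow 2) ((hf'.mul hf').add ((hV.mul hf).mul hf)) fun x hx => by
      nlinarith [mul_nonneg (hVpos x hx).le (sq_nonneg (f x))]
  simp only [sq] at h2 ⊢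
  linarith

lemma pos (hV : ContinuousOn V I) (hVpos : ∀ x ∈ I, 0 < V x) (h : IsEigenpair V μ f f')
    (hne : ∃ x ∈ I, f x ≠ 0) : 0 < μ := by
  obtain ⟨y, hy, hfy⟩ := hne
  have h1 := h.weak hV h.deriv h.continuousOn_deriv
  have hf := h.continuousOn
  have hf' := h.continuousOn_deriv
  have h2 : 0 < ∫ x in (0 : ℝ)..1, (f' x * f' x + V x * f x * f x) :=
    intervalIntegral.integral_pos zero_lt_one ((hf'.mul hf').add ((hV.mul hf).mul hf))
      (fun x hx => by
        have := hVpos x (Ioc_subset_Icc_self hx)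
        nlinarith [mul_nonneg this.le (sq_nonneg (f x)), sq_nonneg (f' x)])
      ⟨y, hy, by
        have := hVpos y hy
        have h3 : 0 < f y ^ 2 := by positivity
        nlinarith [mul_pos this h3, sq_nonneg (f' y)]⟩
  rw [h1] at h2
  have h3 : 0 ≤ ∫ x in (0 : ℝ)..1, f x * f x := integral_unit_nonneg fun x _ => mul_self_nonneg _
  exact pos_of_mul_pos_left h2 h3

lemma abs_le (hV : ContinuousOn V I) (hVpos : ∀ x ∈ I, 0 < V x) (h : IsEigenpair V μ f f')
    (hnorm : ∫ x in (0 : ℝ)..1, f x ^ 2 = 1) {x : ℝ} (hx : x ∈ I) : |f x| ≤ 1 + √μ := by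
  have h1 := abs_le_sqrt_add_sqrt h.deriv h.continuousOn_deriv hx
  have h2 := h.energy_le hV hVpos
  rw [hnorm, mul_one] at h2
  rw [hnorm, Real.sqrt_one] at h1
  linarith [Real.sqrt_le_sqrt h2]

/-- Integrate f'' = (V - μ)f from 0, where f' vanishes, using that the L¹ norm of f is at most 1.
Growth linear in μ is harmless against the exponential factors for t > 0. -/
lemma abs_deriv_le (hV : ContinuousOn V I) (h : IsEigenpair V μ f f') {C : ℝ}
    (hC : ∀ x ∈ I, |V x| ≤ C) (hnorm : ∫ x in (0 : ℝ)..1, f x ^ 2 = 1) {x : ℝ} (hx : x ∈ I) :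
    |f' x| ≤ C + |μ| := by
  have hf := h.continuousOn
  have h1 := abs_sub_le_integral_abs h.deriv_two ((hV.sub continuousOn_const).mul hf) hx zero_mem_I
  rw [h.left, sub_zero] at h1
  have hm : ∫ s in (0 : ℝ)..1, |f s| ≤ 1 := by
    have := sq_integral_abs_le hf
    rw [hnorm] at this
    nlinarith
  have h2 : ∫ s in (0 : ℝ)..1, |(V s - μ) * f s| ≤ ∫ s in (0 : ℝ)..1, (C + |μ|) * |f s| :=
    integral_unit_mono ((hV.sub continuousOn_const).mul hf).abs (continuousOn_const.mul hf.abs)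
      fun s hs => by
        rw [abs_mul]
        refine mul_le_mul_of_nonneg_right ?_ (abs_nonneg _)
        have := abs_sub (V s) μ
        have := hC s hs
        linarith
  rw [intervalIntegral.integral_const_mul] at h2
  have h3 : 0 ≤ C + |μ| := add_nonneg ((abs_nonneg _).trans (hC 0 zero_mem_I)) (abs_nonneg _)
  nlinarith

end IsEigenpair

lemma HasDerivOnI.sum {ι : Type*} (s : Finset ι) {f f' : ι → ℝ → ℝ}
    (h : ∀ i ∈ s, HasDerivOnI (f i) (f' i)) :
    HasDerivOnI (fun x => ∑ i ∈ s, f i x) (fun x => ∑ i ∈ s, f' i x) :=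
  fun x hx => HasDerivWithinAt.fun_sum fun i hi => h i hi x hx

/-- The energy of a finite combination of orthonormal eigenfunctions. -/
lemma energy_sum {V : ℝ → ℝ} (hV : ContinuousOn V I) {ι : Type*} (s : Finset ι) {μ : ι → ℝ}
    {e e' : ι → ℝ → ℝ} (he : ∀ i ∈ s, IsEigenpair V (μ i) (e i) (e' i)) (a : ι → ℝ)
    {g g' : ℝ → ℝ} (hg : HasDerivOnI g g') (hg' : ContinuousOn g' I) :
    ∫ x in (0 : ℝ)..1, ((∑ i ∈ s, a i * e' i x) * g' x + V x * (∑ i ∈ s, a i * e i x) * g x) =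
      ∑ i ∈ s, a i * (μ i * ∫ x in (0 : ℝ)..1, e i x * g x) := by
  have hgc := hg.continuousOn
  have : ∀ x, (∑ i ∈ s, a i * e' i x) * g' x + V x * (∑ i ∈ s, a i * e i x) * g x =
      ∑ i ∈ s, a i * (e' i x * g' x + V x * e i x * g x) := fun x => by
    rw [Finset.mul_sum, Finset.sum_mul, Finset.sum_mul, ← Finset.sum_add_distrib]
    exact Finset.sum_congr rfl fun i _ => by ring
  simp_rw [this]
  rw [intervalIntegral.integral_finsetSum]
  · refine Finset.sum_congr rfl fun i hi => ?_
    rw [intervalIntegral.integral_const_mul, (he i hi).weak hV hg hg']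
  · intro i hi
    have h1 := (he i hi).continuousOn
    have h2 := (he i hi).continuousOn_deriv
    exact intervalIntegrable_unit (continuousOn_const.mul ((h2.mul hg').add ((hV.mul h1).mul hgc)))

lemma integral_sum_mul {ι : Type*} (s : Finset ι) {e : ι → ℝ → ℝ}
    (he : ∀ i ∈ s, ContinuousOn (e i) I) (a : ι → ℝ) {g : ℝ → ℝ} (hg : ContinuousOn g I) :
    ∫ x in (0 : ℝ)..1, (∑ i ∈ s, a i * e i x) * g x =
      ∑ i ∈ s, a i * ∫ x in (0 : ℝ)..1, e i x * g x := by
  simp_rw [Finset.sum_mul, mul_assoc]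
  rw [intervalIntegral.integral_finsetSum]
  · exact Finset.sum_congr rfl fun i _ => intervalIntegral.integral_const_mul _ _
  · exact fun i hi => intervalIntegrable_unit (continuousOn_const.mul ((he i hi).mul hg))

/-- The reciprocals of the eigenvalues are uniformly summable. -/
lemma exists_sum_inv_le {V : ℝ → ℝ} (hV : ContinuousOn V I) (hVpos : ∀ x ∈ I, 0 < V x) :
    ∃ K : ℝ, ∀ (s : Finset ℝ), (∀ μ ∈ s, μ ∈ neumannSpectrum V) → ∑ μ ∈ s, μ⁻¹ ≤ K := by
  obtain ⟨z, hz, hmin⟩ := isCompact_Icc.exists_isMinOn ⟨0, zero_mem_I⟩ hV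
  have hv := hVpos z hz
  refine ⟨(1 / √(V z) + 1) ^ 2, fun s hs => ?_⟩
  have hex : ∀ μ ∈ s, ∃ f f', IsEigenpair V μ f f' ∧ ∫ x in (0 : ℝ)..1, f x ^ 2 = 1 := by
    intro μ hμ
    obtain ⟨f, hf⟩ := hs μ hμ
    obtain ⟨⟨y, hy, hfy⟩, f', h⟩ := isNeumannEigenfunction_iff.1 hf
    set N := ∫ x in (0 : ℝ)..1, f x ^ 2 with hN
    have hNpos : 0 < N := intervalIntegral.integral_pos zero_lt_one (h.continuousOn.pow 2)
      (fun x _ => sq_nonneg _) ⟨y, hy, by positivity⟩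
    refine ⟨_, _, h.smul (√N)⁻¹, ?_⟩
    simp_rw [mul_pow]
    rw [intervalIntegral.integral_const_mul, ← hN, inv_pow, Real.sq_sqrt hNpos.le,
      inv_mul_cancel₀ hNpos.ne']
  choose! e e' he hnorm using hex
  have hpos : ∀ μ ∈ s, 0 < μ := fun μ hμ => (he μ hμ).pos hV hVpos <| by
    by_contra! h0
    have := hnorm μ hμ
    rw [integral_unit_congr (g := fun _ => 0) fun x hx => by simp [h0 x hx]] at this
    simp at this
  -- Reproducing-kernel argument at fixed x: F = ∑ μ⁻¹ e_μ(x) e_μ has both value at x and energy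
  -- equal to S, so the Sobolev inequality reads S ≤ √S (1/√(min V) + 1). This bounds S
  -- independently of s and x; integrating over x gives ∑ μ⁻¹.
  have hpt : ∀ x ∈ I, ∑ μ ∈ s, μ⁻¹ * e μ x ^ 2 ≤ (1 / √(V z) + 1) ^ 2 := by
    intro x hx
    set S := ∑ μ ∈ s, μ⁻¹ * e μ x ^ 2 with hS
    have hS0 : 0 ≤ S := Finset.sum_nonneg fun μ hμ =>
      mul_nonneg (inv_nonneg.2 (hpos μ hμ).le) (sq_nonneg _)
    set a : ℝ → ℝ := fun μ => μ⁻¹ * e μ x with ha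
    set F : ℝ → ℝ := fun y => ∑ μ ∈ s, a μ * e μ y with hF
    set F' : ℝ → ℝ := fun y => ∑ μ ∈ s, a μ * e' μ y with hF'
    have hd : HasDerivOnI F F' :=
      HasDerivOnI.sum s fun μ hμ => ((he μ hμ).smul (a μ)).deriv
    have hc' : ContinuousOn F' I := by
      refine continuousOn_finsetSum s fun μ hμ => ?_
      exact continuousOn_const.mul (he μ hμ).continuousOn_deriv
    have hc := hd.continuousOn
    have hcoef : ∀ μ ∈ s, ∫ y in (0 : ℝ)..1, e μ y * F y = a μ := by
      intro μ hμ
      have h1 : ∫ y in (0 : ℝ)..1, e μ y * F y = ∫ y in (0 : ℝ)..1, F y * e μ y := by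
        congr 1; ext y; ring
      rw [h1, integral_sum_mul s (fun ν hν => (he ν hν).continuousOn) a (he μ hμ).continuousOn,
        Finset.sum_eq_single_of_mem μ hμ]
      · simp_rw [← sq]; rw [hnorm μ hμ, mul_one]
      · intro ν hν hne
        rw [(he ν hν).orthogonal hV (he μ hμ) hne, mul_zero]
    have hE := energy_sum hV s he a hd hc'
    have hE' : ∫ y in (0 : ℝ)..1, (F' y * F' y + V y * F y * F y) = S := by
      rw [hE, hS]
      refine Finset.sum_congr rfl fun μ hμ => ?_
      have := (hpos μ hμ).ne'
      rw [hcoef μ hμ, ha]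
      field_simp
    have i1 := intervalIntegrable_unit (hc'.mul hc')
    have i2 := intervalIntegrable_unit ((hV.mul hc).mul hc)
    have h1 : ∫ y in (0 : ℝ)..1, F' y ^ 2 ≤ S := by
      rw [← hE']
      exact integral_unit_mono (hc'.pow 2) ((hc'.mul hc').add ((hV.mul hc).mul hc))
        fun y hy => by nlinarith [mul_nonneg (hVpos y hy).le (sq_nonneg (F y))]
    have h2 : V z * ∫ y in (0 : ℝ)..1, F y ^ 2 ≤ S := by
      rw [← hE', ← intervalIntegral.integral_const_mul]
      exact integral_unit_mono (continuousOn_const.mul (hc.pow 2))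
        ((hc'.mul hc').add ((hV.mul hc).mul hc))
        fun y hy => by
          have h3 : V z ≤ V y := hmin hy
          nlinarith [mul_le_mul_of_nonneg_right h3 (sq_nonneg (F y)), sq_nonneg (F' y)]
    have h3 : F x = S := by
      rw [hF, hS]; exact Finset.sum_congr rfl fun μ _ => by rw [ha]; ring
    have h4 := abs_le_sqrt_add_sqrt hd hc' hx
    rw [h3, abs_of_nonneg hS0] at h4
    have h5 : √(∫ y in (0 : ℝ)..1, F y ^ 2) ≤ √S / √(V z) := by
      rw [← Real.sqrt_div hS0]
      exact Real.sqrt_le_sqrt ((le_div_iff₀ hv).2 (by linarith))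
    have h6 := Real.sqrt_le_sqrt h1
    have h7 : S ≤ √S * (1 / √(V z) + 1) := by
      calc S ≤ √S / √(V z) + √S := by linarith
        _ = _ := by ring
    have h8 := Real.sq_sqrt hS0
    have h9 := Real.sqrt_nonneg S
    rcases h9.eq_or_lt with h0 | h0
    · rw [← h8, ← h0]
      nlinarith [sq_nonneg (1 / √(V z) + 1)]
    · have : √S ≤ 1 / √(V z) + 1 := by
        by_contra! hlt
        nlinarith
      rw [← h8]
      exact pow_le_pow_left₀ h9 this 2
  have hint : ∫ x in (0 : ℝ)..1, ∑ μ ∈ s, μ⁻¹ * e μ x ^ 2 = ∑ μ ∈ s, μ⁻¹ := by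
    rw [intervalIntegral.integral_finsetSum]
    · refine Finset.sum_congr rfl fun μ hμ => ?_
      rw [intervalIntegral.integral_const_mul, hnorm μ hμ, mul_one]
    · exact fun μ hμ => intervalIntegrable_unit
        (continuousOn_const.mul ((he μ hμ).continuousOn.pow 2))
  rw [← hint]
  have := integral_unit_mono (f := fun x => ∑ μ ∈ s, μ⁻¹ * e μ x ^ 2)
    (continuousOn_finsetSum s fun μ hμ => continuousOn_const.mul ((he μ hμ).continuousOn.pow 2))
    (continuousOn_const (c := (1 / √(V z) + 1) ^ 2)) hpt
  simpa using this

/-! ### Completeness of the eigenfunctions -/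

section Abstract

open Module.End ContinuousLinearMap

variable {K L : Type*} [NormedAddCommGroup K] [InnerProductSpace ℝ K] [CompleteSpace K]
  [NormedAddCommGroup L] [InnerProductSpace ℝ L] [CompleteSpace L]

/-- Completeness of the eigenvectors of a coercive symmetric form `B` relative to a compactly
embedded dense form domain `J : K → L`. -/
theorem eq_zero_of_orthogonal_of_compact (J : K →L[ℝ] L) (hJ : IsCompactOperator J)
    (hd : DenseRange J) (B : K →L[ℝ] K →L[ℝ] ℝ) (hB : IsCoercive B)
    (hsymm : ∀ h k, B h k = B k h) {v : L}
    (hv : ∀ (h : K) (μ : ℝ), (∀ k, B h k = μ * inner ℝ (J h) (J k)) → inner ℝ (J h) v = 0) :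
    v = 0 := by
  -- Lax-Milgram: E represents B, so T = J E⁻¹ J* is the solution operator of B(h, ·) = ⟨f, J ·⟩. It
  -- is compact because J is and symmetric because B is, so its eigenspaces span a dense subspace;
  -- it remains to see that v is orthogonal to each of them.
  set E := hB.continuousLinearEquivOfBilin with hE
  have hEB : ∀ h k, inner ℝ (E h) k = B h k := hB.continuousLinearEquivOfBilin_apply
  set T : L →L[ℝ] L := J ∘L (E.symm : K →L[ℝ] K) ∘L adjoint J with hT
  have hTc : IsCompactOperator T :=
    hJ.comp_clm ((E.symm : K →L[ℝ] K) ∘L adjoint J)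
  have hTB : ∀ f, T f = J (E.symm (adjoint J f)) := fun f => rfl
  have hform : ∀ f k, B (E.symm (adjoint J f)) k = inner ℝ f (J k) := fun f k => by
    rw [← hEB, ContinuousLinearEquiv.apply_symm_apply, adjoint_inner_left]
  have hTs : (T : L →ₗ[ℝ] L).IsSymmetric := by
    intro f g
    change inner ℝ (T f) g = inner ℝ f (T g)
    rw [hTB, hTB, ← hform, hsymm, hform, real_inner_comm]
  have hbot := orthogonalComplement_iSup_eigenspaces_eq_bot hTc hTs
  rw [← Submodule.mem_bot ℝ, ← hbot, ← Submodule.iInf_orthogonal, Submodule.mem_iInf]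
  intro lam f hf
  rw [mem_eigenspace_iff] at hf
  change T f = lam • f at hf
  set h := E.symm (adjoint J f) with hh
  -- The kernel of T is trivial: coercivity gives h = 0, and then density of the range of J gives f
  -- = 0. For lam ≠ 0, h is a weak eigenvector with eigenvalue lam⁻¹, to which `hv` applies.
  by_cases h0 : lam = 0
  · rw [h0, zero_smul, hTB, ← hh] at hf
    have h1 : B h h = 0 := by rw [hh, hform, ← hh, hf, inner_zero_right]
    obtain ⟨C, hC, hco⟩ := hB
    have h2 : h = 0 := by
      have := hco h
      rw [h1] at this
      have h3 : ‖h‖ = 0 := by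
        by_contra hne
        have : 0 < ‖h‖ := lt_of_le_of_ne (norm_nonneg _) (Ne.symm hne)
        have := mul_pos (mul_pos hC this) this
        linarith
      exact norm_eq_zero.1 h3
    have h3 : ∀ k, inner ℝ f (J k) = 0 := fun k => by
      rw [← hform f k, ← hh, h2]; simp
    have h4 : f = 0 := by
      refine hd.eq_zero_of_inner_left (𝕜 := ℝ) fun k => ?_
      exact h3 k
    rw [h4, inner_zero_left]
  · have h1 : inner ℝ (J h) v = 0 := by
      refine hv h lam⁻¹ fun k => ?_
      rw [hh, hform, ← hh, ← hTB, hf, real_inner_smul_left, inv_mul_cancel_left₀ h0]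
    rw [← hTB, hf, real_inner_smul_left] at h1
    exact (mul_eq_zero.1 h1).resolve_left h0

end Abstract

/-- The Hilbert space `L²` over the unit interval as a type. -/
abbrev L2X : Type := Lp ℝ 2 (volume : Measure unitInterval)

/-- The embedding of the continuous functions in `L²`. -/
noncomputable abbrev toL2X : C(unitInterval, ℝ) →L[ℝ] L2X := ContinuousMap.toLp 2 volume ℝ

lemma integral_unitInterval (f : ℝ → ℝ) :
    ∫ x : unitInterval, f x = ∫ x in (0 : ℝ)..1, f x := by
  rw [intervalIntegral.integral_of_le zero_le_one, ← integral_Icc_eq_integral_Ioc]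
  exact integral_subtype_comap measurableSet_Icc f

lemma setIntegral_Iic_unitInterval (f : ℝ → ℝ) (x : unitInterval) :
    ∫ y in Iic x, f y = ∫ y in (0 : ℝ)..x, f y := by
  rw [intervalIntegral.integral_of_le x.2.1, ← integral_Icc_eq_integral_Ioc,
    ← integral_indicator measurableSet_Iic, ← integral_indicator measurableSet_Icc]
  have h1 : ∫ y : unitInterval, (Iic x).indicator (fun y : unitInterval => f y) y =
      ∫ y : unitInterval, (Icc (0 : ℝ) x).indicator f y := by
    congr 1; ext y
    by_cases h : y ≤ x
    · rw [indicator_of_mem (by exact h), indicator_of_mem (by exact ⟨y.2.1, h⟩)]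
    · rw [indicator_of_notMem (by exact h), indicator_of_notMem (by exact fun h' => h h'.2)]
  rw [h1, integral_unitInterval, intervalIntegral.integral_of_le zero_le_one,
    ← integral_Icc_eq_integral_Ioc, ← integral_indicator measurableSet_Icc, indicator_indicator,
    inter_eq_right.2 (Icc_subset_Icc_right x.2.2)]

lemma inner_toL2X (f g : C(unitInterval, ℝ)) :
    inner ℝ (toL2X f) (toL2X g) = ∫ x : unitInterval, f x * g x := by
  rw [ContinuousMap.inner_toLp]
  congr 1; ext x; simp [mul_comm]

/-! ### The Volterra operator and its compactness -/

lemma L2X.integrable (g : L2X) : Integrable g (volume : Measure unitInterval) :=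
  (Lp.memLp g).integrable one_le_two

lemma norm_indicator_L2X {s : Set unitInterval} (hs : MeasurableSet s) :
    ‖indicatorConstLp 2 hs (measure_ne_top volume s) (1 : ℝ)‖ = √(volume.real s) := by
  rw [norm_indicatorConstLp (by simp) (by simp), norm_one, one_mul, Real.sqrt_eq_rpow]
  norm_num

lemma abs_setIntegral_L2X_le (g : L2X) {s : Set unitInterval} (hs : MeasurableSet s) :
    |∫ y in s, g y| ≤ √(volume.real s) * ‖g‖ := by
  rw [← L2.inner_indicatorConstLp_one hs (measure_ne_top _ _) g, ← norm_indicator_L2X hs]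
  exact abs_real_inner_le_norm _ _

/-- Cauchy-Schwarz on the interval between the two points. This Hölder-½ bound supplies the common
modulus of continuity for Arzelà-Ascoli. -/
lemma abs_primitive_sub_le (g : L2X) (x y : unitInterval) :
    |(∫ s in Iic x, g s) - ∫ s in Iic y, g s| ≤ √(dist x y) * ‖g‖ := by
  wlog hxy : y ≤ x generalizing x y
  · rw [abs_sub_comm, dist_comm]
    exact this y x (le_of_not_ge hxy)
  rw [← Iic_union_Ioc_eq_Iic hxy, setIntegral_union _ measurableSet_Ioc
    (L2X.integrable g).integrableOn (L2X.integrable g).integrableOn, add_sub_cancel_left]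
  · refine (abs_setIntegral_L2X_le g measurableSet_Ioc).trans_eq ?_
    rw [measureReal_def, unitInterval.volume_Ioc, ENNReal.toReal_ofReal (sub_nonneg.2 hxy),
      Subtype.dist_eq, Real.dist_eq, abs_of_nonneg (sub_nonneg.2 (show (y : ℝ) ≤ x from hxy))]
  · exact Set.disjoint_left.2 fun z hz hz' => absurd hz'.1 (not_lt.2 hz)

lemma continuous_primitive (g : L2X) : Continuous fun x : unitInterval => ∫ s in Iic x, g s := by
  rw [continuous_iff_continuousAt]
  intro x
  rw [ContinuousAt, tendsto_iff_dist_tendsto_zero]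
  refine squeeze_zero (fun _ => dist_nonneg) (fun y => abs_primitive_sub_le g y x) ?_
  have : Continuous fun y : unitInterval => √(dist y x) * ‖g‖ := by fun_prop
  simpa using this.tendsto x

/-- The Volterra operator `g ↦ ∫₀ˣ g`. -/
noncomputable def volterra : L2X →L[ℝ] C(unitInterval, ℝ) :=
  LinearMap.mkContinuous
    { toFun := fun g => ⟨fun x => ∫ s in Iic x, g s, continuous_primitive g⟩
      map_add' := fun g h => by
        ext x
        simp only [ContinuousMap.coe_mk, ContinuousMap.add_apply]
        rw [← integral_add (L2X.integrable g).integrableOn (L2X.integrable h).integrableOn]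
        exact integral_congr_ae (ae_restrict_of_ae (Lp.coeFn_add g h))
      map_smul' := fun c g => by
        ext x
        simp only [ContinuousMap.coe_mk, ContinuousMap.smul_apply, RingHom.id_apply]
        rw [← integral_smul]
        exact integral_congr_ae (ae_restrict_of_ae (Lp.coeFn_smul c g)) }
    1 fun g => by
      rw [ContinuousMap.norm_le _ (by positivity)]
      intro x
      refine (abs_setIntegral_L2X_le g measurableSet_Iic).trans ?_
      refine mul_le_mul_of_nonneg_right ?_ (norm_nonneg _)
      rw [Real.sqrt_le_one]
      exact measureReal_le_one

lemma volterra_apply (g : L2X) (x : unitInterval) : volterra g x = ∫ s in Iic x, g s := rfl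

lemma norm_volterra_le (g : L2X) : ‖volterra g‖ ≤ ‖g‖ := by
  have h : ‖volterra‖ ≤ 1 := LinearMap.mkContinuous_norm_le _ zero_le_one _
  simpa using volterra.le_of_opNorm_le h g

lemma volterra_toL2X (f : C(unitInterval, ℝ)) (F : ℝ → ℝ) (hF : ∀ x : unitInterval, F x = f x)
    (x : unitInterval) : volterra (toL2X f) x = ∫ s in (0 : ℝ)..x, F s := by
  rw [← setIntegral_Iic_unitInterval, volterra_apply]
  refine integral_congr_ae (ae_restrict_of_ae ?_)
  filter_upwards [ContinuousMap.coeFn_toLp (p := 2) (𝕜 := ℝ) volume f] with y hy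
  rw [hy, hF]

/-- Arzelà-Ascoli: primitives of the unit ball are bounded by 1 and share the modulus √r. -/
lemma isCompactOperator_volterra : IsCompactOperator volterra := by
  refine (isCompactOperator_iff_isCompact_closure_image_ball
    (volterra : L2X →ₗ[ℝ] C(unitInterval, ℝ)) zero_lt_one).2 ?_
  let Φ := ContinuousMap.isometryEquivBoundedOfCompact unitInterval ℝ
  set A := (volterra : L2X →ₗ[ℝ] C(unitInterval, ℝ)) '' Metric.ball 0 1 with hA
  have h1 : IsCompact (closure (Φ '' A)) := by
    refine BoundedContinuousFunction.arzela_ascoli (Icc (-1 : ℝ) 1) isCompact_Icc _ ?_ ?_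
    · rintro _ x ⟨_, ⟨g, hg, rfl⟩, rfl⟩
      have h2 : ‖volterra g‖ ≤ 1 := (norm_volterra_le g).trans (mem_ball_zero_iff.1 hg).le
      exact abs_le.1 (((volterra g).norm_coe_le_norm x).trans h2)
    · refine Metric.equicontinuous_of_continuity_modulus (fun r => √r) ?_ _ ?_
      · simpa using Real.continuous_sqrt.tendsto 0
      · rintro x y ⟨_, ⟨_, ⟨g, hg, rfl⟩, rfl⟩⟩
        refine (abs_primitive_sub_le g x y).trans ?_
        have : ‖g‖ ≤ 1 := (mem_ball_zero_iff.1 hg).le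
        exact mul_le_of_le_one_right (Real.sqrt_nonneg _) this
  rw [← Φ.toHomeomorph.isCompact_image, Φ.toHomeomorph.image_closure]
  exact h1

/-- The form domain `H¹([0,1])`, an element `(c, g)` standing for the function `c + ∫₀ˣ g`. -/
abbrev H1 : Type := WithLp 2 (ℝ × L2X)

/-- The function on `[0,1]` represented by an element of the form domain. -/
noncomputable def H1.toFun : H1 →L[ℝ] C(unitInterval, ℝ) :=
  (ContinuousLinearMap.smulRight (1 : ℝ →L[ℝ] ℝ) (1 : C(unitInterval, ℝ))) ∘L
      WithLp.fstL 2 ℝ ℝ L2X + volterra ∘L WithLp.sndL 2 ℝ ℝ L2X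

lemma H1.toFun_apply (h : H1) (x : unitInterval) : H1.toFun h x = h.fst + volterra h.snd x := by
  simp [H1.toFun]

/-- The embedding of the form domain in `L²`. -/
noncomputable def H1.toL2 : H1 →L[ℝ] L2X := toL2X ∘L H1.toFun

lemma H1.toL2_apply (h : H1) : H1.toL2 h = toL2X (H1.toFun h) := rfl

lemma H1.isCompactOperator_toL2 : IsCompactOperator H1.toL2 := by
  have h1 : IsCompactOperator H1.toFun := by
    have h2 : IsCompactOperator
        ((ContinuousLinearMap.smulRight (1 : ℝ →L[ℝ] ℝ) (1 : C(unitInterval, ℝ))) ∘L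
          WithLp.fstL 2 ℝ ℝ L2X) :=
      (isCompactOperator_of_locallyCompactSpace_dom (WithLp.fstL 2 ℝ ℝ L2X)).clm_comp
        (ContinuousLinearMap.smulRight (1 : ℝ →L[ℝ] ℝ) (1 : C(unitInterval, ℝ)))
    exact h2.add (isCompactOperator_volterra.comp_clm (WithLp.sndL 2 ℝ ℝ L2X))
  exact h1.clm_comp toL2X

lemma H1.toFun_of_hasDeriv {f f' : ℝ → ℝ} (hf : HasDerivOnI f f')
    (F F' : C(unitInterval, ℝ)) (hF : ∀ x : unitInterval, f x = F x)
    (hF' : ∀ x : unitInterval, f' x = F' x) (hf' : ContinuousOn f' I) :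
    H1.toFun (WithLp.toLp 2 (f 0, toL2X F')) = F := by
  ext x
  rw [H1.toFun_apply]
  change f 0 + volterra (toL2X F') x = F x
  rw [volterra_toL2X F' f' hF', hf.integral_eq hf' zero_mem_I x.2, hF]
  ring

/-- Polynomials have L² derivatives, so they lie in the range of `H1.toFun`; Weierstrass makes them
dense in the continuous functions, which are dense in L². -/
lemma H1.denseRange_toL2 : DenseRange H1.toL2 := by
  refine (ContinuousMap.toLp_denseRange ℝ volume ℝ (by simp)).comp ?_ toL2X.continuous
  have h1 : (polynomialFunctions (Icc (0 : ℝ) 1) : Set C(Icc (0 : ℝ) 1, ℝ)) ⊆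
      range H1.toFun := by
    rintro _ ⟨p, -, rfl⟩
    refine ⟨_, H1.toFun_of_hasDeriv (f := fun x => p.eval x)
      (f' := fun x => p.derivative.eval x) (fun x _ => (p.hasDerivAt x).hasDerivWithinAt) _
      (p.derivative.toContinuousMapOn _) (fun x => rfl) (fun x => rfl)
      p.derivative.continuous.continuousOn⟩
  refine Dense.mono h1 ?_
  have h2 := polynomialFunctions_closure_eq_top 0 1
  rw [dense_iff_closure_eq, ← Subalgebra.topologicalClosure_coe, h2]
  rfl

/-! ### The quadratic form on H¹ and its coercivity -/

section Form

variable (W : C(unitInterval, ℝ))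

/-- The quadratic form of `-∂ₓₓ + W`. -/
noncomputable def H1.form : H1 →L[ℝ] H1 →L[ℝ] ℝ :=
  (innerSL ℝ).bilinearComp (WithLp.sndL 2 ℝ ℝ L2X) (WithLp.sndL 2 ℝ ℝ L2X) +
    (innerSL ℝ).bilinearComp (toL2X ∘L ContinuousLinearMap.mul ℝ _ W ∘L H1.toFun) H1.toL2

lemma H1.form_apply (h k : H1) : H1.form W h k = inner ℝ h.snd k.snd +
    ∫ x, W x * H1.toFun h x * H1.toFun k x := by
  have : H1.form W h k = inner ℝ h.snd k.snd +
    inner ℝ (toL2X (W * H1.toFun h)) (toL2X (H1.toFun k)) := rfl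
  rw [this, inner_toL2X]
  rfl

lemma integrable_unitInterval (f : C(unitInterval, ℝ)) : Integrable f :=
  f.continuous.integrable_of_hasCompactSupport (HasCompactSupport.of_compactSpace f)

lemma H1.form_coercive (hW : ∀ x, 0 < W x) : IsCoercive (H1.form W) := by
  obtain ⟨z, -, hz⟩ := isCompact_univ.exists_isMinOn univ_nonempty W.continuous.continuousOn
  have hv := hW z
  -- For u = (c, g) and F = c + ∫₀ˣ g, c² ≤ 2‖F‖² + 2‖g‖², so ‖u‖² ≤ 3‖g‖² + 2N. The constant is
  -- chosen to compare this with ‖g‖² + (min W) N, a lower bound for the form.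
  refine ⟨min (1 / 3) (W z / 2), by positivity, fun u => ?_⟩
  rw [H1.form_apply, real_inner_self_eq_norm_sq]
  set F := H1.toFun u with hF
  set G := volterra u.snd with hG
  set N := ∫ x, F x ^ 2 with hN
  have hN0 : 0 ≤ N := integral_nonneg fun x => sq_nonneg _
  have h1 : W z * N ≤ ∫ x, W x * F x * F x := by
    rw [hN, ← integral_const_mul]
    refine integral_mono (integrable_unitInterval (W z • (F ^ 2)))
      (integrable_unitInterval (W * F * F)) fun x => ?_
    have : W z ≤ W x := hz (mem_univ x)
    nlinarith [mul_le_mul_of_nonneg_right this (sq_nonneg (F x))]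
  have h2 : u.fst ^ 2 ≤ 2 * N + 2 * ‖u.snd‖ ^ 2 := by
    have h3 : ∫ _x : unitInterval, u.fst ^ 2 ≤ ∫ x : unitInterval, (2 * F x ^ 2 + 2 * ‖u.snd‖ ^ 2) := by
      refine integral_mono (integrable_const _)
        ((integrable_unitInterval ((2 : ℝ) • F ^ 2)).add (integrable_const _)) fun x => ?_
      have h4 : F x = u.fst + G x := H1.toFun_apply u x
      have h5 : |G x| ≤ ‖u.snd‖ := (G.norm_coe_le_norm x).trans (norm_volterra_le _)
      have h6 : G x ^ 2 ≤ ‖u.snd‖ ^ 2 := by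
        rw [← sq_abs]; exact pow_le_pow_left₀ (abs_nonneg _) h5 2
      change u.fst ^ 2 ≤ 2 * F x ^ 2 + 2 * ‖u.snd‖ ^ 2
      rw [h4]
      nlinarith [sq_nonneg (u.fst + 2 * G x)]
    have h4 := integral_add (μ := volume) (f := fun x => 2 * F x ^ 2)
      (g := fun _ => 2 * ‖u.snd‖ ^ 2) (integrable_unitInterval ((2 : ℝ) • F ^ 2))
      (integrable_const _)
    rw [h4, integral_const_mul] at h3
    simpa using h3
  have h3 := WithLp.prod_norm_sq_eq_of_L2 u
  rw [Real.norm_eq_abs, sq_abs] at h3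
  have h4 := min_le_left (1 / 3) (W z / 2)
  have h5 := min_le_right (1 / 3) (W z / 2)
  have h6 : 0 < min (1 / 3) (W z / 2) := by positivity
  set c := min (1 / 3) (W z / 2)
  have h7 : c * (‖u‖ ^ 2) ≤ c * (3 * ‖u.snd‖ ^ 2 + 2 * N) :=
    mul_le_mul_of_nonneg_left (by linarith) h6.le
  nlinarith [mul_le_mul_of_nonneg_right h4 (sq_nonneg ‖u.snd‖),
    mul_le_mul_of_nonneg_right h5 hN0]

lemma H1.form_symm (h k : H1) : H1.form W h k = H1.form W k h := by
  rw [H1.form_apply, H1.form_apply, real_inner_comm]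
  congr 2; ext x; ring

end Form

/-- Weak solutions of the eigenvalue equation are classical. -/
lemma exists_isEigenpair_of_form {V : ℝ → ℝ} (W : C(unitInterval, ℝ))
    (hW : ∀ x : unitInterval, V x = W x) {μ : ℝ} {h : H1}
    (hh : ∀ k, H1.form W h k = μ * inner ℝ (H1.toL2 h) (H1.toL2 k)) :
    ∃ f f', IsEigenpair V μ f f' ∧ ∀ x : unitInterval, f x = H1.toFun h x := by
  set F := H1.toFun h with hF
  set p : C(unitInterval, ℝ) := μ • F - W * F with hp
  -- Extending p continuously to the whole line makes two-sided derivatives available at the end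
  -- points.
  set q : ℝ → ℝ := fun x => p (projIcc 0 1 zero_le_one x) with hq
  have hqc : Continuous q := p.continuous.comp continuous_projIcc
  have hqp : ∀ x : unitInterval, q x = p x := fun x => by simp [hq]
  have key : ∀ k : H1, inner ℝ h.snd k.snd = ∫ x, p x * H1.toFun k x := by
    intro k
    have h1 := hh k
    rw [H1.form_apply, H1.toL2_apply, H1.toL2_apply, inner_toL2X, ← hF,
      ← integral_const_mul] at h1
    have h2 : ∫ x, p x * H1.toFun k x =
        (∫ x, μ * (F x * H1.toFun k x)) - ∫ x, W x * F x * H1.toFun k x := by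
      have h3 := integral_sub (integrable_unitInterval (μ • (F * H1.toFun k)))
        (integrable_unitInterval (W * F * H1.toFun k))
      refine Eq.trans ?_ h3
      congr 1; ext x; simp [hp]; ring
    linarith
  -- As p = (μ - W)F should be -F'', P is the candidate for F'. It vanishes at 1 by construction.
  set P : ℝ → ℝ := fun x => ∫ s in x..1, q s with hP
  have hPd : ∀ x, HasDerivAt P (-q x) x := fun x =>
    intervalIntegral.integral_hasDerivAt_left (hqc.intervalIntegrable _ _)
      (hqc.stronglyMeasurableAtFilter _ _) hqc.continuousAt
  have hPc : Continuous P := continuous_iff_continuousAt.2 fun x => (hPd x).continuousAt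
  have hP1 : P 1 = 0 := intervalIntegral.integral_same
  -- Testing against the constant function gives ∫ p = 0: the Neumann condition at 0 is the natural
  -- boundary condition of the form.
  have hP0 : P 0 = 0 := by
    have h1 := key (WithLp.toLp 2 (1, 0))
    have h2 : ∀ x, H1.toFun (WithLp.toLp 2 ((1 : ℝ), (0 : L2X))) x = 1 := fun x => by
      rw [H1.toFun_apply]; simp
    simp_rw [h2, mul_one, ← hqp] at h1
    rw [integral_unitInterval] at h1
    exact h1.symm.trans (inner_zero_right _)
  set Pc : C(unitInterval, ℝ) := ⟨fun x => P x, by fun_prop⟩ with hPcdef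
  -- Testing against (0, G), the function ∫₀ˣ G, and integrating by parts gives ⟨h.snd, G⟩ = ⟨P, G⟩
  -- for all continuous G.
  have hsnd : h.snd = toL2X Pc := by
    refine (ContinuousMap.toLp_denseRange ℝ volume ℝ (by simp)).eq_of_inner_left (𝕜 := ℝ)
      fun G => ?_
    set g : ℝ → ℝ := fun x => G (projIcc 0 1 zero_le_one x) with hg
    have hgc : Continuous g := G.continuous.comp continuous_projIcc
    have hgG : ∀ x : unitInterval, g x = G x := fun x => by simp [hg]
    have h1 := key (WithLp.toLp 2 (0, toL2X G))
    have h2 : ∀ x : unitInterval, H1.toFun (WithLp.toLp 2 ((0 : ℝ), toL2X G)) x =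
        ∫ s in (0 : ℝ)..x, g s := fun x => by
      rw [H1.toFun_apply, ← volterra_toL2X G g hgG x]; simp
    simp_rw [h2, ← hqp] at h1
    rw [integral_unitInterval (fun x => q x * ∫ s in (0 : ℝ)..x, g s)] at h1
    have h3 : HasDerivOnI (fun x => ∫ s in (0 : ℝ)..x, g s) g := fun x _ =>
      (intervalIntegral.integral_hasDerivAt_right (hgc.intervalIntegrable _ _)
        (hgc.stronglyMeasurableAtFilter _ _) hgc.continuousAt).hasDerivWithinAt
    have h4 := HasDerivOnI.integral_mul (f := P) (f' := fun x => -q x)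
      (fun x _ => (hPd x).hasDerivWithinAt) h3 hqc.neg.continuousOn hgc.continuousOn
    simp only [hP1, hP0, zero_mul, sub_zero, zero_sub, neg_mul,
      intervalIntegral.integral_neg, neg_inj] at h4
    rw [inner_toL2X]
    simp_rw [← hgG, hPcdef, ContinuousMap.coe_mk]
    rw [integral_unitInterval (fun x => P x * g x), ← h4, ← h1]
    rfl
  refine ⟨fun x => h.fst + ∫ s in (0 : ℝ)..x, P s, P, ⟨fun x _ => ?_, fun x hx => ?_, hP0, hP1⟩,
    fun x => ?_⟩
  · exact ((intervalIntegral.integral_hasDerivAt_right (hPc.intervalIntegrable _ _)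
        (hPc.stronglyMeasurableAtFilter _ _) hPc.continuousAt).const_add _).hasDerivWithinAt
  · refine (hPd x).hasDerivWithinAt.congr_deriv ?_
    have h1 : F ⟨x, hx⟩ = h.fst + ∫ s in (0 : ℝ)..x, P s := by
      rw [hF, H1.toFun_apply, hsnd, volterra_toL2X Pc P (fun _ => rfl)]
    change -q x = (V x - μ) * (h.fst + ∫ s in (0 : ℝ)..x, P s)
    rw [← h1, hqp ⟨x, hx⟩, hW ⟨x, hx⟩]
    simp [hp]; ring
  · rw [hF, H1.toFun_apply, hsnd, volterra_toL2X Pc P (fun _ => rfl)]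

/-- The eigenfunctions are complete in `L²`. -/
theorem eq_zero_of_orthogonal_eigenpairs {V : ℝ → ℝ} (hV : ContinuousOn V I)
    (hVpos : ∀ x ∈ I, 0 < V x) {v : L2X}
    (hv : ∀ μ f f' (F : C(unitInterval, ℝ)), IsEigenpair V μ f f' →
      (∀ x : unitInterval, f x = F x) → inner ℝ (toL2X F) v = 0) : v = 0 := by
  let W : C(unitInterval, ℝ) := ⟨fun x => V x, hV.domRestrict⟩
  refine eq_zero_of_orthogonal_of_compact H1.toL2 H1.isCompactOperator_toL2 H1.denseRange_toL2
    (H1.form W) (H1.form_coercive W fun x => hVpos x x.2) (H1.form_symm W) fun h μ hh => ?_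
  obtain ⟨f, f', hf, hfF⟩ := exists_isEigenpair_of_form W (fun _ => rfl) hh
  exact hv μ f f' _ hf hfF

/-! ### Infinitely many eigenvalues -/

lemma not_finiteDimensional_L2X : ¬ FiniteDimensional ℝ L2X := by
  intro hfin
  let Φ : Polynomial ℝ →ₗ[ℝ] L2X :=
    (toL2X : C(unitInterval, ℝ) →ₗ[ℝ] L2X) ∘ₗ
      (Polynomial.toContinuousMapOnAlgHom (Icc (0 : ℝ) 1)).toLinearMap
  have hinj : Function.Injective Φ := by
    rw [injective_iff_map_eq_zero]
    intro p hp
    have h1 : inner ℝ (Φ p) (Φ p) = 0 := by rw [hp, inner_zero_left]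
    have h2 : inner ℝ (Φ p) (Φ p) = ∫ x : unitInterval, p.eval (x : ℝ) * p.eval (x : ℝ) :=
      inner_toL2X _ _
    rw [h2, integral_unitInterval (fun x => p.eval x * p.eval x)] at h1
    have h3 := eqOn_zero_of_integral_sq_eq_zero (f := fun x => p.eval x)
      p.continuous.continuousOn (by simpa only [sq] using h1)
    exact Polynomial.eq_zero_of_infinite_isRoot p
      ((Icc_infinite (zero_lt_one (α := ℝ))).mono fun x hx => h3 x hx)
  exact Polynomial.not_finite (R := ℝ) (Module.Finite.of_injective Φ hinj)

/-- A choice of eigenfunctions, one for each eigenvalue, is complete. -/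
lemma eq_zero_of_orthogonal_choice {V : ℝ → ℝ} (hV : ContinuousOn V I)
    (hVpos : ∀ x ∈ I, 0 < V x) {e : ℝ → ℝ → ℝ}
    (he : ∀ μ ∈ neumannSpectrum V, IsNeumannEigenfunction V μ (e μ))
    {E : ℝ → C(unitInterval, ℝ)}
    (hE : ∀ μ ∈ neumannSpectrum V, ∀ x : unitInterval, E μ x = e μ x) {v : L2X}
    (hv : ∀ μ ∈ neumannSpectrum V, inner ℝ (toL2X (E μ)) v = 0) : v = 0 := by
  refine eq_zero_of_orthogonal_eigenpairs hV hVpos fun μ f f' F hf hF => ?_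
  by_cases h0 : ∃ x ∈ I, f x ≠ 0
  · have hμ : μ ∈ neumannSpectrum V := ⟨f, isNeumannEigenfunction_iff.2 ⟨h0, f', hf⟩⟩
    obtain ⟨hne, e', he'⟩ := isNeumannEigenfunction_iff.1 (he μ hμ)
    have h1 := hf.eqOn_smul hV he' (he'.apply_zero_ne hV hne)
    have h2 : F = (f 0 / e μ 0) • E μ := by
      ext x
      rw [← hF, h1 x x.2]
      simp [hE μ hμ]
    rw [h2, map_smul, real_inner_smul_left, hv μ hμ, mul_zero]
  · push Not at h0
    have h2 : F = 0 := by
      ext x; rw [← hF]; exact h0 x x.2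
    simp [h2]

/-- By simplicity, one eigenfunction per eigenvalue is complete; finitely many would span the
infinite-dimensional space L². -/
lemma infinite_neumannSpectrum {V : ℝ → ℝ} (hV : ContinuousOn V I)
    (hVpos : ∀ x ∈ I, 0 < V x) : (neumannSpectrum V).Infinite := by
  intro hfin
  have hex : ∀ μ ∈ neumannSpectrum V, ∃ f, IsNeumannEigenfunction V μ f := fun μ hμ => hμ
  choose! e he using hex
  have hex : ∀ μ ∈ neumannSpectrum V, ∃ F : C(unitInterval, ℝ),
      ∀ x : unitInterval, F x = e μ x := fun μ hμ => by
    obtain ⟨-, e', he'⟩ := isNeumannEigenfunction_iff.1 (he μ hμ)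
    exact ⟨⟨fun x => e μ x, he'.continuousOn.domRestrict⟩, fun _ => rfl⟩
  choose! E hE using hex
  set S : Submodule ℝ L2X := Submodule.span ℝ ((fun μ => toL2X (E μ)) '' neumannSpectrum V)
  have hSfin : FiniteDimensional ℝ S := FiniteDimensional.span_of_finite ℝ (hfin.image _)
  have hS : Sᗮ = ⊥ := by
    rw [Submodule.eq_bot_iff]
    intro v hv
    refine eq_zero_of_orthogonal_choice hV hVpos he hE fun μ hμ => ?_
    exact (Submodule.mem_orthogonal S v).1 hv _
      (Submodule.subset_span (mem_image_of_mem (fun μ => toL2X (E μ)) hμ))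
  rw [Submodule.orthogonal_eq_bot_iff] at hS
  rw [hS] at hSfin
  exact not_finiteDimensional_L2X (Module.Finite.equiv (Submodule.topEquiv (R := ℝ) (M := L2X)))

/-! ### The enumeration of the eigenvalues -/

/-- n eigenvalues in (0, M] contribute at least n/M to ∑ 1/μ, which is bounded. -/
lemma finite_neumannSpectrum_inter_Iic {V : ℝ → ℝ} (hV : ContinuousOn V I)
    (hVpos : ∀ x ∈ I, 0 < V x) (M : ℝ) : (neumannSpectrum V ∩ Iic M).Finite := by
  by_contra hinf
  obtain ⟨K, hK⟩ := exists_sum_inv_le hV hVpos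
  have hpos : ∀ μ ∈ neumannSpectrum V, 0 < μ := fun μ ⟨f, hf⟩ => by
    obtain ⟨hne, f', h⟩ := isNeumannEigenfunction_iff.1 hf
    exact h.pos hV hVpos hne
  obtain ⟨n, hn⟩ := exists_nat_gt (K * M)
  obtain ⟨t, ht, hcard⟩ := Set.Infinite.exists_subset_card_eq hinf n
  obtain ⟨ν, hν⟩ := Set.Infinite.nonempty hinf
  have hM : 0 < M := (hpos ν hν.1).trans_le hν.2
  have h1 := hK t fun μ hμ => (ht hμ).1
  have h2 : ∑ _μ ∈ t, M⁻¹ ≤ ∑ μ ∈ t, μ⁻¹ := Finset.sum_le_sum fun μ hμ =>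
    inv_anti₀ (hpos μ (ht hμ).1) (ht hμ).2
  rw [Finset.sum_const, hcard, nsmul_eq_mul] at h2
  have h3 : (n : ℝ) * M⁻¹ ≤ K := h2.trans h1
  rw [← div_eq_mul_inv, div_le_iff₀ hM] at h3
  linarith

/-- Local finiteness makes the infima in `eigval` attained; nonemptiness rules out the default value
of `sInf`. -/
lemma sInf_mem_of_finite_inter_Iic {S T : Set ℝ} (hS : ∀ M, (S ∩ Iic M).Finite) (hT : T ⊆ S)
    (hne : T.Nonempty) : IsLeast T (sInf T) := by
  obtain ⟨a, ha⟩ := hne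
  have hfin : (T ∩ Iic a).Finite := (hS a).subset (inter_subset_inter_left _ hT)
  obtain ⟨b, hb, hmin⟩ := hfin.exists_minimal ⟨a, ha, mem_Iic.2 le_rfl⟩
  have hl : IsLeast T b := by
    refine ⟨hb.1, fun c hc => ?_⟩
    by_contra! hlt
    exact absurd (hmin ⟨hc, hlt.le.trans hb.2⟩ hlt.le) (not_le.2 hlt)
  rwa [hl.csInf_eq]

section Enumeration

variable {V : ℝ → ℝ} (hV : ContinuousOn V I) (hVpos : ∀ x ∈ I, 0 < V x)
include hV hVpos

lemma isLeast_eigval_succ (n : ℕ) :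
    IsLeast (neumannSpectrum V ∩ Ioi (eigval V n)) (eigval V (n + 1)) := by
  refine sInf_mem_of_finite_inter_Iic (finite_neumannSpectrum_inter_Iic hV hVpos)
    inter_subset_left ?_
  by_contra hne
  rw [not_nonempty_iff_eq_empty] at hne
  refine infinite_neumannSpectrum hV hVpos
    ((finite_neumannSpectrum_inter_Iic hV hVpos (eigval V n)).subset fun μ hμ => ⟨hμ, ?_⟩)
  by_contra hlt
  have : μ ∈ neumannSpectrum V ∩ Ioi (eigval V n) := ⟨hμ, mem_Ioi.2 (not_le.1 hlt)⟩
  rw [hne] at this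
  exact this

lemma isLeast_eigval_zero : IsLeast (neumannSpectrum V) (eigval V 0) :=
  sInf_mem_of_finite_inter_Iic (finite_neumannSpectrum_inter_Iic hV hVpos) subset_rfl
    (infinite_neumannSpectrum hV hVpos).nonempty

lemma eigval_mem (n : ℕ) : eigval V n ∈ neumannSpectrum V := by
  cases n with
  | zero => exact (isLeast_eigval_zero hV hVpos).1
  | succ n => exact (isLeast_eigval_succ hV hVpos n).1.1

lemma eigval_strictMono : StrictMono (eigval V) :=
  strictMono_nat_of_lt_succ fun n => (isLeast_eigval_succ hV hVpos n).1.2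

/-- An eigenvalue missed by the enumeration would exceed every μ_n, leaving infinitely many
eigenvalues below it. -/
lemma exists_eigval_eq {μ : ℝ} (hμ : μ ∈ neumannSpectrum V) : ∃ n, eigval V n = μ := by
  by_contra! hne
  have hlt : ∀ n, eigval V n < μ := by
    intro n
    refine lt_of_le_of_ne ?_ (hne n)
    induction n with
    | zero => exact (isLeast_eigval_zero hV hVpos).2 hμ
    | succ n ih => exact (isLeast_eigval_succ hV hVpos n).2 ⟨hμ, lt_of_le_of_ne ih (hne n)⟩
  refine Set.infinite_range_of_injective (eigval_strictMono hV hVpos).injective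
    ((finite_neumannSpectrum_inter_Iic hV hVpos μ).subset ?_)
  rintro _ ⟨n, rfl⟩
  exact ⟨eigval_mem hV hVpos n, (hlt n).le⟩

lemma eigfun_spec (n : ℕ) : IsNeumannEigenfunction V (eigval V n) (eigfun V n) ∧
    ∫ x in (0 : ℝ)..1, eigfun V n x ^ 2 = 1 ∧ 0 < eigfun V n 0 := by
  have hex : ∃ f, IsNeumannEigenfunction V (eigval V n) f ∧
      ∫ x in (0 : ℝ)..1, f x ^ 2 = 1 ∧ 0 < f 0 := by
    obtain ⟨f, hf⟩ := eigval_mem hV hVpos n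
    obtain ⟨hne, f', h⟩ := isNeumannEigenfunction_iff.1 hf
    have h0 := h.apply_zero_ne hV hne
    set N := ∫ x in (0 : ℝ)..1, f x ^ 2 with hN
    have hNpos : 0 < N := intervalIntegral.integral_pos zero_lt_one (h.continuousOn.pow 2)
      (fun x _ => sq_nonneg _) ⟨0, zero_mem_I, by positivity⟩
    -- The quotient is the sign of f(0), the other factor normalises in L².
    set c : ℝ := |f 0| / f 0 * (√N)⁻¹ with hc
    have hc0 : 0 < c * f 0 := by
      have : c * f 0 = |f 0| * (√N)⁻¹ := by rw [hc]; field_simp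
      rw [this]
      exact mul_pos (abs_pos.2 h0) (inv_pos.2 (Real.sqrt_pos.2 hNpos))
    refine ⟨fun x => c * f x, isNeumannEigenfunction_iff.2
      ⟨⟨0, zero_mem_I, hc0.ne'⟩, _, h.smul c⟩, ?_, hc0⟩
    simp_rw [mul_pow]
    rw [intervalIntegral.integral_const_mul, ← hN, hc, mul_pow, div_pow, sq_abs,
      div_self (pow_ne_zero 2 h0), one_mul, inv_pow, Real.sq_sqrt hNpos.le,
      inv_mul_cancel₀ hNpos.ne']
  rw [eigfun, dif_pos hex]
  exact hex.choose_spec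

/-- Identifies the existentially given derivative with `derivWithin`, the one that occurs in the
Koopman modes. -/
lemma isEigenpair_eigfun (n : ℕ) :
    IsEigenpair V (eigval V n) (eigfun V n) (derivWithin (eigfun V n) I) := by
  obtain ⟨-, f', h⟩ := isNeumannEigenfunction_iff.1 (eigfun_spec hV hVpos n).1
  have heq := h.deriv.continuousOn_congr
  exact ⟨fun x hx => by rw [heq hx]; exact h.deriv x hx,
    fun x hx => (h.deriv_two x hx).congr_of_mem heq hx,
    (heq zero_mem_I).trans h.left, (heq one_mem_I).trans h.right⟩

lemma integral_eigfun_sq (n : ℕ) : ∫ x in (0 : ℝ)..1, eigfun V n x ^ 2 = 1 :=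
  (eigfun_spec hV hVpos n).2.1

lemma continuousOn_eigfun (n : ℕ) : ContinuousOn (eigfun V n) I :=
  (isEigenpair_eigfun hV hVpos n).continuousOn

lemma continuousOn_deriv_eigfun (n : ℕ) : ContinuousOn (derivWithin (eigfun V n) I) I :=
  (isEigenpair_eigfun hV hVpos n).continuousOn_deriv

lemma eigval_pos (n : ℕ) : 0 < eigval V n :=
  (isEigenpair_eigfun hV hVpos n).pos hV hVpos
    ⟨0, zero_mem_I, (eigfun_spec hV hVpos n).2.2.ne'⟩

lemma coeff_eigfun (n m : ℕ) : coeff V n (eigfun V m) = if n = m then 1 else 0 := by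
  split_ifs with h
  · refine Eq.trans ?_ (integral_eigfun_sq hV hVpos n)
    simp only [← h, coeff, sq]
  · exact (isEigenpair_eigfun hV hVpos n).orthogonal hV (isEigenpair_eigfun hV hVpos m)
      ((eigval_strictMono hV hVpos).injective.ne h)

lemma summable_inv_eigval : Summable fun n => (eigval V n)⁻¹ := by
  obtain ⟨K, hK⟩ := exists_sum_inv_le hV hVpos
  refine summable_of_sum_le (c := K) (fun n => inv_nonneg.2 (eigval_pos hV hVpos n).le) fun s => ?_
  have := hK (s.map ⟨eigval V, (eigval_strictMono hV hVpos).injective⟩) fun μ hμ => by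
    obtain ⟨n, -, rfl⟩ := Finset.mem_map.1 hμ
    exact eigval_mem hV hVpos n
  rwa [Finset.sum_map] at this

/-- **Parseval's identity** for continuous functions. -/
theorem hasSum_coeff_sq {f : ℝ → ℝ} (hf : ContinuousOn f I) :
    HasSum (fun n => coeff V n f ^ 2) (∫ x in (0 : ℝ)..1, f x ^ 2) := by
  let E : ℕ → C(unitInterval, ℝ) := fun n =>
    ⟨fun x => eigfun V n x, (continuousOn_eigfun hV hVpos n).domRestrict⟩
  let F : C(unitInterval, ℝ) := ⟨fun x => f x, hf.domRestrict⟩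
  have hin : ∀ n m, inner ℝ (toL2X (E n)) (toL2X (E m)) = if n = m then 1 else 0 := fun n m => by
    rw [inner_toL2X, ← coeff_eigfun hV hVpos n m]
    exact integral_unitInterval fun x => eigfun V n x * eigfun V m x
  have horth : Orthonormal ℝ fun n => toL2X (E n) := orthonormal_iff_ite.2 hin
  have hbot : (Submodule.span ℝ (range fun n => toL2X (E n)))ᗮ = ⊥ := by
    rw [Submodule.eq_bot_iff]
    intro v hv
    have hex : ∀ μ ∈ neumannSpectrum V, ∃ n, eigval V n = μ :=
      fun μ hμ => exists_eigval_eq hV hVpos hμ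
    choose! N hN using hex
    refine eq_zero_of_orthogonal_choice hV hVpos (e := fun μ => eigfun V (N μ))
      (E := fun μ => E (N μ)) (fun μ hμ => ?_) (fun μ hμ x => rfl) fun μ hμ => ?_
    · have := (eigfun_spec hV hVpos (N μ)).1
      rwa [hN μ hμ] at this
    · exact (Submodule.mem_orthogonal _ v).1 hv _ (Submodule.subset_span ⟨N μ, rfl⟩)
  let b := HilbertBasis.mkOfOrthogonalEqBot horth hbot
  have h := b.hasSum_inner_mul_inner (toL2X F) (toL2X F)
  have hb : ∀ n, b n = toL2X (E n) := fun n => by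
    rw [HilbertBasis.coe_mkOfOrthogonalEqBot]
  have h1 : ∀ n, inner ℝ (toL2X (E n)) (toL2X F) = coeff V n f := fun n => by
    rw [inner_toL2X]
    exact integral_unitInterval fun x => eigfun V n x * f x
  have h2 : inner ℝ (toL2X F) (toL2X F) = ∫ x in (0 : ℝ)..1, f x ^ 2 := by
    rw [inner_toL2X]
    refine (integral_unitInterval fun x => f x * f x).trans ?_
    simp only [sq]
  rw [h2] at h
  have h3 : (fun n => coeff V n f ^ 2) =
      fun n => inner ℝ (toL2X F) (b n) * inner ℝ (b n) (toL2X F) := by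
    funext n
    rw [hb, real_inner_comm, h1, sq]
  rwa [h3]

lemma eqOn_zero_of_coeff_eq_zero {f : ℝ → ℝ} (hf : ContinuousOn f I)
    (h : ∀ n, coeff V n f = 0) : ∀ x ∈ I, f x = 0 := by
  have h1 := hasSum_coeff_sq hV hVpos hf
  simp only [h, ne_eq, OfNat.ofNat_ne_zero, not_false_eq_true, zero_pow] at h1
  exact eqOn_zero_of_integral_sq_eq_zero hf (h1.unique hasSum_zero)

end Enumeration

/-! ### The ground state -/

lemma coeff_congr {V : ℝ → ℝ} (n : ℕ) {f g : ℝ → ℝ} (h : EqOn f g I) : coeff V n f = coeff V n g :=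
  integral_unit_congr fun x hx => by simp only [h hx]

lemma coeff_const_mul {V : ℝ → ℝ} (n : ℕ) (c : ℝ) (f : ℝ → ℝ) :
    coeff V n (fun x => c * f x) = c * coeff V n f := by
  rw [coeff, coeff, ← intervalIntegral.integral_const_mul]
  congr 1; ext x; ring

section GroundState

variable {V : ℝ → ℝ} (hV : ContinuousOn V I) (hVpos : ∀ x ∈ I, 0 < V x)
include hV hVpos

lemma coeff_sub (n : ℕ) {f g : ℝ → ℝ} (hf : ContinuousOn f I) (hg : ContinuousOn g I) :
    coeff V n (fun x => f x - g x) = coeff V n f - coeff V n g := by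
  have he := continuousOn_eigfun hV hVpos n
  refine Eq.trans ?_ (integral_unit_sub (he.mul hf) (he.mul hg))
  rw [coeff]
  congr 1; ext x; ring

lemma abs_coeff_le (n : ℕ) {f : ℝ → ℝ} (hf : ContinuousOn f I) {C : ℝ}
    (hC : ∀ x ∈ I, |f x| ≤ C) : |coeff V n f| ≤ C := by
  have he := continuousOn_eigfun hV hVpos n
  have hC0 : 0 ≤ C := (abs_nonneg _).trans (hC 0 zero_mem_I)
  have h1 : |coeff V n f| ≤ ∫ x in (0 : ℝ)..1, |eigfun V n x * f x| :=
    intervalIntegral.abs_integral_le_integral_abs zero_le_one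
  have h2 : ∫ x in (0 : ℝ)..1, |eigfun V n x * f x| ≤ ∫ x in (0 : ℝ)..1, C * |eigfun V n x| :=
    integral_unit_mono (he.mul hf).abs (continuousOn_const.mul he.abs) fun x hx => by
      rw [abs_mul, mul_comm]
      exact mul_le_mul_of_nonneg_right (hC x hx) (abs_nonneg _)
  have h3 := sq_integral_abs_le he
  rw [integral_eigfun_sq hV hVpos] at h3
  have h4 : ∫ x in (0 : ℝ)..1, |eigfun V n x| ≤ 1 := by nlinarith
  rw [intervalIntegral.integral_const_mul] at h2
  nlinarith

/-- Bessel's inequality for the quadratic form of the operator. -/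
lemma sum_eigval_mul_coeff_sq_le (s : Finset ℕ) {g g' : ℝ → ℝ} (hg : HasDerivOnI g g')
    (hg' : ContinuousOn g' I) :
    ∑ q ∈ s, eigval V q * coeff V q g ^ 2 ≤ ∫ x in (0 : ℝ)..1, (g' x * g' x + V x * g x * g x) := by
  have he := fun q => isEigenpair_eigfun hV hVpos q
  have hgc := hg.continuousOn
  set c : ℕ → ℝ := fun q => coeff V q g with hc
  set G : ℝ → ℝ := fun x => ∑ q ∈ s, c q * eigfun V q x with hG
  set G' : ℝ → ℝ := fun x => ∑ q ∈ s, c q * derivWithin (eigfun V q) I x with hG'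
  have hd : HasDerivOnI G G' := HasDerivOnI.sum s fun q _ => ((he q).smul (c q)).deriv
  have hGc := hd.continuousOn
  have hGc' : ContinuousOn G' I :=
    continuousOn_finsetSum s fun q _ => continuousOn_const.mul (he q).continuousOn_deriv
  have h1 := energy_sum hV s (fun q _ => he q) c hg hg'
  have h2 := energy_sum hV s (fun q _ => he q) c hd hGc'
  have hcoef : ∀ q ∈ s, ∫ x in (0 : ℝ)..1, eigfun V q x * G x = c q := by
    intro q hq
    have h3 : ∫ y in (0 : ℝ)..1, eigfun V q y * G y = ∫ y in (0 : ℝ)..1, G y * eigfun V q y := by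
      congr 1; ext y; ring
    rw [h3, integral_sum_mul s (fun p _ => (he p).continuousOn) c (he q).continuousOn,
      Finset.sum_eq_single_of_mem q hq]
    · have := coeff_eigfun hV hVpos q q
      rw [if_pos rfl] at this
      rw [show ∫ x in (0 : ℝ)..1, eigfun V q x * eigfun V q x = 1 from this, mul_one]
    · intro p _ hne
      have := coeff_eigfun hV hVpos p q
      rw [if_neg hne] at this
      rw [show ∫ x in (0 : ℝ)..1, eigfun V p x * eigfun V q x = 0 from this, mul_zero]
  rw [Finset.sum_congr rfl fun q hq => by rw [hcoef q hq]] at h2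
  have h3 : ∀ q ∈ s, c q * (eigval V q * ∫ x in (0 : ℝ)..1, eigfun V q x * g x) =
      c q * (eigval V q * c q) := fun q _ => rfl
  rw [Finset.sum_congr rfl h3] at h1
  -- The form is nonnegative at g - G, where G is the partial eigenfunction sum. The mixed term and
  -- the form at G both reduce to ∑ μ_q c_q².
  have h4 : 0 ≤ ∫ x in (0 : ℝ)..1, ((g' x * g' x + V x * g x * g x) -
      2 * (G' x * g' x + V x * G x * g x) + (G' x * G' x + V x * G x * G x)) :=
    integral_unit_nonneg fun x hx => by
      nlinarith [sq_nonneg (g' x - G' x), mul_nonneg (hVpos x hx).le (sq_nonneg (g x - G x))]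
  rw [integral_unit_add (by fun_prop) (by fun_prop), integral_unit_sub (by fun_prop)
    (by fun_prop), intervalIntegral.integral_const_mul, h1, h2] at h4
  have h5 : ∑ q ∈ s, eigval V q * coeff V q g ^ 2 = ∑ q ∈ s, c q * (eigval V q * c q) :=
    Finset.sum_congr rfl fun q _ => by rw [hc]; ring
  rw [h5]
  linarith

/-- |e_0| has the same energy and norm as e_0, so by the spectral gap it has no component in higher
modes. Since |e_0| need not be differentiable, the argument runs with √(e_0² + ε²): its energy is at
most μ_0 + Cε² and its squared norm is 1 + ε², so its p-th coefficient is O(ε), and it differs from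
|e_0| by at most ε. -/
lemma coeff_abs_eigfun_zero {p : ℕ} (hp : p ≠ 0) : coeff V p (fun x => |eigfun V 0 x|) = 0 := by
  set e := eigfun V 0 with he
  set e' := derivWithin (eigfun V 0) I with he'
  have hpair : IsEigenpair V (eigval V 0) e e' := isEigenpair_eigfun hV hVpos 0
  have hec := hpair.continuousOn
  have hec' := hpair.continuousOn_deriv
  have hδ : 0 < eigval V p - eigval V 0 :=
    sub_pos.2 (eigval_strictMono hV hVpos (Nat.pos_of_ne_zero hp))
  have hμ0 := eigval_pos hV hVpos 0
  obtain ⟨C, hC⟩ := isCompact_Icc.exists_bound_of_continuousOn hV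
  have hC0 : 0 ≤ C := (norm_nonneg _).trans (hC 0 zero_mem_I)
  have key : ∀ ε > 0, |coeff V p (fun x => |e x|)| ≤
      ε * (√(C / (eigval V p - eigval V 0)) + 1) := by
    intro ε hε
    set f : ℝ → ℝ := fun x => √(e x ^ 2 + ε ^ 2) with hf
    set f' : ℝ → ℝ := fun x => e x * e' x / f x with hf'
    have hfpos : ∀ x, 0 < f x := fun x => Real.sqrt_pos.2 (by positivity)
    have hfsq : ∀ x, f x ^ 2 = e x ^ 2 + ε ^ 2 := fun x => Real.sq_sqrt (by positivity)
    have hd : HasDerivOnI f f' := fun x hx => by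
      refine ((((hpair.deriv x hx).fun_pow 2).add_const (ε ^ 2)).sqrt (by positivity)).congr_deriv ?_
      simp only [hf', hf]
      field_simp
      simp
      ring
    have hfc := hd.continuousOn
    have hfc' : ContinuousOn f' I := (hec.mul hec').div hfc fun x _ => (hfpos x).ne'
    have h1 : ∫ x in (0 : ℝ)..1, (f' x * f' x + V x * f x * f x) ≤ eigval V 0 + C * ε ^ 2 := by
      have h2 : ∫ x in (0 : ℝ)..1, (f' x * f' x + V x * f x * f x) ≤
          ∫ x in (0 : ℝ)..1, ((e' x * e' x + V x * e x * e x) + C * ε ^ 2) := by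
        refine integral_unit_mono (by fun_prop) (by fun_prop) fun x hx => ?_
        have h3 : f' x * f' x ≤ e' x * e' x := by
          have h4 : f' x * f x = e x * e' x := div_mul_cancel₀ _ (hfpos x).ne'
          have h5 : (f' x * f' x) * f x ^ 2 ≤ (e' x * e' x) * f x ^ 2 := by
            have : (f' x * f' x) * f x ^ 2 = (e x * e' x) ^ 2 := by rw [← h4]; ring
            rw [this, hfsq]
            nlinarith [mul_nonneg (sq_nonneg (e' x)) (sq_nonneg ε)]
          exact le_of_mul_le_mul_right h5 (pow_pos (hfpos x) 2)
        have h4 : V x * f x * f x = V x * e x * e x + V x * ε ^ 2 := by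
          rw [mul_assoc, ← sq, hfsq]; ring
        have h5 : V x ≤ C := (le_abs_self _).trans (hC x hx)
        nlinarith [mul_le_mul_of_nonneg_right h5 (sq_nonneg ε)]
      refine h2.trans_eq ?_
      rw [integral_unit_add (by fun_prop) (by fun_prop),
        hpair.weak hV hpair.deriv hec']
      have h3 := integral_eigfun_sq hV hVpos 0
      simp only [sq] at h3
      rw [← he] at h3
      rw [h3]; simp
    have h2 : ∫ x in (0 : ℝ)..1, f x ^ 2 = 1 + ε ^ 2 := by
      simp_rw [hfsq]
      rw [integral_unit_add (by fun_prop) (by fun_prop), integral_eigfun_sq hV hVpos 0]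
      simp
    have hpars := hasSum_coeff_sq hV hVpos hfc
    rw [h2] at hpars
    -- Every mode costs at least μ_0 and mode p costs μ_p; Bessel for the form on finite sums and
    -- Parseval in the limit.
    have h3 : eigval V 0 * (1 + ε ^ 2) + (eigval V p - eigval V 0) * coeff V p f ^ 2 ≤
        eigval V 0 + C * ε ^ 2 := by
      refine le_of_tendsto ((hpars.mul_left (eigval V 0)).add_const
        ((eigval V p - eigval V 0) * coeff V p f ^ 2)) ?_
      filter_upwards [eventually_ge_atTop {p}] with s hs
      have hps : p ∈ s := hs (Finset.mem_singleton_self p)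
      refine le_trans ?_ ((sum_eigval_mul_coeff_sq_le hV hVpos s hd hfc').trans h1)
      rw [← Finset.add_sum_erase s _ hps, ← Finset.add_sum_erase s
        (fun q => eigval V q * coeff V q f ^ 2) hps]
      have h4 : ∑ q ∈ s.erase p, eigval V 0 * coeff V q f ^ 2 ≤
          ∑ q ∈ s.erase p, eigval V q * coeff V q f ^ 2 :=
        Finset.sum_le_sum fun q _ => mul_le_mul_of_nonneg_right
          ((eigval_strictMono hV hVpos).monotone (Nat.zero_le q)) (sq_nonneg _)
      linarith
    have h4 : |coeff V p f| ≤ ε * √(C / (eigval V p - eigval V 0)) := by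
      rw [← Real.sqrt_sq hε.le, ← Real.sqrt_mul (by positivity)]
      apply Real.abs_le_sqrt
      rw [← mul_div_assoc, le_div_iff₀ hδ]
      nlinarith [mul_nonneg hμ0.le (sq_nonneg ε)]
    have h5 : |coeff V p (fun x => |e x| - f x)| ≤ ε := by
      refine abs_coeff_le hV hVpos p (hec.abs.sub hfc) fun x _ => ?_
      have h6 := hfsq x
      have h7 := (hfpos x).le
      have h8 : |e x| ≤ f x := Real.abs_le_sqrt (by nlinarith [sq_nonneg ε])
      have h9 : f x ≤ |e x| + ε := by
        apply Real.sqrt_le_iff.2 ⟨by positivity, ?_⟩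
        nlinarith [sq_abs (e x), mul_nonneg (abs_nonneg (e x)) hε.le]
      change |(|e x| - f x)| ≤ ε
      rw [abs_le]; constructor <;> linarith
    rw [coeff_sub hV hVpos p hec.abs hfc] at h5
    have h6 := abs_sub_abs_le_abs_sub (coeff V p (fun x => |e x|)) (coeff V p f)
    linarith
  by_contra hne
  have h1 := abs_pos.2 hne
  set K := √(C / (eigval V p - eigval V 0)) + 1 with hK
  have hKpos : 0 < K := by positivity
  have h2 := key (|coeff V p (fun x => |e x|)| / (2 * K)) (by positivity)
  have h3 : |coeff V p (fun x => |e x|)| / (2 * K) * K = |coeff V p (fun x => |e x|)| / 2 := by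
    field_simp
  linarith

/-- The ground state is positive. -/
theorem eigfun_zero_pos : ∀ x ∈ I, 0 < eigfun V 0 x := by
  have hpair := isEigenpair_eigfun hV hVpos 0
  have hec := hpair.continuousOn
  have h0 := (eigfun_spec hV hVpos 0).2.2
  -- All higher coefficients of |e_0| vanish, so |e_0| is a multiple of e_0; evaluation at 0 then
  -- makes the factor 1.
  have h1 : ∀ x ∈ I, |eigfun V 0 x| - coeff V 0 (fun x => |eigfun V 0 x|) * eigfun V 0 x = 0 := by
    refine eqOn_zero_of_coeff_eq_zero hV hVpos (hec.abs.sub (continuousOn_const.mul hec))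
      fun n => ?_
    rw [coeff_sub hV hVpos n (g := fun x => coeff V 0 (fun x => |eigfun V 0 x|) * eigfun V 0 x)
      hec.abs (continuousOn_const.mul hec), coeff_const_mul,
      coeff_eigfun hV hVpos]
    by_cases hn : n = 0
    · simp [hn]
    · simp [hn, coeff_abs_eigfun_zero hV hVpos hn]
  set c := coeff V 0 (fun x => |eigfun V 0 x|) with hc
  have hc1 : c = 1 := by
    have := h1 0 zero_mem_I
    rw [abs_of_pos h0] at this
    have h2 : (1 - c) * eigfun V 0 0 = 0 := by linarith
    have := (mul_eq_zero.1 h2).resolve_right h0.ne'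
    linarith
  have hnn : ∀ x ∈ I, 0 ≤ eigfun V 0 x := fun x hx => by
    have := h1 x hx
    rw [hc1] at this
    have := abs_nonneg (eigfun V 0 x)
    linarith
  intro y hy
  refine lt_of_le_of_ne (hnn y hy) fun hey => ?_
  -- A zero of e_0 ≥ 0 is a minimum, so the derivative vanishes there too (at the end points by the
  -- Neumann condition), contradicting Cauchy uniqueness.
  have hd : derivWithin (eigfun V 0) I y = 0 := by
    by_cases h : y = 0
    · rw [h]; exact hpair.left
    by_cases h' : y = 1
    · rw [h']; exact hpair.right
    have hyo : y ∈ Ioo (0 : ℝ) 1 := ⟨lt_of_le_of_ne hy.1 (Ne.symm h), lt_of_le_of_ne hy.2 h'⟩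
    refine IsLocalMin.hasDerivAt_eq_zero (f := eigfun V 0) ?_ (hpair.deriv.hasDerivAt hyo)
    filter_upwards [Ioo_mem_nhds hyo.1 hyo.2] with x hx
    rw [← hey]; exact hnn x (Ioo_subset_Icc_self hx)
  exact h0.ne' (hpair.eqOn_zero hV hy hey.symm hd 0 zero_mem_I)

lemma m0_spec : 0 < m0 V ∧ ∀ x ∈ I, m0 V ≤ eigfun V 0 x := by
  have hec := continuousOn_eigfun hV hVpos 0
  have hcomp : IsCompact (eigfun V 0 '' I) := isCompact_Icc.image_of_continuousOn hec
  refine ⟨?_, fun x hx => csInf_le hcomp.bddBelow (mem_image_of_mem _ hx)⟩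
  obtain ⟨x, hx, h⟩ := hcomp.sInf_mem (Set.Nonempty.image _ ⟨0, zero_mem_I⟩)
  rw [m0, ← h]
  exact eigfun_zero_pos hV hVpos x hx

end GroundState

/-! ### The function `h₅` -/

section H5

variable {V : ℝ → ℝ} (hV : ContinuousOn V I) (hVpos : ∀ x ∈ I, 0 < V x)
include hV hVpos

/-- The bound y^{k+1}/(k+1)! ≤ e^y at y = μ_n t reduces every term to a constant times 1/μ_n, so
convergence of ∑ 1/μ_n suffices. -/
lemma summable_eigval_pow_mul_exp (k : ℕ) {t : ℝ} (ht : 0 < t) :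
    Summable fun n => eigval V n ^ k * Real.exp (-(eigval V n - eigval V 0) * t) := by
  refine Summable.of_nonneg_of_le (fun n => mul_nonneg
    (pow_nonneg (eigval_pos hV hVpos n).le k) (Real.exp_pos _).le) (fun n => ?_)
    ((summable_inv_eigval hV hVpos).mul_left
      (Real.exp (eigval V 0 * t) * ((k + 1).factorial / t ^ (k + 1))))
  have hμ := eigval_pos hV hVpos n
  have h1 := Real.pow_div_factorial_le_exp (eigval V n * t) (by positivity) (k + 1)
  have h2 : Real.exp (-(eigval V n - eigval V 0) * t) =
      Real.exp (eigval V 0 * t) / Real.exp (eigval V n * t) := by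
    rw [← Real.exp_sub]; congr 1; ring
  rw [h2, mul_div_assoc', div_le_iff₀ (Real.exp_pos _)]
  have h3 : (eigval V n * t) ^ (k + 1) ≤ (k + 1).factorial * Real.exp (eigval V n * t) := by
    rwa [div_le_iff₀' (by positivity)] at h1
  have h4 : eigval V n ^ k = (eigval V n * t) ^ (k + 1) * ((t ^ (k + 1))⁻¹ * (eigval V n)⁻¹) := by
    rw [mul_pow]; field_simp; ring
  calc eigval V n ^ k * Real.exp (eigval V 0 * t)
      ≤ (((k + 1).factorial * Real.exp (eigval V n * t)) * ((t ^ (k + 1))⁻¹ * (eigval V n)⁻¹)) *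
        Real.exp (eigval V 0 * t) := by
        rw [h4]; gcongr
    _ = _ := by ring

omit hV hVpos in
/-- The terms of the series defining `h₅`. -/
noncomputable def h5Term (V : ℝ → ℝ) (t : ℝ) (q : ℕ) : ℝ :=
  Real.exp (-2 * (eigval V (q + 1) - eigval V 0) * t) * (1 + √(eigval V (q + 1))) ^ 2

omit hV hVpos in
lemma h5Term_pos (t : ℝ) (q : ℕ) : 0 < h5Term V t q :=
  mul_pos (Real.exp_pos _) (by positivity)

lemma gap_pos (q : ℕ) : 0 < eigval V (q + 1) - eigval V 0 :=
  sub_pos.2 (eigval_strictMono hV hVpos (Nat.succ_pos q))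

lemma h5Term_strictAnti (q : ℕ) : StrictAnti fun t => h5Term V t q := by
  intro s t hst
  have := gap_pos hV hVpos q
  refine mul_lt_mul_of_pos_right (Real.exp_lt_exp.2 ?_) (by positivity)
  nlinarith

lemma summable_h5Term {t : ℝ} (ht : 0 < t) : Summable (h5Term V t) := by
  have h0 := (summable_nat_add_iff 1).2 (summable_eigval_pow_mul_exp hV hVpos 0
    (t := 2 * t) (by positivity))
  have h1 := (summable_nat_add_iff 1).2 (summable_eigval_pow_mul_exp hV hVpos 1
    (t := 2 * t) (by positivity))
  refine Summable.of_nonneg_of_le (fun q => (h5Term_pos t q).le) (fun q => ?_)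
    ((h0.mul_left 2).add (h1.mul_left 2))
  have hμ := eigval_pos hV hVpos (q + 1)
  have h2 := Real.sq_sqrt hμ.le
  have h3 : -(eigval V (q + 1) - eigval V 0) * (2 * t) =
      -2 * (eigval V (q + 1) - eigval V 0) * t := by ring
  simp only [pow_zero, pow_one, one_mul, h3, h5Term]
  nlinarith [Real.exp_pos (-2 * (eigval V (q + 1) - eigval V 0) * t),
    sq_nonneg (1 - √(eigval V (q + 1)))]

omit hV hVpos in
/-- The square of `h₅` as a real number. -/
noncomputable def h5Sq (V : ℝ → ℝ) (t : ℝ) : ℝ := ∑' q, h5Term V t q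

lemma h5Sq_pos {t : ℝ} (ht : 0 < t) : 0 < h5Sq V t :=
  (summable_h5Term hV hVpos ht).tsum_pos (fun q => (h5Term_pos t q).le) 0 (h5Term_pos t 0)

lemma h5_eq {t : ℝ} (ht : 0 < t) : h5 V t = ENNReal.ofReal (√(h5Sq V t)) := by
  rw [h5, Real.sqrt_eq_rpow, ← ENNReal.ofReal_rpow_of_pos (h5Sq_pos hV hVpos ht), h5Sq,
    ENNReal.ofReal_tsum_of_nonneg (fun q => (h5Term_pos t q).le) (summable_h5Term hV hVpos ht)]
  rfl

omit hV hVpos in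
lemma h5_zero : h5 V 0 = ∞ := by
  rw [h5]
  have : ∑' q : ℕ, ENNReal.ofReal (Real.exp (-2 * (eigval V (q + 1) - eigval V 0) * 0) *
      (1 + Real.sqrt (eigval V (q + 1))) ^ 2) = ∞ := by
    refine top_unique ?_
    rw [← ENNReal.tsum_const_eq_top_of_ne_zero (α := ℕ) (c := 1) one_ne_zero]
    refine ENNReal.tsum_le_tsum fun q => ?_
    rw [← ENNReal.ofReal_one]
    refine ENNReal.ofReal_le_ofReal ?_
    have := Real.sqrt_nonneg (eigval V (q + 1))
    simp only [mul_zero, Real.exp_zero, one_mul]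
    nlinarith
  rw [this, ENNReal.top_rpow_of_pos (by norm_num)]

lemma h5Sq_lt {s t : ℝ} (hs : 0 < s) (hst : s < t) : h5Sq V t < h5Sq V s :=
  (summable_h5Term hV hVpos (hs.trans hst)).tsum_lt_tsum (i := 0)
    (fun q => (h5Term_strictAnti hV hVpos q hst).le) (h5Term_strictAnti hV hVpos 0 hst)
    (summable_h5Term hV hVpos hs)

lemma continuousOn_h5Sq {a : ℝ} (ha : 0 < a) : ContinuousOn (h5Sq V) (Ici a) := by
  refine continuousOn_tsum (fun q => ?_) (summable_h5Term hV hVpos ha) fun q t ht => ?_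
  · unfold h5Term
    fun_prop
  · rw [Real.norm_of_nonneg (h5Term_pos t q).le]
    exact (h5Term_strictAnti hV hVpos q).antitone ht

/-- At t = 0 each term is at least 1, so N terms exceed R there, and by continuity also at small t >
0. -/
lemma exists_lt_h5Sq (R : ℝ) : ∃ t > 0, R < h5Sq V t := by
  obtain ⟨N, hN⟩ := exists_nat_gt R
  have h1 : Tendsto (fun t => ∑ q ∈ Finset.range N, h5Term V t q) (𝓝[>] 0)
      (𝓝 (∑ q ∈ Finset.range N, h5Term V 0 q)) := by
    refine Tendsto.mono_left (Continuous.tendsto ?_ 0) nhdsWithin_le_nhds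
    unfold h5Term
    fun_prop
  have h2 : R < ∑ q ∈ Finset.range N, h5Term V 0 q := by
    refine hN.trans_le ?_
    have : ∑ _q ∈ Finset.range N, (1 : ℝ) ≤ ∑ q ∈ Finset.range N, h5Term V 0 q :=
      Finset.sum_le_sum fun q _ => by
        have := Real.sqrt_nonneg (eigval V (q + 1))
        simp only [h5Term, mul_zero, Real.exp_zero, one_mul]
        nlinarith
    simpa using this
  obtain ⟨t, ht, ht0⟩ := ((h1.eventually (lt_mem_nhds h2)).and self_mem_nhdsWithin).exists
  exact ⟨t, ht0, ht.trans_le ((summable_h5Term hV hVpos ht0).sum_le_tsum _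
    fun q _ => (h5Term_pos t q).le)⟩

/-- For t ≥ 1 the factor e^{-2(μ_1-μ_0)(t-1)} comes out of every term. -/
lemma exists_h5Sq_lt {R : ℝ} (hR : 0 < R) : ∃ t > 0, h5Sq V t < R := by
  have hg := gap_pos hV hVpos 0
  have h1 : ∀ t, 1 ≤ t → h5Sq V t ≤
      Real.exp (-2 * (eigval V 1 - eigval V 0) * (t - 1)) * h5Sq V 1 := by
    intro t ht
    rw [h5Sq, h5Sq, ← tsum_mul_left]
    refine (summable_h5Term hV hVpos (by linarith)).tsum_le_tsum (fun q => ?_)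
      ((summable_h5Term hV hVpos one_pos).mul_left _)
    rw [h5Term, h5Term, ← mul_assoc, ← Real.exp_add]
    refine mul_le_mul_of_nonneg_right (Real.exp_le_exp.2 ?_) (by positivity)
    have : eigval V 1 ≤ eigval V (q + 1) :=
      (eigval_strictMono hV hVpos).monotone (Nat.succ_le_succ (Nat.zero_le q))
    nlinarith
  have h2 : Tendsto (fun t => Real.exp (-2 * (eigval V 1 - eigval V 0) * (t - 1)) * h5Sq V 1)
      atTop (𝓝 (0 * h5Sq V 1)) := by
    refine Tendsto.mul_const _ (Real.tendsto_exp_atBot.comp ?_)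
    exact (tendsto_atTop_add_const_right _ (-1) tendsto_id).const_mul_atTop_of_neg
      (by simpa using hg)
  rw [zero_mul] at h2
  obtain ⟨t, h3, h4⟩ := ((h2.eventually (gt_mem_nhds hR)).and (eventually_ge_atTop 1)).exists
  exact ⟨t, by linarith, (h1 t h4).trans_lt h3⟩

lemma exists_h5Sq_eq {R : ℝ} (hR : 0 < R) : ∃ t > 0, h5Sq V t = R := by
  obtain ⟨a, ha, haR⟩ := exists_lt_h5Sq hV hVpos R
  obtain ⟨b, hb, hbR⟩ := exists_h5Sq_lt hV hVpos hR
  have hab : a ≤ b := by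
    by_contra! h
    have := h5Sq_lt hV hVpos hb h
    linarith
  obtain ⟨t, ht, h⟩ := intermediate_value_Icc' hab
    ((continuousOn_h5Sq hV hVpos ha).mono Icc_subset_Ici_self) ⟨hbR.le, haR.le⟩
  exact ⟨t, ha.trans_le ht.1, h⟩

lemma h5_lt {s t : ℝ} (hs : 0 ≤ s) (hst : s < t) : h5 V t < h5 V s := by
  rcases hs.eq_or_lt with rfl | hs
  · rw [h5_zero, h5_eq hV hVpos hst]
    exact ENNReal.ofReal_lt_top
  · rw [h5_eq hV hVpos hs, h5_eq hV hVpos (hs.trans hst)]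
    exact (ENNReal.ofReal_lt_ofReal_iff (Real.sqrt_pos.2 (h5Sq_pos hV hVpos hs))).2
      (Real.sqrt_lt_sqrt (h5Sq_pos hV hVpos (hs.trans hst)).le (h5Sq_lt hV hVpos hs hst))

/-- `h₅` is a bijection of `[0,∞)` onto `(0,∞]`. -/
lemma existsUnique_h5_eq {R : ℝ≥0∞} (hR : R ≠ 0) : ∃! τ : ℝ, 0 ≤ τ ∧ h5 V τ = R := by
  have hex : ∃ τ : ℝ, 0 ≤ τ ∧ h5 V τ = R := by
    by_cases hT : R = ∞
    · exact ⟨0, le_rfl, by rw [hT, h5_zero]⟩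
    · have hpos := ENNReal.toReal_pos hR hT
      obtain ⟨t, ht, h⟩ := exists_h5Sq_eq hV hVpos (pow_pos hpos 2)
      exact ⟨t, ht.le, by rw [h5_eq hV hVpos ht, h, Real.sqrt_sq hpos.le, ENNReal.ofReal_toReal hT]⟩
  obtain ⟨τ, h0, h⟩ := hex
  refine ⟨τ, ⟨h0, h⟩, fun σ ⟨hσ0, hσ⟩ => ?_⟩
  rcases lt_trichotomy σ τ with hlt | heq | hlt
  · have := h5_lt hV hVpos hσ0 hlt
    rw [h, hσ] at this
    exact absurd this (lt_irrefl _)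
  · exact heq
  · have := h5_lt hV hVpos h0 hlt
    rw [h, hσ] at this
    exact absurd this (lt_irrefl _)

end H5

/-! ### The Cole-Hopf transform -/

instance : IsProbabilityMeasure vol := ⟨by simp [vol]⟩

/-- The unnormalised Cole-Hopf transform. -/
noncomputable def expPrim (u : ℝ → ℝ) (x : ℝ) : ℝ :=
  Real.exp (-(1 / 2) * ∫ s in (0 : ℝ)..x, u s)

lemma expPrim_pos (u : ℝ → ℝ) (x : ℝ) : 0 < expPrim u x := Real.exp_pos _

lemma coleHopf_eq (u : ℝ → ℝ) (x : ℝ) :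
    coleHopf u x = (∫ y in (0 : ℝ)..1, expPrim u y)⁻¹ * expPrim u x := by
  rw [coleHopf, div_eq_mul_inv, mul_comm]
  rfl

lemma continuousOn_expPrim {u : ℝ → ℝ} (hu : Integrable u vol) : ContinuousOn (expPrim u) I := by
  have h : ContinuousOn (fun x => ∫ s in (0 : ℝ)..x, u s) (uIcc 0 1) := by
    refine intervalIntegral.continuousOn_primitive_interval ?_
    rw [uIcc_of_le zero_le_one]
    exact hu
  rw [uIcc_of_le zero_le_one] at h
  unfold expPrim
  fun_prop

lemma integral_expPrim_pos {u : ℝ → ℝ} (hu : Integrable u vol) :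
    0 < ∫ y in (0 : ℝ)..1, expPrim u y :=
  intervalIntegral.intervalIntegral_pos_of_pos_on
    (intervalIntegrable_unit (continuousOn_expPrim hu)) (fun x _ => expPrim_pos u x) zero_lt_one

lemma continuousOn_coleHopf {u : ℝ → ℝ} (hu : Integrable u vol) : ContinuousOn (coleHopf u) I :=
  (continuousOn_const.mul (continuousOn_expPrim hu)).congr fun x _ => coleHopf_eq u x

lemma coleHopf_pos {u : ℝ → ℝ} (hu : Integrable u vol) (x : ℝ) : 0 < coleHopf u x := by
  rw [coleHopf_eq]
  exact mul_pos (inv_pos.2 (integral_expPrim_pos hu)) (expPrim_pos u x)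

lemma integral_coleHopf {u : ℝ → ℝ} (hu : Integrable u vol) :
    ∫ x in (0 : ℝ)..1, coleHopf u x = 1 := by
  simp_rw [coleHopf_eq]
  rw [intervalIntegral.integral_const_mul, inv_mul_cancel₀ (integral_expPrim_pos hu).ne']

lemma coeff_coleHopf (V : ℝ → ℝ) (n : ℕ) (u : ℝ → ℝ) :
    coeff V n (coleHopf u) = (∫ y in (0 : ℝ)..1, expPrim u y)⁻¹ * coeff V n (expPrim u) := by
  rw [← coeff_const_mul]
  exact coeff_congr n fun x _ => coleHopf_eq u x

/-- The normalising integral cancels in ratios, so the dynamics can be followed in the unnormalised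
variable. -/
lemma coeff_coleHopf_div (V : ℝ → ℝ) (n : ℕ) {u : ℝ → ℝ} (hu : Integrable u vol) :
    coeff V n (coleHopf u) / coeff V 0 (coleHopf u) =
      coeff V n (expPrim u) / coeff V 0 (expPrim u) := by
  rw [coeff_coleHopf, coeff_coleHopf, mul_div_mul_left _ _
    (inv_ne_zero (integral_expPrim_pos hu).ne')]

lemma integrable_of_L2 (u : L2) : Integrable u vol := (Lp.memLp u).integrable one_le_two

lemma abs_integral_sub_le {u v : ℝ → ℝ} (hu : MemLp u 2 vol) (hv : MemLp v 2 vol) {x : ℝ}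
    (hx : x ∈ I) : |(∫ s in (0 : ℝ)..x, u s) - ∫ s in (0 : ℝ)..x, v s| ≤
      (eLpNorm (fun s => u s - v s) 2 vol).toReal := by
  have hui := hu.integrable one_le_two
  have hvi := hv.integrable one_le_two
  have hsub : Ioc (0 : ℝ) x ⊆ I := fun s hs => ⟨hs.1.le, hs.2.trans hx.2⟩
  have hint : ∀ {w : ℝ → ℝ}, Integrable w vol → IntervalIntegrable w volume 0 x := fun hw =>
    (intervalIntegrable_iff_integrableOn_Ioc_of_le hx.1).2 (IntegrableOn.mono_set hw hsub)
  rw [← intervalIntegral.integral_sub (hint hui) (hint hvi)]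
  refine (intervalIntegral.abs_integral_le_integral_abs hx.1).trans ?_
  rw [intervalIntegral.integral_of_le hx.1]
  have h1 : ∫ s in Ioc 0 x, |u s - v s| ≤ ∫ s in I, |u s - v s| :=
    setIntegral_mono_set (hui.sub hvi).abs (Eventually.of_forall fun _ => abs_nonneg _)
      (LE.le.eventuallyLE hsub)
  refine h1.trans ?_
  have h2 : ∫ s in I, |u s - v s| = (eLpNorm (fun s => u s - v s) 1 vol).toReal := by
    rw [eLpNorm_one_eq_lintegral_enorm]
    exact integral_norm_eq_lintegral_enorm (hui.sub hvi).aestronglyMeasurable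
  rw [h2]
  exact ENNReal.toReal_mono (hu.sub hv).eLpNorm_ne_top
    (eLpNorm_le_eLpNorm_of_exponent_le one_le_two (hui.sub hvi).aestronglyMeasurable)

/-- On a space of mass one the L² distance δ dominates the difference of primitives, so the
exponentials compare up to e^{δ/2}. In `coleHopf_le` numerator and denominator each cost this
factor. -/
lemma expPrim_le {u v : ℝ → ℝ} (hu : MemLp u 2 vol) (hv : MemLp v 2 vol) {x : ℝ} (hx : x ∈ I) :
    expPrim u x ≤
      Real.exp ((eLpNorm (fun s => u s - v s) 2 vol).toReal / 2) * expPrim v x := by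
  rw [expPrim, expPrim, ← Real.exp_add]
  refine Real.exp_le_exp.2 ?_
  have := (abs_le.1 (abs_integral_sub_le hu hv hx)).1
  linarith

lemma eLpNorm_sub_comm' (u v : ℝ → ℝ) :
    eLpNorm (fun s => u s - v s) 2 vol = eLpNorm (fun s => v s - u s) 2 vol := by
  rw [← eLpNorm_neg]
  congr 1; ext s; simp

lemma coleHopf_le {u v : ℝ → ℝ} (hu : MemLp u 2 vol) (hv : MemLp v 2 vol) {x : ℝ} (hx : x ∈ I) :
    coleHopf u x ≤ Real.exp (eLpNorm (fun s => u s - v s) 2 vol).toReal * coleHopf v x := by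
  set δ := (eLpNorm (fun s => u s - v s) 2 vol).toReal with hδ
  have hui := hu.integrable one_le_two
  have hvi := hv.integrable one_le_two
  have h1 := expPrim_le hu hv hx
  have h2 : ∫ y in (0 : ℝ)..1, expPrim v y ≤
      Real.exp (δ / 2) * ∫ y in (0 : ℝ)..1, expPrim u y := by
    rw [← intervalIntegral.integral_const_mul]
    refine integral_unit_mono (continuousOn_expPrim hvi)
      (continuousOn_const.mul (continuousOn_expPrim hui)) fun y hy => ?_
    have := expPrim_le hv hu hy
    rwa [eLpNorm_sub_comm', ← hδ] at this
  have hNu := integral_expPrim_pos hui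
  have hNv := integral_expPrim_pos hvi
  rw [coleHopf_eq, coleHopf_eq, inv_mul_le_iff₀ hNu]
  have h3 : (1 : ℝ) ≤ (∫ y in (0 : ℝ)..1, expPrim v y)⁻¹ *
      (Real.exp (δ / 2) * ∫ y in (0 : ℝ)..1, expPrim u y) := by
    rw [inv_mul_eq_div, one_le_div hNv]
    exact h2
  have h4 : 0 < Real.exp (δ / 2) * expPrim v x := mul_pos (Real.exp_pos _) (expPrim_pos v x)
  have h5 : Real.exp δ = Real.exp (δ / 2) * Real.exp (δ / 2) := by
    rw [← Real.exp_add]; ring_nf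
  rw [h5]
  calc expPrim u x ≤ Real.exp (δ / 2) * expPrim v x * 1 := by rw [mul_one]; exact h1
    _ ≤ Real.exp (δ / 2) * expPrim v x * ((∫ y in (0 : ℝ)..1, expPrim v y)⁻¹ *
      (Real.exp (δ / 2) * ∫ y in (0 : ℝ)..1, expPrim u y)) :=
        mul_le_mul_of_nonneg_left h3 h4.le
    _ = _ := by ring

/-- The Cole-Hopf transform is continuous from `L²` to the continuous functions. -/
lemma abs_coleHopf_sub_le {u v : ℝ → ℝ} (hu : MemLp u 2 vol) (hv : MemLp v 2 vol) {x : ℝ}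
    (hx : x ∈ I) : |coleHopf u x - coleHopf v x| ≤
      (Real.exp (eLpNorm (fun s => u s - v s) 2 vol).toReal - 1) * coleHopf v x := by
  have h1 := coleHopf_le hu hv hx
  have h2 := coleHopf_le hv hu hx
  rw [eLpNorm_sub_comm'] at h2
  set δ := (eLpNorm (fun s => u s - v s) 2 vol).toReal
  have hpu := coleHopf_pos (hu.integrable one_le_two) x
  have hpv := coleHopf_pos (hv.integrable one_le_two) x
  have h3 : 1 ≤ Real.exp δ := Real.one_le_exp ENNReal.toReal_nonneg
  rw [abs_le]
  constructor
  · rcases le_total (coleHopf u x) (coleHopf v x) with h | h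
    · nlinarith
    · nlinarith
  · linarith

lemma eLpNorm_eq_sqrt_integral {f : ℝ → ℝ} (hf : ContinuousOn f I) :
    eLpNorm f 2 vol = ENNReal.ofReal (√(∫ x in (0 : ℝ)..1, f x ^ 2)) := by
  have hm : AEStronglyMeasurable f vol := hf.aestronglyMeasurable measurableSet_Icc
  have hL : MemLp f 2 vol := (memLp_two_iff_integrable_sq hm).2 (hf.pow 2).integrableOn_Icc
  rw [hL.eLpNorm_eq_integral_rpow_norm (by simp) (by simp),
    intervalIntegral.integral_of_le zero_le_one, ← integral_Icc_eq_integral_Ioc,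
    Real.sqrt_eq_rpow]
  simp

section Coeff

variable {V : ℝ → ℝ} (hV : ContinuousOn V I) (hVpos : ∀ x ∈ I, 0 < V x)
include hV hVpos

lemma coeff_zero_pos {f : ℝ → ℝ} (hf : ContinuousOn f I) (hpos : ∀ x ∈ I, 0 < f x) :
    0 < coeff V 0 f :=
  intervalIntegral.intervalIntegral_pos_of_pos_on
    (intervalIntegrable_unit ((continuousOn_eigfun hV hVpos 0).mul hf))
    (fun x hx => mul_pos (eigfun_zero_pos hV hVpos x (Ioo_subset_Icc_self hx))
      (hpos x (Ioo_subset_Icc_self hx))) zero_lt_one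

/-- H is positive with integral 1 and e_0 ≥ m_0. This provides one of the two factors m_0 in the
threshold. -/
lemma m0_le_coeff_coleHopf {u : ℝ → ℝ} (hu : Integrable u vol) :
    m0 V ≤ coeff V 0 (coleHopf u) := by
  have hc := continuousOn_coleHopf hu
  have h := integral_unit_mono (f := fun x => m0 V * coleHopf u x)
    (continuousOn_const.mul hc) ((continuousOn_eigfun hV hVpos 0).mul hc)
    fun x hx => mul_le_mul_of_nonneg_right ((m0_spec hV hVpos).2 x hx) (coleHopf_pos hu x).le
  rw [intervalIntegral.integral_const_mul, integral_coleHopf hu, mul_one] at h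
  exact h

/-- The distance to a multiple of the ground state dominates the remaining coefficients. -/
lemma hasSum_coeff_sq_sub {f : ℝ → ℝ} (hf : ContinuousOn f I) (a : ℝ) :
    HasSum (fun q => coeff V (q + 1) f ^ 2)
      ((∫ x in (0 : ℝ)..1, (f x - a * eigfun V 0 x) ^ 2) - (coeff V 0 f - a) ^ 2) := by
  have he := continuousOn_eigfun hV hVpos 0
  have hg : ContinuousOn (fun x => a * eigfun V 0 x) I := continuousOn_const.mul he
  have h := hasSum_coeff_sq hV hVpos (hf.sub hg)
  rw [← hasSum_nat_add_iff' 1] at h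
  have hcoef : ∀ n, coeff V n (f - fun x => a * eigfun V 0 x) =
      coeff V n f - a * if n = 0 then 1 else 0 := fun n => by
    rw [← coeff_eigfun hV hVpos, ← coeff_const_mul, ← coeff_sub hV hVpos n hf hg]
    rfl
  simp only [hcoef, Finset.sum_range_one] at h
  simpa using h

/-- Needed at t → 0⁺, where an orbit attains its data only in L². -/
lemma tendsto_coeff_coleHopf (n : ℕ) {ι : Type*} {l : Filter ι} {u : ι → ℝ → ℝ} {v : ℝ → ℝ}
    (hu : ∀ᶠ i in l, MemLp (u i) 2 vol) (hv : MemLp v 2 vol)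
    (h : Tendsto (fun i => eLpNorm (fun s => u i s - v s) 2 vol) l (𝓝 0)) :
    Tendsto (fun i => coeff V n (coleHopf (u i))) l (𝓝 (coeff V n (coleHopf v))) := by
  have hvi := hv.integrable one_le_two
  have hc := continuousOn_coleHopf hvi
  obtain ⟨C, hC⟩ := isCompact_Icc.exists_bound_of_continuousOn hc
  rw [tendsto_iff_dist_tendsto_zero]
  have h1 : Tendsto (fun i => (Real.exp (eLpNorm (fun s => u i s - v s) 2 vol).toReal - 1) * C)
      l (𝓝 0) := by
    have h2 := (ENNReal.tendsto_toReal ENNReal.zero_ne_top).comp h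
    have h3 := (((Real.continuous_exp.tendsto _).comp h2).sub_const 1).mul_const C
    simpa using h3
  refine squeeze_zero' (Eventually.of_forall fun _ => dist_nonneg) ?_ h1
  filter_upwards [hu] with i hi
  have hci := continuousOn_coleHopf (hi.integrable one_le_two)
  rw [Real.dist_eq, ← coeff_sub hV hVpos n hci hc]
  refine abs_coeff_le hV hVpos n (hci.sub hc) fun x hx => ?_
  refine (abs_coleHopf_sub_le hi hv hx).trans ?_
  refine mul_le_mul_of_nonneg_left ((le_abs_self _).trans (hC x hx)) ?_
  exact sub_nonneg.2 (Real.one_le_exp ENNReal.toReal_nonneg)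

end Coeff

/-! ### The orbits of the Burgers equation -/

lemma hasDerivOnI_primitive {f : ℝ → ℝ} (hf : ContinuousOn f I) :
    HasDerivOnI (fun x => ∫ s in (0 : ℝ)..x, f s) f := by
  set g : ℝ → ℝ := fun x => f (projIcc 0 1 zero_le_one x) with hg
  have hgc : Continuous g :=
    hf.comp_continuous (by fun_prop) fun x => (projIcc (0 : ℝ) 1 zero_le_one x).2
  have hgf : ∀ x ∈ I, g x = f x := fun x hx => by simp only [hg, projIcc_of_mem zero_le_one hx]
  intro x hx
  have h1 : HasDerivWithinAt (fun x => ∫ s in (0 : ℝ)..x, g s) (g x) I x :=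
    (intervalIntegral.integral_hasDerivAt_right (hgc.intervalIntegrable _ _)
      (hgc.stronglyMeasurableAtFilter _ _) hgc.continuousAt).hasDerivWithinAt
  rw [hgf x hx] at h1
  refine h1.congr_of_mem (fun y hy => ?_) hx
  exact intervalIntegral.integral_congr fun s hs =>
    (hgf s (uIcc_subset_I zero_mem_I hy hs)).symm

lemma hasDerivAt_integral_of_continuousOn {F F' : ℝ → ℝ → ℝ}
    (hF : ∀ t > 0, ContinuousOn (F t) I)
    (hF' : ContinuousOn (Function.uncurry F') (Ioi 0 ×ˢ I))
    (hd : ∀ t > 0, ∀ x ∈ I, HasDerivAt (fun s => F s x) (F' t x) t) {t : ℝ} (ht : 0 < t)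
    {b : ℝ} (hb : b ∈ I) :
    HasDerivAt (fun s => ∫ x in (0 : ℝ)..b, F s x) (∫ x in (0 : ℝ)..b, F' t x) t := by
  have hK : IsCompact (Icc (t / 2) (2 * t) ×ˢ I) := isCompact_Icc.prod isCompact_Icc
  obtain ⟨C, hC⟩ := hK.exists_bound_of_continuousOn (hF'.mono (prod_mono_left fun s hs =>
    mem_Ioi.2 ((half_pos ht).trans_le hs.1)))
  have hsub : uIoc 0 b ⊆ I := uIoc_subset_uIcc.trans (uIcc_subset_I zero_mem_I hb)
  have hF't : ContinuousOn (F' t) I :=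
    hF'.comp (f := fun x => (t, x)) (by fun_prop) fun x hx => ⟨ht, hx⟩
  have hnhds : Ioo (t / 2) (2 * t) ∈ 𝓝 t := Ioo_mem_nhds (by linarith) (by linarith)
  refine (intervalIntegral.hasDerivAt_integral_of_dominated_loc_of_deriv_le
    (bound := fun _ => C) hnhds ?_
    (intervalIntegrable_of_mem (hF t ht) zero_mem_I hb) ?_ ?_
    intervalIntegrable_const ?_).2
  · filter_upwards [lt_mem_nhds ht] with s hs
    exact ((hF s hs).mono hsub).aestronglyMeasurable measurableSet_uIoc
  · exact (hF't.mono hsub).aestronglyMeasurable measurableSet_uIoc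
  · exact Eventually.of_forall fun x hx s hs =>
      hC (s, x) ⟨Ioo_subset_Icc_self hs, hsub hx⟩
  · exact Eventually.of_forall fun x hx s hs =>
      hd s ((half_pos ht).trans hs.1) x (hsub hx)

lemma continuousOn_primitive_uncurry {u : ℝ → ℝ → ℝ}
    (hu : ContinuousOn (Function.uncurry u) (Ioi 0 ×ˢ I)) :
    ContinuousOn (fun p : ℝ × ℝ => ∫ s in (0 : ℝ)..p.2, u p.1 s) (Ioi 0 ×ˢ I) := by
  rintro ⟨t, x⟩ ⟨ht, hx⟩
  have ht : 0 < t := ht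
  -- Clamping time at t/2 from below and projecting space to [0,1] gives a globally continuous
  -- function that agrees with u near (t, x).
  set v : ℝ × ℝ → ℝ → ℝ := fun p s => u (max p.1 (t / 2)) (projIcc 0 1 zero_le_one s) with hv
  have hvc : Continuous (Function.uncurry v) :=
    hu.comp_continuous
      (f := fun q : (ℝ × ℝ) × ℝ =>
        (max q.1.1 (t / 2), (projIcc (0 : ℝ) 1 zero_le_one q.2 : ℝ)))
      (by fun_prop) fun q => ⟨lt_max_of_lt_right (half_pos ht),
        (projIcc (0 : ℝ) 1 zero_le_one q.2).2⟩
  have h1 : Continuous fun p : ℝ × ℝ => ∫ s in (0 : ℝ)..p.2, v p s :=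
    intervalIntegral.continuous_parametric_intervalIntegral_of_continuous hvc continuous_snd
  refine h1.continuousWithinAt.congr_of_eventuallyEq_of_mem ?_ ⟨ht, hx⟩
  have h2 : ∀ᶠ p : ℝ × ℝ in 𝓝[Ioi 0 ×ˢ I] (t, x), t / 2 < p.1 :=
    nhdsWithin_le_nhds ((continuous_fst.tendsto (t, x)).eventually
      (lt_mem_nhds (half_lt_self ht)))
  filter_upwards [h2, self_mem_nhdsWithin] with p hp hpI
  refine intervalIntegral.integral_congr fun s hs => ?_
  have hs' := uIcc_subset_I zero_mem_I hpI.2 hs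
  simp only [hv, max_eq_left hp.le, projIcc_of_mem zero_le_one hs']

section Burgers

variable {V : ℝ → ℝ} {u₀ : L2} {u : ℝ → ℝ → ℝ}

lemma IsBurgersSolution.continuousOn (hu : IsBurgersSolution V u₀ u) {t : ℝ} (ht : 0 < t) :
    ContinuousOn (u t) I := by
  obtain ⟨ut, ux, uxx, hc, -⟩ := hu.equation
  exact hc.comp (f := fun x => (t, x)) (by fun_prop) fun x hx => ⟨ht, hx⟩

lemma hasDerivOnI_expPrim {f : ℝ → ℝ} (hf : ContinuousOn f I) :
    HasDerivOnI (expPrim f) (fun x => -(1 / 2) * f x * expPrim f x) := fun x hx =>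
  (((hasDerivOnI_primitive hf x hx).const_mul (-(1 / 2))).exp).congr_deriv (by
    simp only [expPrim]; ring)

/-- The evolution of the coefficients of the Cole-Hopf transform. -/
lemma IsBurgersSolution.exists_hasDerivAt_coeff (hV : ContDiffOn ℝ 1 V I)
    (hVpos : ∀ x ∈ I, 0 < V x) (hu : IsBurgersSolution V u₀ u) {t : ℝ} (ht : 0 < t) :
    ∃ g : ℝ, ∀ n, HasDerivAt (fun s => coeff V n (expPrim (u s)))
      ((g - eigval V n) * coeff V n (expPrim (u t))) t := by
  have hVc := hV.continuousOn
  have hVd : HasDerivOnI V (derivWithin V I) := fun x hx =>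
    (hV.differentiableOn one_ne_zero x hx).hasDerivWithinAt
  have huc := fun s (hs : 0 < s) => hu.continuousOn hs
  obtain ⟨ut, ux, uxx, hc, hct, hcx, hcxx, heq⟩ := hu.equation
  have hb := hu.boundary
  have hslice : ∀ {f : ℝ → ℝ → ℝ}, ContinuousOn (Function.uncurry f) (Ioi 0 ×ˢ I) →
      ∀ s > 0, ContinuousOn (f s) I := fun hf s hs =>
    hf.comp (f := fun x => (s, x)) (by fun_prop) fun x hx => ⟨hs, hx⟩
  -- The space primitive of u_t: the equation reads u_t = ∂ₓ(u_x + 2V - u²/2), and u(t,0) = 0.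
  set Ut : ℝ → ℝ → ℝ := fun s x =>
    ux s x - ux s 0 + 2 * (V x - V 0) - u s x ^ 2 / 2 with hUt
  have hprim : ∀ s > 0, ∀ x ∈ I, ∫ y in (0 : ℝ)..x, ut s y = Ut s x := by
    intro s hs x hx
    have h1 : HasDerivOnI (fun y => ux s y + 2 * V y - u s y ^ 2 / 2) (ut s) := fun y hy => by
      obtain ⟨-, h2, h3, h4⟩ := heq s hs y hy
      refine ((h3.fun_add ((hVd y hy).const_mul 2)).fun_sub
        ((h2.fun_pow 2).div_const 2)).congr_deriv ?_
      simp only [Nat.cast_ofNat, Nat.add_one_sub_one, pow_one]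
      linarith
    rw [h1.integral_eq (hslice hct s hs) zero_mem_I hx, hUt, (hb s hs).1]
    ring
  have hUd : ∀ s > 0, ∀ x ∈ I,
      HasDerivAt (fun r => ∫ y in (0 : ℝ)..x, u r y) (Ut s x) s := fun s hs x hx => by
    rw [← hprim s hs x hx]
    exact hasDerivAt_integral_of_continuousOn huc hct (fun r hr y hy => (heq r hr y hy).1) hs hx
  have hwd : ∀ s > 0, ∀ x ∈ I,
      HasDerivAt (fun r => expPrim (u r) x) (-(1 / 2) * Ut s x * expPrim (u s) x) s :=
    fun s hs x hx => (((hUd s hs x hx).const_mul (-(1 / 2))).exp).congr_deriv (by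
      rw [expPrim]; ring)
  have hfst : ContinuousOn (fun p : ℝ × ℝ => ux p.1 0) (Ioi 0 ×ˢ I) :=
    hcx.comp (f := fun p : ℝ × ℝ => (p.1, (0 : ℝ))) (by fun_prop)
      fun p hp => ⟨hp.1, zero_mem_I⟩
  have hVp : ContinuousOn (fun p : ℝ × ℝ => V p.2) (Ioi 0 ×ˢ I) :=
    hVc.comp (by fun_prop) fun p hp => hp.2
  have hUtc : ContinuousOn (fun p : ℝ × ℝ => Ut p.1 p.2) (Ioi 0 ×ˢ I) :=
    ((ContinuousOn.sub hcx hfst).add (continuousOn_const.mul (hVp.sub continuousOn_const))).sub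
      ((ContinuousOn.pow hc 2).div_const 2)
  have hwc : ContinuousOn (fun p : ℝ × ℝ => expPrim (u p.1) p.2) (Ioi 0 ×ˢ I) :=
    (continuousOn_const.mul (continuousOn_primitive_uncurry hc)).rexp
  set w := expPrim (u t) with hw
  set w1 : ℝ → ℝ := fun x => -(1 / 2) * u t x * w x with hw1
  have hw_d : HasDerivOnI w w1 := hasDerivOnI_expPrim (huc t ht)
  set w2 : ℝ → ℝ := fun x => -(1 / 2) * ux t x * w x + -(1 / 2) * u t x * w1 x with hw2
  have hw1_d : HasDerivOnI w1 w2 := fun x hx =>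
    (((heq t ht x hx).2.1.const_mul (-(1 / 2))).fun_mul (hw_d x hx))
  have hwcont := hw_d.continuousOn
  have hw1c := hw1_d.continuousOn
  have hutc := huc t ht
  have huxc := hslice hcx t ht
  have hw2c : ContinuousOn w2 I := by fun_prop
  -- The constants come from basing the primitive at x = 0: w_t = w_xx - V w + (½u_x(t,0) + V(0)) w.
  -- They do not depend on n.
  refine ⟨1 / 2 * ux t 0 + V 0, fun n => ?_⟩
  have hpair := isEigenpair_eigfun hVc hVpos n
  set e := eigfun V n
  have hec := hpair.continuousOn
  have hec' := hpair.continuousOn_deriv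
  have hep : ContinuousOn (fun p : ℝ × ℝ => e p.2) (Ioi 0 ×ˢ I) :=
    hec.comp (by fun_prop) fun p hp => hp.2
  have hmain := hasDerivAt_integral_of_continuousOn (F := fun s x => e x * expPrim (u s) x)
    (F' := fun s x => e x * (-(1 / 2) * Ut s x * expPrim (u s) x))
    (fun s hs => hec.mul (hasDerivOnI_expPrim (huc s hs)).continuousOn)
    (hep.mul ((continuousOn_const.mul hUtc).mul hwc))
    (fun s hs x hx => (hwd s hs x hx).const_mul (e x)) ht one_mem_I
  refine hmain.congr_deriv ?_
  have h1 : ∫ x in (0 : ℝ)..1, e x * (-(1 / 2) * Ut t x * w x) =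
      ∫ x in (0 : ℝ)..1, (w2 x * e x - V x * e x * w x +
        (1 / 2 * ux t 0 + V 0) * (e x * w x)) :=
    integral_unit_congr fun x _ => by simp only [hUt, hw2, hw1]; ring
  have h2 := hw1_d.integral_mul hpair.deriv hw2c hec'
  have h3 := hpair.weak hVc hw_d hw1c
  rw [integral_unit_add (by fun_prop) (by fun_prop)] at h3
  have h4 : ∫ x in (0 : ℝ)..1, w1 x * derivWithin e I x =
      ∫ x in (0 : ℝ)..1, derivWithin e I x * w1 x := by
    congr 1; ext x; ring
  -- The Dirichlet condition on u turns into the Neumann condition on w, removing the boundary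
  -- terms.
  have h5 : w1 0 = 0 := by simp [hw1, (hb t ht).1]
  have h6 : w1 1 = 0 := by simp [hw1, (hb t ht).2]
  rw [h5, h6, h4] at h2
  rw [h1, integral_unit_add (by fun_prop) (by fun_prop),
    integral_unit_sub (by fun_prop) (by fun_prop), intervalIntegral.integral_const_mul, h2, coeff]
  linarith

/-- In the Cole-Hopf variable, the normalised coefficients evolve exponentially. -/
theorem IsBurgersSolution.coeff_div (hV : ContDiffOn ℝ 1 V I)
    (hVpos : ∀ x ∈ I, 0 < V x) (hu : IsBurgersSolution V u₀ u) {t : ℝ} (ht : 0 < t) (n : ℕ) :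
    coeff V n (expPrim (u t)) / coeff V 0 (expPrim (u t)) =
      Real.exp (-(eigval V n - eigval V 0) * t) *
        (coeff V n (coleHopf u₀) / coeff V 0 (coleHopf u₀)) := by
  have hVc := hV.continuousOn
  have hmem : ∀ s > 0, MemLp (u s) 2 vol := fun s hs => by
    have hc := hu.continuousOn hs
    exact (memLp_two_iff_integrable_sq (hc.aestronglyMeasurable measurableSet_Icc)).2
      (hc.pow 2).integrableOn_Icc
  have hint : ∀ s > 0, Integrable (u s) vol := fun s hs => (hmem s hs).integrable one_le_two
  have hpos : ∀ s > 0, 0 < coeff V 0 (expPrim (u s)) := fun s hs =>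
    coeff_zero_pos hVc hVpos (continuousOn_expPrim (hint s hs)) fun x _ => expPrim_pos _ x
  -- The common rate g cancels in the quotient and the exponential compensates the rest, so R is
  -- constant; its value is then read off as t → 0⁺.
  set R : ℝ → ℝ := fun s => coeff V n (expPrim (u s)) / coeff V 0 (expPrim (u s)) *
    Real.exp ((eigval V n - eigval V 0) * s) with hR
  have hd : ∀ s > 0, HasDerivAt R 0 s := by
    intro s hs
    obtain ⟨g, hg⟩ := hu.exists_hasDerivAt_coeff hV hVpos hs
    have h1 : HasDerivAt (fun s => Real.exp ((eigval V n - eigval V 0) * s))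
        ((eigval V n - eigval V 0) * Real.exp ((eigval V n - eigval V 0) * s)) s := by
      simpa [mul_comm] using ((hasDerivAt_id s).const_mul (eigval V n - eigval V 0)).exp
    refine (((hg n).fun_div (hg 0) (hpos s hs).ne').fun_mul h1).congr_deriv ?_
    have := (hpos s hs).ne'
    field_simp
    ring
  have hconst : ∀ s > 0, R s = R t := fun s hs =>
    isOpen_Ioi.is_const_of_deriv_eq_zero isPreconnected_Ioi
      (fun r hr => (hd r hr).differentiableAt.differentiableWithinAt)
      (fun r hr => (hd r hr).deriv) hs ht
  have hm0 := (m0_spec hVc hVpos).1.trans_le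
    (m0_le_coeff_coleHopf hVc hVpos (integrable_of_L2 u₀))
  have hlim : Tendsto R (𝓝[>] 0) (𝓝 (coeff V n (coleHopf u₀) / coeff V 0 (coleHopf u₀))) := by
    have hev : ∀ᶠ s in 𝓝[>] (0 : ℝ), MemLp (u s) 2 vol := by
      filter_upwards [self_mem_nhdsWithin] with s hs using hmem s hs
    have h1 := (tendsto_coeff_coleHopf hVc hVpos n hev (Lp.memLp u₀) hu.initial).div
      (tendsto_coeff_coleHopf hVc hVpos 0 hev (Lp.memLp u₀) hu.initial) hm0.ne'
    have h2 : Tendsto (fun s => Real.exp ((eigval V n - eigval V 0) * s)) (𝓝[>] 0) (𝓝 1) := by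
      have : Continuous fun s => Real.exp ((eigval V n - eigval V 0) * s) := by fun_prop
      simpa using (this.tendsto 0).mono_left nhdsWithin_le_nhds
    have h3 := h1.mul h2
    rw [mul_one] at h3
    refine h3.congr' ?_
    filter_upwards [self_mem_nhdsWithin] with s hs
    simp only [Pi.div_apply, hR, coeff_coleHopf_div V n (hint s hs)]
  have hRt : R t = coeff V n (coleHopf u₀) / coeff V 0 (coleHopf u₀) := by
    refine tendsto_nhds_unique (tendsto_const_nhds.congr' ?_) hlim
    filter_upwards [self_mem_nhdsWithin] with s hs using (hconst s hs).symm
  rw [← hRt, hR]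
  have : Real.exp (-(eigval V n - eigval V 0) * t) *
      Real.exp ((eigval V n - eigval V 0) * t) = 1 := by
    rw [← Real.exp_add, ← add_mul]; simp
  linear_combination (-(coeff V n (expPrim (u t)) / coeff V 0 (expPrim (u t)))) * this

end Burgers

/-! ### Geometric series over the index set -/

lemma hasSum_prod_fin {β : Type*} {z : β → ℝ} {ζ : ℝ} (hz : Summable fun b => ‖z b‖)
    (hζ : HasSum z ζ) (m : ℕ) :
    (Summable fun v : Fin m → β => ‖∏ i, z (v i)‖) ∧
      HasSum (fun v : Fin m → β => ∏ i, z (v i)) (ζ ^ m) := by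
  induction m with
  | zero =>
    refine ⟨(hasSum_fintype _).summable, ?_⟩
    simp
  | succ m ih =>
    have h1 := summable_mul_of_summable_norm hz ih.1
    have h2 := hζ.mul ih.2 h1
    have h3 := h1.norm
    have he : ∀ p : β × (Fin m → β), ∏ i, z (Fin.consEquiv (fun _ => β) p i) =
        z p.1 * ∏ i, z (p.2 i) := fun p => by
      rw [Fin.prod_univ_succ]; simp [Fin.consEquiv]
    constructor
    · rw [← (Fin.consEquiv fun _ : Fin (m + 1) => β).summable_iff]
      refine h3.congr fun p => ?_
      rw [Function.comp_apply, he]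
    · rw [← (Fin.consEquiv fun _ : Fin (m + 1) => β).hasSum_iff, pow_succ']
      refine h2.congr_fun fun p => ?_
      rw [Function.comp_apply, he]

lemma hasSum_mul_prod_fin {β : Type*} {A : ℕ → ℝ} {α : ℝ} (hA : Summable fun q => ‖A q‖)
    (hα : HasSum A α) {z : β → ℝ} {ζ : ℝ} (hz : Summable fun b => ‖z b‖)
    (hζ : HasSum z ζ) (m : ℕ) :
    HasSum (fun p : ℕ × (Fin m → β) => A p.1 * ∏ i, z (p.2 i)) (α * ζ ^ m) := by
  have h := hasSum_prod_fin hz hζ m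
  have h1 := summable_mul_of_summable_norm (f := A) (g := fun v : Fin m → β => ∏ i, z (v i)) hA h.1
  have h2 := HasSum.mul hα h.2 h1
  exact h2

lemma summable_index {b : ℕ → ℝ} (hb : ∀ q, 0 ≤ b q) (hbs : Summable b) {β : ℕ+ → ℝ}
    (hβ : ∀ q, 0 ≤ β q) (hβs : Summable β) (hlt : ∑' q, β q < 1) :
    Summable fun ν : Index => b ν.2.1 * ∏ i, β (ν.2.2 i) := by
  have hbn : Summable fun q => ‖b q‖ := hbs.norm
  have hβn : Summable fun q => ‖β q‖ := hβs.norm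
  have h := hasSum_mul_prod_fin hbn hbs.hasSum hβn hβs.hasSum
  rw [summable_sigma_of_nonneg fun ν => mul_nonneg (hb _) (Finset.prod_nonneg fun i _ => hβ _)]
  refine ⟨fun m => (h m).summable, ?_⟩
  simp_rw [fun m => (h m).tsum_eq]
  exact (summable_geometric_of_lt_one (tsum_nonneg hβ) hlt).mul_left _

/-- Grouped by m, the family sums to α(-ζ)^m, a geometric series for α/(1+ζ). Absolute summability
over all indices requires ∑‖z_q‖ < 1, not merely |ζ| < 1. -/
lemma hasSum_index {A : ℕ → ℝ} {α : ℝ} (hA : Summable fun q => ‖A q‖) (hα : HasSum A α)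
    {z : ℕ+ → ℝ} {ζ : ℝ} (hz : Summable fun q => ‖z q‖) (hζ : HasSum z ζ)
    (hlt : ∑' q, ‖z q‖ < 1) :
    HasSum (fun ν : Index => (-1) ^ ν.1 * (A ν.2.1 * ∏ i, z (ν.2.2 i))) (α / (1 + ζ)) := by
  have hs : Summable fun ν : Index => (-1) ^ ν.1 * (A ν.2.1 * ∏ i, z (ν.2.2 i)) := by
    refine Summable.of_norm ((summable_index (fun q => norm_nonneg (A q)) hA
      (fun q => norm_nonneg (z q)) hz hlt).congr fun ν => ?_)
    simp
  have habs : |-ζ| < 1 := by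
    rw [abs_neg, ← hζ.tsum_eq]
    exact (norm_tsum_le_tsum_norm hz).trans_lt hlt
  have hg := (hasSum_geometric_of_abs_lt_one habs).mul_left α
  rw [sub_neg_eq_add, ← div_eq_mul_inv] at hg
  refine HasSum.sigma_of_hasSum hg (fun m => ?_) hs
  have h := (hasSum_mul_prod_fin hA hα hz hζ m).mul_left ((-1) ^ m)
  rwa [mul_left_comm, ← mul_pow, neg_one_mul] at h

/-! ### Eigenfunction expansions -/

lemma hasSum_integral_unit {F : ℕ → ℝ → ℝ} {G : ℝ → ℝ} {b : ℕ → ℝ}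
    (hF : ∀ n, ContinuousOn (F n) I) (hb : Summable b) (hFb : ∀ n, ∀ x ∈ I, |F n x| ≤ b n)
    (hG : ∀ x ∈ I, HasSum (fun n => F n x) (G x)) {y : ℝ} (hy : y ∈ I) :
    HasSum (fun n => ∫ x in (0 : ℝ)..y, F n x) (∫ x in (0 : ℝ)..y, G x) := by
  have hsub : uIoc 0 y ⊆ I := uIoc_subset_uIcc.trans (uIcc_subset_I zero_mem_I hy)
  refine intervalIntegral.hasSum_integral_of_dominated_convergence (fun n _ => b n)
    (fun n => ((hF n).mono hsub).aestronglyMeasurable measurableSet_uIoc)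
    (fun n => Eventually.of_forall fun x hx => hFb n x (hsub hx))
    (Eventually.of_forall fun x _ => hb) intervalIntegrable_const
    (Eventually.of_forall fun x hx => hG x (hsub hx))

section Expansion

variable {V : ℝ → ℝ} (hV : ContinuousOn V I) (hVpos : ∀ x ∈ I, 0 < V x)
include hV hVpos

lemma abs_eigfun_le (q : ℕ) {x : ℝ} (hx : x ∈ I) : |eigfun V q x| ≤ 1 + √(eigval V q) :=
  (isEigenpair_eigfun hV hVpos q).abs_le hV hVpos (integral_eigfun_sq hV hVpos q) hx

lemma abs_deriv_eigfun_le {C : ℝ} (hC : ∀ x ∈ I, |V x| ≤ C) (q : ℕ) {x : ℝ} (hx : x ∈ I) :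
    |derivWithin (eigfun V q) I x| ≤ C + eigval V q := by
  have h := (isEigenpair_eigfun hV hVpos q).abs_deriv_le hV hC (integral_eigfun_sq hV hVpos q) hx
  rwa [abs_of_pos (eigval_pos hV hVpos q)] at h

/-- The series converges uniformly to a continuous function with the same coefficients as f, hence
to f by completeness. -/
lemma hasSum_eigfun {f : ℝ → ℝ} (hf : ContinuousOn f I)
    (hs : Summable fun q => |coeff V q f| * (1 + √(eigval V q))) {x : ℝ} (hx : x ∈ I) :
    HasSum (fun q => coeff V q f * eigfun V q x) (f x) := by
  have hc := fun q => continuousOn_eigfun hV hVpos q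
  have hbd : ∀ q, ∀ x ∈ I, |coeff V q f * eigfun V q x| ≤
      |coeff V q f| * (1 + √(eigval V q)) := fun q x hx => by
    rw [abs_mul]
    exact mul_le_mul_of_nonneg_left (abs_eigfun_le hV hVpos q hx) (abs_nonneg _)
  have hsum : ∀ x ∈ I, Summable fun q => coeff V q f * eigfun V q x := fun x hx =>
    Summable.of_norm_bounded hs fun q => hbd q x hx
  set W : ℝ → ℝ := fun x => ∑' q, coeff V q f * eigfun V q x with hW
  have hWc : ContinuousOn W I :=
    continuousOn_tsum (fun q => continuousOn_const.mul (hc q)) hs hbd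
  have hcoef : ∀ p, coeff V p W = coeff V p f := by
    intro p
    obtain ⟨B, hB⟩ := isCompact_Icc.exists_bound_of_continuousOn (hc p)
    have h1 := hasSum_integral_unit (F := fun q x => eigfun V p x * (coeff V q f * eigfun V q x))
      (G := fun x => eigfun V p x * W x) (fun q => (hc p).mul (continuousOn_const.mul (hc q)))
      (hs.mul_left B) (fun q x hx => by
        rw [abs_mul]
        exact mul_le_mul (hB x hx) (hbd q x hx) (abs_nonneg _) ((norm_nonneg _).trans (hB x hx)))
      (fun x hx => (hsum x hx).hasSum.mul_left _) one_mem_I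
    have h2 : ∀ q, ∫ x in (0 : ℝ)..1, eigfun V p x * (coeff V q f * eigfun V q x) =
        if q = p then coeff V p f else 0 := fun q => by
      have h3 := coeff_const_mul (V := V) p (coeff V q f) (eigfun V q)
      rw [coeff_eigfun hV hVpos] at h3
      refine h3.trans ?_
      by_cases h : p = q
      · simp [h]
      · simp [h, Ne.symm h]
    simp_rw [h2] at h1
    exact h1.unique (hasSum_ite_eq p _)
  have h0 := eqOn_zero_of_coeff_eq_zero hV hVpos (f := fun x => W x - f x) (hWc.sub hf)
    (fun p => by rw [coeff_sub hV hVpos p hWc hf, hcoef, sub_self]) x hx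
  rw [← sub_eq_zero.1 h0]
  exact (hsum x hx).hasSum

/-- Integrating the derivative series termwise gives f - f(0), so its continuous sum is f'. -/
lemma hasSum_deriv_eigfun {f f' : ℝ → ℝ} (hf : HasDerivOnI f f') {C : ℝ}
    (hC : ∀ x ∈ I, |V x| ≤ C)
    (hs : Summable fun q => |coeff V q f| * (1 + √(eigval V q)))
    (hs' : Summable fun q => |coeff V q f| * (C + eigval V q)) {x : ℝ} (hx : x ∈ I) :
    HasSum (fun q => coeff V q f * derivWithin (eigfun V q) I x) (f' x) := by
  have hpair := fun q => isEigenpair_eigfun hV hVpos q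
  have hc := fun q => (hpair q).continuousOn_deriv
  have hbd : ∀ q, ∀ x ∈ I, |coeff V q f * derivWithin (eigfun V q) I x| ≤
      |coeff V q f| * (C + eigval V q) := fun q x hx => by
    rw [abs_mul]
    exact mul_le_mul_of_nonneg_left (abs_deriv_eigfun_le hV hVpos hC q hx) (abs_nonneg _)
  have hsum : ∀ x ∈ I, Summable fun q => coeff V q f * derivWithin (eigfun V q) I x :=
    fun x hx => Summable.of_norm_bounded hs' fun q => hbd q x hx
  set W : ℝ → ℝ := fun x => ∑' q, coeff V q f * derivWithin (eigfun V q) I x with hW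
  have hWc : ContinuousOn W I :=
    continuousOn_tsum (fun q => continuousOn_const.mul (hc q)) hs' hbd
  have hint : ∀ y ∈ I, ∫ x in (0 : ℝ)..y, W x = f y - f 0 := by
    intro y hy
    have h1 := hasSum_integral_unit (F := fun q x => coeff V q f * derivWithin (eigfun V q) I x)
      (fun q => continuousOn_const.mul (hc q)) hs' hbd (fun x hx => (hsum x hx).hasSum) hy
    have h2 := (hasSum_eigfun hV hVpos hf.continuousOn hs hy).sub
      (hasSum_eigfun hV hVpos hf.continuousOn hs zero_mem_I)
    refine h1.unique ?_
    refine h2.congr_fun fun q => ?_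
    rw [intervalIntegral.integral_const_mul, (hpair q).deriv.integral_eq (hc q) zero_mem_I hy]
    ring
  have hd : HasDerivWithinAt f (W x) I x := by
    have h1 := (hasDerivOnI_primitive hWc x hx).add_const (f 0)
    refine h1.congr_of_mem (fun y hy => ?_) hx
    rw [hint y hy]; ring
  have heq : f' x = W x :=
    (uniqueDiffOn_Icc zero_lt_one x hx).eq_deriv _ (hf x hx) hd
  rw [heq]
  exact (hsum x hx).hasSum

end Expansion

/-! ### Convergence of the Koopman decomposition -/

/-- The normalised coefficients of the Cole-Hopf transform of the orbit at time `t`. -/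
noncomputable def normCoeff (V : ℝ → ℝ) (u₀ : L2) (t : ℝ) (q : ℕ) : ℝ :=
  Real.exp (-(eigval V q - eigval V 0) * t) * (coeff V q (coleHopf u₀) / coeff V 0 (coleHopf u₀))

/-- λ_ν is additive over the entries of ν, so each exponential joins its own coefficient ratio. -/
lemma exp_mul_phi (V : ℝ → ℝ) (u₀ : L2) (t : ℝ) (ν : Index) :
    Real.exp (-lam V ν * t) * phi V ν u₀ =
      normCoeff V u₀ t ν.2.1 * ∏ i, normCoeff V u₀ t (ν.2.2 i) := by
  have h : -lam V ν * t = -(eigval V ν.2.1 - eigval V 0) * t +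
      ∑ i, -(eigval V (ν.2.2 i) - eigval V 0) * t := by
    rw [lam, ← Finset.sum_mul, Finset.sum_neg_distrib]; ring
  rw [h, Real.exp_add, Real.exp_sum, phi]
  simp only [normCoeff, Finset.prod_mul_distrib]
  ring

section Koopman

variable {V : ℝ → ℝ} (hV : ContDiffOn ℝ 1 V I) (hVpos : ∀ x ∈ I, 0 < V x) (u₀ : L2)
include hV hVpos

lemma coeff_zero_coleHopf_pos : 0 < coeff V 0 (coleHopf u₀) :=
  (m0_spec hV.continuousOn hVpos).1.trans_le
    (m0_le_coeff_coleHopf hV.continuousOn hVpos (integrable_of_L2 u₀))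

lemma summable_normCoeff_mul {t : ℝ} (ht : 0 < t) {g : ℕ → ℝ} {k : ℝ} (hg0 : ∀ q, 0 ≤ g q)
    (hg : ∀ q, g q ≤ k + eigval V q) : Summable fun q => |normCoeff V u₀ t q| * g q := by
  have hVc := hV.continuousOn
  have hc0 := coeff_zero_coleHopf_pos hV hVpos u₀
  have hHc := continuousOn_coleHopf (integrable_of_L2 u₀)
  obtain ⟨B, hB⟩ := isCompact_Icc.exists_bound_of_continuousOn hHc
  have h0 := summable_eigval_pow_mul_exp hVc hVpos 0 ht
  have h1 := summable_eigval_pow_mul_exp hVc hVpos 1 ht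
  refine Summable.of_nonneg_of_le (fun q => mul_nonneg (abs_nonneg _) (hg0 q)) (fun q => ?_)
    (((h0.mul_left k).add h1).mul_left (B / coeff V 0 (coleHopf u₀)))
  have h2 := abs_coeff_le hVc hVpos q hHc hB
  have h3 : |normCoeff V u₀ t q| ≤ Real.exp (-(eigval V q - eigval V 0) * t) *
      (B / coeff V 0 (coleHopf u₀)) := by
    rw [normCoeff, abs_mul, Real.abs_exp, abs_div, abs_of_pos hc0]
    gcongr
  refine (mul_le_mul h3 (hg q) (hg0 q) ((abs_nonneg _).trans h3)).trans_eq ?_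
  ring

lemma summable_normCoeff_mul_sqrt {t : ℝ} (ht : 0 < t) :
    Summable fun q => |normCoeff V u₀ t q| * (1 + √(eigval V q)) := by
  refine summable_normCoeff_mul hV hVpos u₀ ht (k := 2) (fun q => by positivity) fun q => ?_
  have := Real.sq_sqrt (eigval_pos hV.continuousOn hVpos q).le
  nlinarith [sq_nonneg (√(eigval V q) - 1)]

/-- Cauchy-Schwarz splits the sum into h₅(t) and the L² norm of the part of H orthogonal to e_0. One
factor 1/m_0 is explicit, for the later division by e_0(x); the other bounds 1/c_0(H). -/
lemma tsum_normCoeff_lt {t : ℝ} (ht : 0 < t)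
    (hlt : h5 V t * dist0 V u₀ < ENNReal.ofReal (m0 V ^ 2)) :
    ∑' q : ℕ+, |normCoeff V u₀ t q| * (1 + √(eigval V q)) / m0 V < 1 := by
  have hVc := hV.continuousOn
  have hm := (m0_spec hVc hVpos).1
  have hc0 := coeff_zero_coleHopf_pos hV hVpos u₀
  have hmc := m0_le_coeff_coleHopf hVc hVpos (integrable_of_L2 u₀)
  have hHc := continuousOn_coleHopf (integrable_of_L2 u₀)
  set H := coleHopf u₀ with hH
  set D := ∫ x in (0 : ℝ)..1, (H x - coeff V 0 H * eigfun V 0 x) ^ 2 with hD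
  have hsum := hasSum_coeff_sq_sub hVc hVpos hHc (coeff V 0 H)
  rw [sub_self, zero_pow two_ne_zero, sub_zero, ← hD] at hsum
  have hdist : dist0 V u₀ = ENNReal.ofReal (√D) :=
    eLpNorm_eq_sqrt_integral (hHc.sub (continuousOn_const.mul (continuousOn_eigfun hVc hVpos 0)))
  have hreal : √(h5Sq V t) * √D < m0 V ^ 2 := by
    rw [hdist, h5_eq hVc hVpos ht, ← ENNReal.ofReal_mul (Real.sqrt_nonneg _)] at hlt
    exact (ENNReal.ofReal_lt_ofReal_iff (by positivity)).1 hlt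
  have hpart : ∀ s : Finset ℕ, ∑ q ∈ s,
      |normCoeff V u₀ t (q + 1)| * (1 + √(eigval V (q + 1))) / m0 V ≤
        √(h5Sq V t) * √D / m0 V ^ 2 := by
    intro s
    have h1 : ∑ q ∈ s, √(h5Term V t q) * |coeff V (q + 1) H| ≤ √(h5Sq V t) * √D := by
      refine (Real.sum_mul_le_sqrt_mul_sqrt s _ _).trans ?_
      refine mul_le_mul (Real.sqrt_le_sqrt ?_) (Real.sqrt_le_sqrt ?_) (Real.sqrt_nonneg _)
        (Real.sqrt_nonneg _)
      · simp_rw [Real.sq_sqrt (h5Term_pos t _).le]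
        exact (summable_h5Term hVc hVpos ht).sum_le_tsum s fun q _ => (h5Term_pos t q).le
      · simp_rw [sq_abs]
        exact sum_le_hasSum s (fun q _ => sq_nonneg _) hsum
    have h2 : ∀ q, |normCoeff V u₀ t (q + 1)| * (1 + √(eigval V (q + 1))) / m0 V ≤
        √(h5Term V t q) * |coeff V (q + 1) H| / m0 V ^ 2 := by
      intro q
      have h3 : √(h5Term V t q) =
          Real.exp (-(eigval V (q + 1) - eigval V 0) * t) * (1 + √(eigval V (q + 1))) := by
        rw [h5Term, show -2 * (eigval V (q + 1) - eigval V 0) * t =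
          -(eigval V (q + 1) - eigval V 0) * t + -(eigval V (q + 1) - eigval V 0) * t by ring,
          Real.exp_add, ← sq, ← mul_pow, Real.sqrt_sq (by positivity)]
      rw [h3, normCoeff, abs_mul, Real.abs_exp, abs_div, abs_of_pos hc0, ← hH]
      calc _ = Real.exp (-(eigval V (q + 1) - eigval V 0) * t) * (1 + √(eigval V (q + 1))) *
            |coeff V (q + 1) H| / (coeff V 0 H * m0 V) := by field_simp
        _ ≤ _ := by
          rw [sq]
          gcongr
    calc _ ≤ ∑ q ∈ s, √(h5Term V t q) * |coeff V (q + 1) H| / m0 V ^ 2 :=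
          Finset.sum_le_sum fun q _ => h2 q
      _ ≤ _ := by
        rw [← Finset.sum_div]
        gcongr
  rw [tsum_pnat_eq_tsum_succ (f := fun q : ℕ => |normCoeff V u₀ t q| * (1 + √(eigval V q)) / m0 V)]
  refine (Real.tsum_le_of_sum_le (fun q => by positivity) hpart).trans_lt ?_
  rw [div_lt_one (by positivity)]
  exact hreal

/-- The orbit as a quotient of two eigenfunction expansions. -/
lemma IsBurgersSolution.hasSum_index {u : ℝ → ℝ → ℝ} {u₀ : L2} (hu : IsBurgersSolution V u₀ u)
    {t : ℝ} (ht : 0 < t) (hlt : h5 V t * dist0 V u₀ < ENNReal.ofReal (m0 V ^ 2)) {x : ℝ}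
    (hx : x ∈ I) :
    HasSum (fun ν => Real.exp (-lam V ν * t) * phi V ν u₀ * mode V ν x) (u t x) := by
  have hVc := hV.continuousOn
  obtain ⟨hm, hme⟩ := m0_spec hVc hVpos
  have he0 := eigfun_zero_pos hVc hVpos x hx
  obtain ⟨C, hC⟩ := isCompact_Icc.exists_bound_of_continuousOn hVc
  have hC0 : 0 ≤ C := (norm_nonneg _).trans (hC 0 zero_mem_I)
  have huc := hu.continuousOn ht
  set w := expPrim (u t) with hw
  have hwd := hasDerivOnI_expPrim huc
  have hwc := hwd.continuousOn
  set k := coeff V 0 w with hk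
  have hkpos : 0 < k := coeff_zero_pos hVc hVpos hwc fun x _ => expPrim_pos _ x
  set a := normCoeff V u₀ t with ha
  have hcoef : ∀ q, coeff V q w = k * a q := fun q => by
    have h := hu.coeff_div hV hVpos ht q
    rw [← hw, div_eq_iff hkpos.ne'] at h
    rw [h, ha, normCoeff]; ring
  have hs := summable_normCoeff_mul_sqrt hV hVpos u₀ ht
  have hs' := summable_normCoeff_mul hV hVpos u₀ ht (k := C) (g := fun q => C + eigval V q)
    (fun q => add_nonneg hC0 (eigval_pos hVc hVpos q).le) fun q => le_rfl
  have hsw : Summable fun q => |coeff V q w| * (1 + √(eigval V q)) :=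
    (hs.mul_left k).congr fun q => by rw [hcoef, abs_mul, abs_of_pos hkpos]; ring
  have hsw' : Summable fun q => |coeff V q w| * (C + eigval V q) :=
    (hs'.mul_left k).congr fun q => by rw [hcoef, abs_mul, abs_of_pos hkpos]; ring
  have h1 := (hasSum_eigfun hVc hVpos hwc hsw hx).div_const (k * eigfun V 0 x)
  have h2 := (hasSum_deriv_eigfun hVc hVpos hwd hC hsw hsw' hx).div_const (k * eigfun V 0 x)
  set z : ℕ → ℝ := fun q => a q * (eigfun V q x / eigfun V 0 x) with hz
  set A : ℕ → ℝ := fun q => a q * (derivWithin (eigfun V q) I x / eigfun V 0 x) with hA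
  have h1' : HasSum z (w x / (k * eigfun V 0 x)) := h1.congr_fun fun q => by
    have hq : coeff V q (expPrim (u t)) = k * a q := hcoef q
    simp only [hz]
    rw [hq]
    field_simp
  have h2' : HasSum A (-(1 / 2) * u t x * w x / (k * eigfun V 0 x)) := h2.congr_fun fun q => by
    have hq : coeff V q (expPrim (u t)) = k * a q := hcoef q
    simp only [hA]
    rw [hq]
    field_simp
  -- The zeroth term is the 1 in 1 + ∑_{q≥1} z_q, which is why q_1, …, q_m run over positive
  -- integers only.
  have hz0 : z 0 = 1 := by
    have h3 := hcoef 0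
    have h4 : a 0 = 1 := by
      rw [← hk] at h3
      exact mul_left_cancel₀ hkpos.ne' (by rw [mul_one]; exact h3.symm)
    simp only [hz, h4, one_mul]
    exact div_self he0.ne'
  have hz1 : HasSum (fun q : ℕ+ => z q) (w x / (k * eigfun V 0 x) - 1) := by
    rw [← Equiv.pnatEquivNat.symm.hasSum_iff]
    have h3 := (hasSum_nat_add_iff' 1).2 h1'
    rw [Finset.sum_range_one, hz0] at h3
    exact h3
  have hle : ∀ q, ‖z q‖ ≤ |a q| * (1 + √(eigval V q)) / m0 V := fun q => by
    simp only [hz, norm_mul, norm_div, Real.norm_eq_abs]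
    rw [abs_of_pos he0, ← mul_div_assoc]
    gcongr
    · exact abs_eigfun_le hVc hVpos q hx
    · exact hme x hx
  have hzs : Summable fun q : ℕ+ => |a q| * (1 + √(eigval V q)) / m0 V := by
    rw [← Equiv.pnatEquivNat.symm.summable_iff]
    exact (summable_nat_add_iff 1).2 (hs.div_const (m0 V))
  have hzn : Summable fun q : ℕ+ => ‖z q‖ :=
    Summable.of_nonneg_of_le (fun q => norm_nonneg _) (fun q => hle q) hzs
  have hzlt : ∑' q : ℕ+, ‖z q‖ < 1 :=
    (Summable.tsum_le_tsum (f := fun q : ℕ+ => ‖z q‖) (fun q : ℕ+ => hle q) hzn hzs).trans_lt (tsum_normCoeff_lt hV hVpos u₀ ht hlt)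
  have hAn : Summable fun q => ‖A q‖ := by
    refine Summable.of_nonneg_of_le (fun q => norm_nonneg _) (fun q => ?_)
      (hs'.div_const (eigfun V 0 x))
    simp only [hA, norm_mul, norm_div, Real.norm_eq_abs]
    rw [abs_of_pos he0, ← mul_div_assoc]
    gcongr
    exact abs_deriv_eigfun_le hVc hVpos hC q hx
  -- The factor -2 from u = -2 w_x/w combines with (-1)^m into the 2(-1)^{m+1} of the modes.
  have hfin := (BurgersKoopman.hasSum_index hAn h2' hzn hz1 hzlt).mul_left (-2)
  have hval : -2 * (-(1 / 2) * u t x * w x / (k * eigfun V 0 x) /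
      (1 + (w x / (k * eigfun V 0 x) - 1))) = u t x := by
    have hwx : w x ≠ 0 := (expPrim_pos (u t) x).ne'
    rw [add_sub_cancel]
    field_simp
  rw [hval] at hfin
  refine hfin.congr_fun fun ν => ?_
  rw [exp_mul_phi, mode]
  simp only [hA, hz, Finset.prod_mul_distrib]
  ring

/-- Weierstrass test: M bounds the sup norm of each mode by a product over the entries of ν, so the
majorants sum as a geometric series. The uniform limit is identified through the pointwise sum. -/
theorem koopmanConvergesAbsolutely_of_lt {t : ℝ} (ht : 0 < t)
    (hlt : h5 V t * dist0 V u₀ < ENNReal.ofReal (m0 V ^ 2)) :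
    KoopmanConvergesAbsolutely V u₀ t := by
  have hVc := hV.continuousOn
  obtain ⟨hm, hme⟩ := m0_spec hVc hVpos
  obtain ⟨C, hC⟩ := isCompact_Icc.exists_bound_of_continuousOn hVc
  have hC0 : 0 ≤ C := (norm_nonneg _).trans (hC 0 zero_mem_I)
  have hpos := eigval_pos hVc hVpos
  set a := normCoeff V u₀ t with ha
  set M : Index → ℝ := fun ν => 2 * ((C + eigval V ν.2.1) / m0 V) *
    ∏ i, ((1 + √(eigval V (ν.2.2 i))) / m0 V) with hM
  have hmode : ∀ ν, ∀ x ∈ I, |mode V ν x| ≤ M ν := by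
    intro ν x hx
    have he0 := eigfun_zero_pos hVc hVpos x hx
    rw [mode, abs_mul, Finset.abs_prod, abs_mul, abs_mul, abs_pow, abs_neg, abs_one, one_pow,
      mul_one, abs_two, abs_div, abs_of_pos he0]
    refine mul_le_mul ?_ ?_ (Finset.prod_nonneg fun i _ => abs_nonneg _) ?_
    · gcongr
      · exact add_nonneg hC0 (hpos _).le
      · exact abs_deriv_eigfun_le hVc hVpos hC _ hx
      · exact hme x hx
    · refine Finset.prod_le_prod (fun i _ => abs_nonneg _) fun i _ => ?_
      rw [abs_div, abs_of_pos he0]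
      gcongr
      · exact abs_eigfun_le hVc hVpos _ hx
      · exact hme x hx
    · have := (hpos ν.2.1).le
      positivity
  have hs := summable_normCoeff_mul_sqrt hV hVpos u₀ ht
  have hs' := summable_normCoeff_mul hV hVpos u₀ ht (k := C) (g := fun q => C + eigval V q)
    (fun q => add_nonneg hC0 (hpos q).le) fun q => le_rfl
  have hzs : Summable fun q : ℕ+ => |a q| * (1 + √(eigval V q)) / m0 V := by
    rw [← Equiv.pnatEquivNat.symm.summable_iff]
    exact (summable_nat_add_iff 1).2 (hs.div_const (m0 V))
  have hsumm : Summable fun ν => Real.exp (-lam V ν * t) * |phi V ν u₀| * M ν := by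
    refine ((summable_index (fun q => ?_) (hs'.div_const (m0 V)) (fun q => ?_) hzs
      (tsum_normCoeff_lt hV hVpos u₀ ht hlt)).mul_left 2).congr fun ν => ?_
    · have := (hpos q).le
      positivity
    · positivity
    · rw [← Real.abs_exp (-lam V ν * t), ← abs_mul, exp_mul_phi, abs_mul, Finset.abs_prod, hM]
      simp only [div_eq_mul_inv, Finset.prod_mul_distrib]
      ring
  constructor
  · have hle : ∀ ν, ENNReal.ofReal (Real.exp (-lam V ν * t) * |phi V ν u₀|) *
        ⨆ x ∈ I, ENNReal.ofReal |mode V ν x| ≤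
        ENNReal.ofReal (Real.exp (-lam V ν * t) * |phi V ν u₀| * M ν) := fun ν => by
      rw [ENNReal.ofReal_mul (q := M ν) (by positivity)]
      gcongr
      exact iSup₂_le fun x hx => ENNReal.ofReal_le_ofReal (hmode ν x hx)
    exact (ENNReal.tsum_le_tsum hle).trans_lt hsumm.tsum_ofReal_lt_top
  · intro u hu
    have h := HasSumUniformlyOn.of_norm_le_summable hsumm (s := I)
      (f := fun ν x => Real.exp (-lam V ν * t) * phi V ν u₀ * mode V ν x) fun ν x hx => by
        rw [norm_mul, norm_mul, Real.norm_eq_abs, Real.abs_exp, Real.norm_eq_abs,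
          Real.norm_eq_abs]
        exact mul_le_mul_of_nonneg_left (hmode ν x hx) (by positivity)
    rw [hasSumUniformlyOn_iff_tendstoUniformlyOn] at h ⊢
    exact h.congr_right fun x hx => (hu.hasSum_index hV hVpos ht hlt hx).tsum_eq

end Koopman

/-! ### The neighbourhoods of the sink -/

section Sink

variable {V : ℝ → ℝ} (hV : ContinuousOn V I) (hVpos : ∀ x ∈ I, 0 < V x)
include hV hVpos

/-- Among multiples of e_0, the orthogonal projection c_0(H)e_0 is closest to H, and f̃₀ is such a
multiple. -/
lemma dist0_le (u₀ : L2) :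
    dist0 V u₀ ≤ eLpNorm (fun x => coleHopf u₀ x - heatSink V x) 2 vol := by
  have he := continuousOn_eigfun hV hVpos 0
  have hHc := continuousOn_coleHopf (integrable_of_L2 u₀)
  set b := (∫ y in (0 : ℝ)..1, eigfun V 0 y)⁻¹ with hb
  have hsink : ∀ x, heatSink V x = b * eigfun V 0 x := fun x => by
    rw [heatSink, div_eq_inv_mul]
  simp_rw [hsink]
  rw [dist0, eLpNorm_eq_sqrt_integral (f := fun x => coleHopf u₀ x - b * eigfun V 0 x)
    (hHc.sub (continuousOn_const.mul he)),
    eLpNorm_eq_sqrt_integral (f := fun x => coleHopf u₀ x - coeff V 0 (coleHopf u₀) *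
      eigfun V 0 x) (hHc.sub (continuousOn_const.mul he))]
  refine ENNReal.ofReal_le_ofReal (Real.sqrt_le_sqrt ?_)
  have h1 := hasSum_coeff_sq_sub hV hVpos hHc (coeff V 0 (coleHopf u₀))
  have h2 := hasSum_coeff_sq_sub hV hVpos hHc b
  have h3 := h1.unique h2
  rw [sub_self, zero_pow two_ne_zero, sub_zero] at h3
  rw [h3]
  linarith [sq_nonneg (coeff V 0 (coleHopf u₀) - b)]

lemma continuousOn_burgersSink : ContinuousOn (burgersSink V) I :=
  continuousOn_const.mul ((continuousOn_deriv_eigfun hV hVpos 0).div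
    (continuousOn_eigfun hV hVpos 0) fun x hx => (eigfun_zero_pos hV hVpos x hx).ne')

/-- The Cole-Hopf transform maps the sink of the Burgers flow to that of the heat flow. -/
lemma coleHopf_burgersSink {x : ℝ} (hx : x ∈ I) : coleHopf (burgersSink V) x = heatSink V x := by
  have hpos := eigfun_zero_pos hV hVpos
  have hpair := isEigenpair_eigfun hV hVpos 0
  have hexp : ∀ y ∈ I, expPrim (burgersSink V) y = (eigfun V 0 0)⁻¹ * eigfun V 0 y := by
    intro y hy
    have hd : HasDerivOnI (fun x => -2 * Real.log (eigfun V 0 x)) (burgersSink V) :=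
      fun z hz => ((hpair.deriv z hz).log (hpos z hz).ne').const_mul (-2)
    rw [expPrim, hd.integral_eq (continuousOn_burgersSink hV hVpos) zero_mem_I hy]
    have : -(1 / 2) * (-2 * Real.log (eigfun V 0 y) - -2 * Real.log (eigfun V 0 0)) =
        Real.log (eigfun V 0 y) - Real.log (eigfun V 0 0) := by ring
    rw [this, Real.exp_sub, Real.exp_log (hpos y hy), Real.exp_log (hpos 0 zero_mem_I),
      div_eq_inv_mul]
  have h0 := (hpos 0 zero_mem_I).ne'
  rw [coleHopf_eq, integral_unit_congr hexp, hexp x hx, intervalIntegral.integral_const_mul,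
    heatSink, mul_inv, inv_inv, div_eq_inv_mul]
  field_simp

/-- The transform is continuous at s₀ with value f̃₀, and the radius is positive because h₅(θ) is
finite for θ > 0. -/
lemma Omega_mem_nhds {s₀ : L2} (hs : s₀ =ᵐ[vol] burgersSink V) {θ : ℝ} (hθ : 0 < θ) :
    Omega V θ ∈ 𝓝 s₀ := by
  have hlog : ∀ y ∈ I, expPrim s₀ y = expPrim (burgersSink V) y := by
    intro y hy
    rw [expPrim, expPrim]
    congr 2
    rw [intervalIntegral.integral_of_le hy.1, intervalIntegral.integral_of_le hy.1]
    refine setIntegral_congr_ae measurableSet_Ioc ?_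
    have h1 := (ae_restrict_iff' measurableSet_Icc).1 hs
    filter_upwards [h1] with z hz hzy
    exact hz ⟨hzy.1.le, hzy.2.trans hy.2⟩
  have hH : ∀ x ∈ I, coleHopf s₀ x = heatSink V x := fun x hx => by
    rw [← coleHopf_burgersSink hV hVpos hx, coleHopf_eq, coleHopf_eq, integral_unit_congr hlog,
      hlog x hx]
  have hHc := continuousOn_coleHopf (integrable_of_L2 s₀)
  obtain ⟨B, hB⟩ := isCompact_Icc.exists_bound_of_continuousOn hHc
  have hlim : Tendsto (fun u : L2 => eLpNorm (fun x => coleHopf u x - heatSink V x) 2 vol)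
      (𝓝 s₀) (𝓝 0) := by
    have h1 : ∀ u : L2, eLpNorm (fun x => coleHopf u x - heatSink V x) 2 vol ≤
        ENNReal.ofReal ((Real.exp ‖u - s₀‖ - 1) * B) := by
      intro u
      have hn : (eLpNorm (fun s => u s - s₀ s) 2 vol).toReal = ‖u - s₀‖ := by
        rw [Lp.norm_def]
        congr 1
        exact eLpNorm_congr_ae (Lp.coeFn_sub u s₀).symm
      have h2 : ∀ᵐ x ∂vol, ‖coleHopf u x - heatSink V x‖ ≤ (Real.exp ‖u - s₀‖ - 1) * B := by
        refine (ae_restrict_iff' measurableSet_Icc).2 (Eventually.of_forall fun x hx => ?_)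
        rw [← hH x hx, Real.norm_eq_abs, ← hn]
        refine (abs_coleHopf_sub_le (Lp.memLp u) (Lp.memLp s₀) hx).trans ?_
        refine mul_le_mul_of_nonneg_left ((le_abs_self _).trans (hB x hx)) ?_
        exact sub_nonneg.2 (Real.one_le_exp ENNReal.toReal_nonneg)
      refine (eLpNorm_le_of_ae_bound h2).trans_eq ?_
      simp
    have h2 : Tendsto (fun u : L2 => ENNReal.ofReal ((Real.exp ‖u - s₀‖ - 1) * B)) (𝓝 s₀)
        (𝓝 0) := by
      have : Continuous fun u : L2 => ENNReal.ofReal ((Real.exp ‖u - s₀‖ - 1) * B) :=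
        ENNReal.continuous_ofReal.comp (by fun_prop)
      simpa using this.tendsto s₀
    exact tendsto_of_tendsto_of_tendsto_of_le_of_le tendsto_const_nhds h2 (fun _ => zero_le) h1
  have hpos : 0 < ENNReal.ofReal (m0 V ^ 2) / h5 V θ := by
    rw [h5_eq hV hVpos hθ]
    exact ENNReal.div_pos (ENNReal.ofReal_pos.2 (pow_pos (m0_spec hV hVpos).1 2)).ne'
      ENNReal.ofReal_ne_top
  exact hlim.eventually (gt_mem_nhds hpos)

end Sink

end BurgersKoopman

open BurgersKoopman

theorem mainTheorem3 (V : ℝ → ℝ) (hV : ContDiffOn ℝ 1 V BurgersKoopman.I)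
    (hVpos : ∀ x ∈ BurgersKoopman.I, 0 < V x) :
    (∀ u₀ : BurgersKoopman.L2,
      (∃! τ : ℝ, BurgersKoopman.IsThresholdTime V u₀ τ) ∧
      ∀ τ : ℝ, BurgersKoopman.IsThresholdTime V u₀ τ →
        ∀ t > τ, BurgersKoopman.KoopmanConvergesAbsolutely V u₀ t) ∧
    (∃ s₀ : BurgersKoopman.L2, s₀ =ᵐ[BurgersKoopman.vol] BurgersKoopman.burgersSink V ∧
      ∀ θ₀ > 0, BurgersKoopman.Omega V θ₀ ∈ 𝓝 s₀) ∧
    (∀ θ₀ > 0, ∀ u₀ ∈ BurgersKoopman.Omega V θ₀,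
      ∀ t > θ₀, BurgersKoopman.KoopmanConvergesAbsolutely V u₀ t) := by
  have hVc := hV.continuousOn
  have hm : ENNReal.ofReal (m0 V ^ 2) ≠ 0 :=
    (ENNReal.ofReal_pos.2 (pow_pos (m0_spec hVc hVpos).1 2)).ne'
  refine ⟨fun u₀ => ⟨?_, fun τ hτ t ht => ?_⟩, ?_, fun θ₀ hθ₀ u₀ hu₀ t ht => ?_⟩
  · refine existsUnique_h5_eq hVc hVpos (ENNReal.div_pos hm ?_).ne'
    have he := continuousOn_eigfun hVc hVpos 0
    have hHc := continuousOn_coleHopf (integrable_of_L2 u₀)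
    rw [dist0, eLpNorm_eq_sqrt_integral (f := fun x => coleHopf u₀ x -
      coeff V 0 (coleHopf u₀) * eigfun V 0 x) (hHc.sub (continuousOn_const.mul he))]
    exact ENNReal.ofReal_ne_top
  -- Strict decrease of h₅ turns the threshold equation into the strict smallness condition at every
  -- later time.
  · have hlt := h5_lt hVc hVpos hτ.1 ht
    rw [hτ.2] at hlt
    exact koopmanConvergesAbsolutely_of_lt hV hVpos u₀ (hτ.1.trans_lt ht)
      (ENNReal.mul_lt_of_lt_div hlt)
  · have hc := continuousOn_burgersSink hVc hVpos
    have hmem : MemLp (burgersSink V) 2 vol :=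
      (memLp_two_iff_integrable_sq (hc.aestronglyMeasurable measurableSet_Icc)).2
        (hc.pow 2).integrableOn_Icc
    exact ⟨hmem.toLp _, hmem.coeFn_toLp, fun θ₀ hθ₀ =>
      Omega_mem_nhds hVc hVpos hmem.coeFn_toLp hθ₀⟩
  · refine koopmanConvergesAbsolutely_of_lt hV hVpos u₀ (hθ₀.trans ht) ?_
    have hlt := ENNReal.mul_lt_of_lt_div hu₀
    rw [mul_comm] at hlt
    exact (mul_le_mul' (h5_lt hVc hVpos hθ₀.le ht).le (dist0_le hVc hVpos u₀)).trans_lt hlt
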